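/- **Setting.** Let $\mathbb D=\mathbb D([0,1],\mathbb R)$ be the space of real càdlàg functions on $[0,1]$ with the Skorohod $J_1$ metric $d_{J_1}(f,g)=\inf_{\tau}\max\{\sup_t|f(t)-g(\tau(t))|,\ \sup_t|\tau(t)-t|\}$, the infimum being over all strictly increasing continuous $\tau:[0,1]\to[0,1]$ with $\tau(0)=0$, $\tau(1)=1$, and with its Borel $\sigma$-field. For $j\ge 0$ let $U_j^\uparrow=\{\boldsymbol u\in[0,1]^j: u_1<\dots<u_j\}$ and $$h_j:(\mathbb R\setminus\{0\})^j\times U_j^\uparrow\to\mathbb D,\qquad h_j(\boldsymbol z,\boldsymbol u)(t)=\sum_{i=1}^j z_i\mathbf 1\{u_i\le t\}.$$ Let $\mathbb D_{=j}$ be the image of $h_j$ (so $\mathbb D_{=0}=\{0\}$) and $\mathbb D_{\le j}=\bigcup_{i=0}^j\mathbb D_{=i}$. For a metric space $\mathbb S$ and closed $\mathbb C\subset\mathbb S$, a set $A$ is bounded away from $\mathbb C$ if $\inf\{d(x,y):x\in\mathbb C,\,y\in A\}>0$; $\mathbb M(\mathbb S\setminus\mathbb C)$ is the set of Borel measures on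 $\mathbb S\setminus\mathbb C$ that are finite on Borel sets bounded away from $\mathbb C$; and $\mu_n\to\mu$ in $\mathbb M(\mathbb S\setminus\mathbb C)$ means that $\mu_n,\mu\in\mathbb M(\mathbb S\setminus\mathbb C)$, $\limsup_n\mu_n(F)\le\mu(F)$ for every closed $F$ and $\liminf_n\mu_n(G)\ge\mu(G)$ for every open $G$, both bounded away from $\mathbb C$. A sequence $(a_n)_{n\ge1}$ of positive numbers is in $RV_\beta$ if $a_{\lfloor cn\rfloor}/a_n\to c^\beta$ for all $c>0$. A real random variable $X$ is in $RV_{-\alpha}$ if there are a regularly varying sequence $(\gamma_n)$ and a non-zero $\mu\in\mathbb M(\mathbb R\setminus\{0\})$ with $\gamma_nP(X/n\in\cdot)\to\mu$ in $\mathbb M(\mathbb R\setminus\{0\})$ and $\mu(sA)=s^{-\alpha}\mu(A)$ for all $s>0$ and Borel $A\subset\mathbb R\setminus\{0\}$. **Theorem 3.5.** Let $Z_1,Z_2,\dots$ be iid real random variables with $Z_1\in RV_{-\alpha}$, $\alpha>0$, satisfying the tail balance condition $$\frac{P(Z_1>n)}{P(|Z_1|>n)}\to p,\qquad \frac{P(Z_1<-n)}{P(|Z_1|>n)}\to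 q=1-p$$ for some $p\in[0,1]$, and with $E Z_1=0$ if $E|Z_1|<\infty$. Let $(\lambda_n)\in RV_\rho$ be a sequence with $\lambda_n\to\infty$, where $\rho>1/2$ if $\operatorname{Var}(Z_1)<\infty$, and $\alpha\rho>1$ if $\operatorname{Var}(Z_1)=\infty$. Put $\boldsymbol X^{(n)}(t)=\sum_{k=1}^{n}Z_k\mathbf 1\{k/n\le t\}$ for $t\in[0,1]$, and let $\nu_\alpha$ be the measure on $\mathbb R\setminus\{0\}$ with $\nu_\alpha((-\infty,-y)\cup(x,\infty))=qy^{-\alpha}+px^{-\alpha}$ for $x,y>0$. Then for every $j\ge1$, as $n\to\infty$, $$[nP(|Z_1|>\lambda_n)]^{-j}\,P\bigl(\boldsymbol X^{(n)}/\lambda_n\in\cdot\bigr)\ \to\ (\nu_\alpha^j\times\mathrm{Leb}_j)\circ h_j^{-1}\quad\text{in }\mathbb M(\mathbb D\setminus\mathbb D_{\le j-1}),$$ where $\nu_\alpha^j$ is the $j$-fold product of $\nu_\alpha$ and $\mathrm{Leb}_j$ is Lebesgue measure on $U_j^\uparrow$. -/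

import Mathlib

open MeasureTheory ProbabilityTheory Filter Topology
open scoped ENNReal

noncomputable section

/-! ### The Skorohod space `D([0,1], ℝ)` -/

/-- Real-valued càdlàg functions on `[0,1]`: right-continuous with left limits. -/
@[ext]
structure SkorohodD where
  toFun : unitInterval → ℝ
  right_cts : ∀ t, ContinuousWithinAt toFun (Set.Ici t) t
  left_lim : ∀ t, ∃ l : ℝ, Tendsto toFun (𝓝[<] t) (𝓝 l)

namespace SkorohodD

instance : CoeFun SkorohodD (fun _ => unitInterval → ℝ) := ⟨SkorohodD.toFun⟩

/-- `‖f - g ∘ τ‖ ∨ ‖τ - e‖` (sup norms over `[0,1]`). The order automorphisms `τ` of `[0,1]` are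
exactly the strictly increasing continuous maps `[0,1] → [0,1]` with `τ 0 = 0` and `τ 1 = 1`. -/
def j1Cost (f g : SkorohodD) (τ : unitInterval ≃o unitInterval) : ℝ≥0∞ :=
  max (⨆ t : unitInterval, edist (f t) (g (τ t))) (⨆ t : unitInterval, edist (τ t) t)

/-- The Skorohod `J₁` metric `d(f,g) = inf_τ ‖f - g ∘ τ‖ ∨ ‖τ - e‖`, as an extended distance (it is
finite, since càdlàg functions on `[0,1]` are bounded). -/
instance : PseudoEMetricSpace SkorohodD where
  edist f g := ⨅ τ : unitInterval ≃o unitInterval, j1Cost f g τ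
  edist_self f := by
    refine le_antisymm (iInf_le_of_le (OrderIso.refl unitInterval) ?_) bot_le
    simp [j1Cost]
  edist_comm := by
    have key : ∀ f g : SkorohodD, (⨅ τ : unitInterval ≃o unitInterval, j1Cost f g τ) ≤
        ⨅ τ : unitInterval ≃o unitInterval, j1Cost g f τ := by
      intro f g
      refine le_iInf fun τ => iInf_le_of_le τ.symm (max_le_max ?_ ?_)
      · refine iSup_le fun t => ?_
        refine le_trans (le_of_eq ?_) (le_iSup _ (τ.symm t))
        simp [edist_comm]
      · refine iSup_le fun t => ?_
        refine le_trans (le_of_eq ?_) (le_iSup _ (τ.symm t))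
        simp [edist_comm]
    exact fun f g => le_antisymm (key f g) (key g f)
  edist_triangle f g h := by
    refine ENNReal.le_iInf_add_iInf fun τ τ' => iInf_le_of_le (τ.trans τ') (max_le ?_ ?_)
    · refine iSup_le fun t => (edist_triangle _ (g (τ t)) _).trans (add_le_add ?_ ?_)
      · exact (le_iSup (fun t : unitInterval => edist (f t) (g (τ t))) t).trans (le_max_left _ _)
      · exact (le_iSup (fun t : unitInterval => edist (g t) (h (τ' t))) (τ t)).trans (le_max_left _ _)
    · refine iSup_le fun t => (edist_triangle _ (τ t) _).trans ?_
      rw [add_comm]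
      refine add_le_add ?_ ?_
      · exact (le_iSup (fun t : unitInterval => edist (τ t) t) t).trans (le_max_right _ _)
      · exact (le_iSup (fun t : unitInterval => edist (τ' t) t) (τ t)).trans (le_max_right _ _)

instance : MeasurableSpace SkorohodD := borel SkorohodD

instance : BorelSpace SkorohodD := ⟨rfl⟩

/-- Pointwise multiplication by a real number. -/
instance : SMul ℝ SkorohodD where
  smul c f :=
    { toFun := fun t => c * f t
      right_cts := fun t => (f.right_cts t).const_mul c
      left_lim := fun t => by
        obtain ⟨l, hl⟩ := f.left_lim t
        exact ⟨c * l, hl.const_mul c⟩ }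

end SkorohodD

/-- The step function `t ↦ ∑ i, z i * 1{u i ≤ t}`, with jump sizes `z` and jump times `u`. On the set
`jumpDomain j` this is the map `h_j`. -/
def stepFun {j : ℕ} (z u : Fin j → ℝ) : SkorohodD where
  toFun t := ∑ i, if u i ≤ (t : ℝ) then z i else 0
  right_cts t := by
    refine tendsto_finsetSum _ fun i _ => ?_
    by_cases h : u i ≤ (t : ℝ)
    · refine tendsto_const_nhds.congr' ?_
      filter_upwards [self_mem_nhdsWithin] with s hs
      have hts : (t : ℝ) ≤ s := hs
      rw [if_pos h, if_pos (h.trans hts)]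
    · refine tendsto_const_nhds.congr' ?_
      have hopen : IsOpen {s : unitInterval | (s : ℝ) < u i} :=
        isOpen_lt continuous_subtype_val continuous_const
      filter_upwards [mem_nhdsWithin_of_mem_nhds (hopen.mem_nhds (not_le.mp h))] with s hs
      rw [if_neg h, if_neg (not_le.mpr hs)]
  left_lim t := by
    refine ⟨∑ i, if u i < (t : ℝ) then z i else 0, tendsto_finsetSum _ fun i _ => ?_⟩
    by_cases h : u i < (t : ℝ)
    · refine tendsto_const_nhds.congr' ?_
      have hopen : IsOpen {s : unitInterval | u i < (s : ℝ)} :=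
        isOpen_lt continuous_const continuous_subtype_val
      filter_upwards [mem_nhdsWithin_of_mem_nhds (hopen.mem_nhds h)] with s hs
      rw [if_pos h, if_pos (le_of_lt hs)]
    · refine tendsto_const_nhds.congr' ?_
      filter_upwards [self_mem_nhdsWithin] with s hs
      have hst : (s : ℝ) < t := hs
      rw [if_neg h, if_neg (not_le.mpr (hst.trans_le (not_lt.mp h)))]

/-- `(ℝ \ {0})^j × U_j^↑`, where `U_j^↑ = {u ∈ [0,1]^j : u_1 < ⋯ < u_j}`. -/
def jumpDomain (j : ℕ) : Set ((Fin j → ℝ) × (Fin j → ℝ)) :=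
  {zu | (∀ i, zu.1 i ≠ 0) ∧ (∀ i, zu.2 i ∈ Set.Icc (0 : ℝ) 1) ∧ StrictMono zu.2}

/-- Step functions with exactly `j` jumps: the image of `jumpDomain j` under `h_j`. A non-zero value
at time `0` counts as a jump; for `j = 0` only the zero function remains. -/
def stepExactly (j : ℕ) : Set SkorohodD :=
  (fun zu => stepFun zu.1 zu.2) '' jumpDomain j

/-- Step functions with at most `j` jumps. -/
def stepAtMost (j : ℕ) : Set SkorohodD :=
  ⋃ i ∈ Finset.range (j + 1), stepExactly i

/-! ### Convergence in `M(S \ C)` -/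

/-- `μ` is finite on the Borel sets that are bounded away from `C`. -/
def FiniteAwayFrom {S : Type*} [PseudoEMetricSpace S] [MeasurableSpace S]
    (C : Set S) (μ : Measure S) : Prop :=
  ∀ A : Set S, MeasurableSet A → Metric.AreSeparated C A → μ A < ∞

/-- `μ n → μ₀` in `M(S \ C)`. Measures on `S \ C` are given here by measures on `S`, of which only the
values on sets bounded away from `C` matter. -/
structure TendstoMO {S : Type*} [PseudoEMetricSpace S] [MeasurableSpace S]
    (C : Set S) (μ : ℕ → Measure S) (μ₀ : Measure S) : Prop where
  finite : ∀ n, FiniteAwayFrom C (μ n)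
  finite_limit : FiniteAwayFrom C μ₀
  limsup_le : ∀ F : Set S, IsClosed F → Metric.AreSeparated C F →
    limsup (fun n => μ n F) atTop ≤ μ₀ F
  le_liminf : ∀ G : Set S, IsOpen G → Metric.AreSeparated C G →
    μ₀ G ≤ liminf (fun n => μ n G) atTop

/-! ### Regular variation -/

/-- The sequence `(a n)_{n ≥ 1}` of positive numbers is regularly varying with index `β`:
`a ⌊c n⌋ / a n → c ^ β` for every `c > 0`. -/
def RegVarSeq (a : ℕ → ℝ) (β : ℝ) : Prop :=
  (∀ n, 1 ≤ n → 0 < a n) ∧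
    ∀ c : ℝ, 0 < c → Tendsto (fun n : ℕ => a ⌊c * n⌋₊ / a n) atTop (𝓝 (c ^ β))

/-- The random variable `X` is regularly varying at infinity with index `-α`: for some regularly
varying sequence `γ` and some non-zero `μ` in `M(ℝ \ {0})`, `γ n * P(X / n ∈ ·) → μ` in
`M(ℝ \ {0})`, and `μ (s A) = s ^ (-α) * μ A` for `s > 0` and Borel `A ⊆ ℝ \ {0}`. -/
def RegVarRV {Ω : Type*} [MeasurableSpace Ω] (P : Measure Ω) (X : Ω → ℝ) (α : ℝ) : Prop :=
  ∃ (γ : ℕ → ℝ) (β : ℝ) (μ : Measure ℝ), RegVarSeq γ β ∧ μ {0}ᶜ ≠ 0 ∧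
    TendstoMO {0} (fun n => ENNReal.ofReal (γ n) • P.map (fun ω => X ω / n)) μ ∧
    ∀ s : ℝ, 0 < s → ∀ A : Set ℝ, MeasurableSet A → A ⊆ {0}ᶜ →
      μ ((fun x => s * x) '' A) = ENNReal.ofReal (s ^ (-α)) * μ A

/-- The tail balance condition with right-tail weight `p` and left-tail weight `1 - p`. -/
def TailBalance {Ω : Type*} [MeasurableSpace Ω] (P : Measure Ω) (X : Ω → ℝ) (p : ℝ) : Prop :=
  0 ≤ p ∧ p ≤ 1 ∧
    Tendsto (fun n : ℕ => P.real {ω | (n : ℝ) < X ω} / P.real {ω | (n : ℝ) < |X ω|})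
      atTop (𝓝 p) ∧
    Tendsto (fun n : ℕ => P.real {ω | X ω < -(n : ℝ)} / P.real {ω | (n : ℝ) < |X ω|})
      atTop (𝓝 (1 - p))

/-- The Lebesgue density of `nuAlpha α p`. -/
def nuDensity (α p : ℝ) (x : ℝ) : ℝ≥0∞ :=
  ENNReal.ofReal (if 0 < x then p * (α * x ^ (-α - 1))
    else if x < 0 then (1 - p) * (α * (-x) ^ (-α - 1)) else 0)

/-- The measure `ν_α` on `ℝ \ {0}`, seen as a measure on `ℝ` without mass at `0`; `nuAlpha_tails`
shows that `ν_α ((-∞,-y) ∪ (x,∞)) = (1 - p) y^(-α) + p x^(-α)` for `x, y > 0`. -/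
def nuAlpha (α p : ℝ) : Measure ℝ := volume.withDensity (nuDensity α p)

lemma lintegral_pareto_tail {α c x : ℝ} (hα : 0 < α) (hc : 0 ≤ c) (hx : 0 < x) :
    ∫⁻ t in Set.Ioi x, ENNReal.ofReal (c * (α * t ^ (-α - 1))) =
      ENNReal.ofReal (c * x ^ (-α)) := by
  have hlt : -α - 1 < -1 := by linarith
  have hint : IntegrableOn (fun t : ℝ => c * (α * t ^ (-α - 1))) (Set.Ioi x) :=
    ((integrableOn_Ioi_rpow_of_lt hlt hx).const_mul α).const_mul c
  rw [← ofReal_integral_eq_lintegral_ofReal hint]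
  · rw [integral_const_mul, integral_const_mul, integral_Ioi_rpow_of_lt hlt hx]
    have h1 : -α - 1 + 1 = -α := by ring
    rw [h1]
    congr 1
    field_simp
  · filter_upwards [ae_restrict_mem measurableSet_Ioi] with t ht
    have ht0 : (0 : ℝ) < t := hx.trans ht
    simp only [Pi.zero_apply]
    positivity

lemma nuAlpha_tails {α p x y : ℝ} (hα : 0 < α) (hp0 : 0 ≤ p) (hp1 : p ≤ 1)
    (hx : 0 < x) (hy : 0 < y) :
    nuAlpha α p (Set.Iio (-y) ∪ Set.Ioi x) =
      ENNReal.ofReal ((1 - p) * y ^ (-α) + p * x ^ (-α)) := by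
  have hdisj : Disjoint (Set.Iio (-y)) (Set.Ioi x) :=
    Set.disjoint_left.mpr fun t (h1 : t < -y) (h2 : x < t) => by linarith
  have hR : nuAlpha α p (Set.Ioi x) = ENNReal.ofReal (p * x ^ (-α)) := by
    rw [nuAlpha, withDensity_apply _ measurableSet_Ioi, ← lintegral_pareto_tail hα hp0 hx]
    refine setLIntegral_congr_fun measurableSet_Ioi fun t ht => ?_
    have ht0 : (0 : ℝ) < t := hx.trans ht
    simp [nuDensity, ht0]
  have hL : nuAlpha α p (Set.Iio (-y)) = ENNReal.ofReal ((1 - p) * y ^ (-α)) := by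
    rw [nuAlpha, withDensity_apply _ measurableSet_Iio,
      ← lintegral_pareto_tail hα (sub_nonneg.mpr hp1) hy]
    rw [← (Measure.measurePreserving_neg (volume : Measure ℝ)).setLIntegral_comp_preimage_emb
      (MeasurableEquiv.neg ℝ).measurableEmbedding]
    have hpre : (Neg.neg : ℝ → ℝ) ⁻¹' (Set.Iio (-y)) = Set.Ioi y := by
      ext t; simp
    rw [hpre]
    refine setLIntegral_congr_fun measurableSet_Ioi fun t ht => ?_
    have ht0 : 0 < t := hy.trans ht
    simp [nuDensity, ht0, not_lt.mpr ht0.le]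
  have h1p : 0 ≤ 1 - p := sub_nonneg.mpr hp1
  rw [measure_union hdisj measurableSet_Ioi, hL, hR, ← ENNReal.ofReal_add] <;> positivity

/-! ### The random walk and the limit measure -/

/-- The random walk embedded in `D`: `X^(n)(t) = ∑_{k=1}^n Z_k 1{k/n ≤ t}`. The increments are
numbered from `0`, so `Z k` is `Z_{k+1}`. -/
def walkPath {Ω : Type*} (Z : ℕ → Ω → ℝ) (n : ℕ) (ω : Ω) : SkorohodD :=
  stepFun (fun k : Fin n => Z k ω) (fun k : Fin n => ((k : ℝ) + 1) / n)

/-- `(ν_α^j × Leb_j) ∘ h_j⁻¹`. -/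
def limitMeasure (α p : ℝ) (j : ℕ) : Measure SkorohodD :=
  (((Measure.pi fun _ : Fin j => nuAlpha α p).prod
    (volume : Measure (Fin j → ℝ))).restrict (jumpDomain j)).map
      (fun zu => stepFun zu.1 zu.2)

end

/-! ### Regularly varying tails -/

/-! The theorem is a principle of `j` big jumps. Write `T` for the tail of `|Z 0|` and `λ_n` for
`lam n`. The scaled walk can be far from every step function with at most `j - 1` jumps essentially
only if exactly `j` increments are of order `λ_n`. Fewer large increments leave the path within `ε`
of `stepAtMost (j - 1)`, unless a sum of small increments is atypically large. More than `j` of them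
have probability of order `(n T(λ_n)) ^ (j + 1)`, which is negligible against `(n T(λ_n)) ^ j`
because `n T(λ_n) → 0`.

Small increments. The variance hypotheses provide a moment of order `β ≤ 2` with `β ρ > 1`
(`RegVarRV.exists_moment`). A Chernoff bound for increments truncated at `δ λ_n` then makes the bad
event smaller than any prescribed power of `n`, once `δ` is small
(`eventually_measureReal_exists_abs_sum_truncAt_le`). Since `T(λ_n)` decays at most polynomially,
this beats the normalization (`exists_tendsto_small_jumps`).

Large increments. Given that they exceed `c λ_n`, `j` distinct increments are iid with the
conditioned law, and a uniformly chosen tuple of indices gives iid grid times. This law converges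
weakly to the product of `ν_α` conditioned on `|y| > c` and of the uniform law
(`exists_tendsto_jumpMeasure`). The factor `(T(c λ_n) / T(λ_n)) ^ j → c ^ (-α j)` restores the total
mass, so `c` disappears from the limit (`smul_jumpLimit`). The limit charges only interior, distinct
jump times, where `h_j` is continuous (`continuousOn_stepFun`).

`measure_walk_le` and `sum_measure_le_walk` compare the walk with its large jumps, up to an error
`ε` in path space. They yield the upper bound for a thickening of a closed set and the lower bound
for a shrinking of an open set (`limsup_walk_le`, `le_liminf_walk`); finally `ε → 0`. -/

/-- The tail function of `|X|`. -/
noncomputable def absTail {Ω : Type*} [MeasurableSpace Ω] (P : Measure Ω) (X : Ω → ℝ) (t : ℝ) : ℝ :=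
  P.real {ω | t < |X ω|}

theorem absTail_nonneg {Ω : Type*} [MeasurableSpace Ω] {P : Measure Ω} {X : Ω → ℝ} (t : ℝ) :
    0 ≤ absTail P X t := measureReal_nonneg

/-- The limit of a ratio of monotone functions may be computed along the integers. -/
theorem tendsto_div_of_antitone_of_nat {F T : ℝ → ℝ} {p : ℝ} (hF : Antitone F) (hT : Antitone T)
    (hF0 : ∀ t, 0 ≤ F t) (hT0 : ∀ t, 0 < T t)
    (h1 : Tendsto (fun n : ℕ => T (n + 1) / T n) atTop (𝓝 1))
    (hp : Tendsto (fun n : ℕ => F n / T n) atTop (𝓝 p)) :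
    Tendsto (fun t => F t / T t) atTop (𝓝 p) := by
  have hp' : Tendsto (fun n : ℕ => F (n + 1) / T (n + 1)) atTop (𝓝 p) := by
    refine (hp.comp (tendsto_add_atTop_nat 1)).congr fun n => ?_
    simp
  have hlo : Tendsto (fun n : ℕ => F (n + 1) / T n) atTop (𝓝 p) := by
    have := hp'.mul h1
    rw [mul_one] at this
    refine this.congr fun n => ?_
    have := (hT0 (n + 1)).ne'
    field_simp
  have hhi : Tendsto (fun n : ℕ => F n / T (n + 1)) atTop (𝓝 p) := by
    have := hp.div h1 one_ne_zero
    rw [div_one] at this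
    refine this.congr fun n => ?_
    have := (hT0 (n + 1)).ne'
    have := (hT0 n).ne'
    simp only [Pi.div_apply]
    field_simp
  -- With `n = ⌊t⌋`, monotonicity squeezes the ratio at `t` between `F (n + 1) / T n` and `F n / T
  -- (n + 1)`.
  have hfl : Tendsto (fun t : ℝ => ⌊t⌋₊) atTop atTop := tendsto_nat_floor_atTop
  refine tendsto_of_tendsto_of_tendsto_of_le_of_le' (hlo.comp hfl) (hhi.comp hfl) ?_ ?_
  · filter_upwards [eventually_ge_atTop 0] with t ht
    exact div_le_div₀ (hF0 _) (hF (Nat.lt_floor_add_one t).le) (hT0 _) (hT (Nat.floor_le ht))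
  · filter_upwards [eventually_ge_atTop 0] with t ht
    exact div_le_div₀ (hF0 _) (hF (Nat.floor_le ht)) (hT0 _) (hT (Nat.lt_floor_add_one t).le)

section Tail

variable {Ω : Type*} [MeasurableSpace Ω] {P : Measure Ω} [IsProbabilityMeasure P] {X : Ω → ℝ}
  {α p : ℝ}

theorem absTail_antitone : Antitone (absTail P X) := fun _ _ h =>
  measureReal_mono fun _ hω => lt_of_le_of_lt h hω

theorem areSeparated_zero_le_abs {x : ℝ} (hx : 0 < x) :
    Metric.AreSeparated ({0} : Set ℝ) {y | x ≤ |y|} := by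
  refine ⟨ENNReal.ofReal x, by simpa using hx, ?_⟩
  rintro _ rfl y hy
  rw [edist_dist, dist_zero_left]
  exact ENNReal.ofReal_le_ofReal hy

theorem areSeparated_zero_lt_abs {x : ℝ} (hx : 0 < x) :
    Metric.AreSeparated ({0} : Set ℝ) {y | x < |y|} := by
  refine (areSeparated_zero_le_abs hx).mono subset_rfl fun y hy => ?_
  have hy : x < |y| := hy
  exact hy.le

/-- Homogeneity makes the mass of `|y| > x` equal to `m x ^ (-α)`, which is continuous in `x`; open
sets give the lower bound, and closed sets, compared with `|y| > x'` for `x' ↑ x`, the upper one. If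
`m` were zero, all dilations of `|y| > 1` would be null, and they exhaust `ℝ \ {0}`. -/
theorem RegVarRV.exists_tendsto_nat (hX : Measurable X) (h : RegVarRV P X α) :
    ∃ (γ : ℕ → ℝ) (m : ℝ), (∀ n, 1 ≤ n → 0 < γ n) ∧ 0 < m ∧ ∀ x : ℝ, 0 < x →
      Tendsto (fun n : ℕ => γ n * absTail P X (x * n)) atTop (𝓝 (m * x ^ (-α))) := by
  obtain ⟨γ, β, μ, hγ, hμ0, hμ, hscale⟩ := h
  have hopen : ∀ x : ℝ, MeasurableSet {y : ℝ | x < |y|} := fun x =>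
    (isOpen_lt continuous_const continuous_abs).measurableSet
  have hs : ∀ x : ℝ, 0 < x → μ {y | x < |y|} = ENNReal.ofReal (x ^ (-α)) * μ {y | 1 < |y|} := by
    intro x hx
    rw [← hscale x hx _ (hopen 1)]
    · congr 1
      ext y
      simp only [Set.mem_ofPred_eq, Set.mem_image]
      constructor
      · intro hy
        refine ⟨y / x, ?_, by field_simp⟩
        rw [abs_div, abs_of_pos hx, lt_div_iff₀ hx, one_mul]
        exact hy
      · rintro ⟨w, hw, rfl⟩
        rw [abs_mul, abs_of_pos hx]
        nlinarith
    · rintro y hy rfl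
      simp at hy
      linarith
  have hfin : μ {y | 1 < |y|} ≠ ∞ :=
    (hμ.finite_limit _ (hopen 1) (areSeparated_zero_lt_abs one_pos)).ne
  have hne : μ {y | 1 < |y|} ≠ 0 := by
    intro h0
    refine hμ0 (measure_mono_null (t := ⋃ n : ℕ, {y : ℝ | 1 / ((n : ℝ) + 1) < |y|}) ?_ ?_)
    · intro y hy
      obtain ⟨n, hn⟩ := exists_nat_one_div_lt (abs_pos.mpr hy)
      exact Set.mem_iUnion.mpr ⟨n, hn⟩
    · refine measure_iUnion_null fun n => ?_
      rw [hs _ (by positivity), h0, mul_zero]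
  refine ⟨γ, (μ {y | 1 < |y|}).toReal, hγ.1, ENNReal.toReal_pos hne hfin, fun x hx => ?_⟩
  have hmap : ∀ n : ℕ, 1 ≤ n → ∀ x : ℝ,
      (ENNReal.ofReal (γ n) • P.map (fun ω => X ω / n)) {y | x < |y|} =
        ENNReal.ofReal (γ n * absTail P X (x * n)) := by
    intro n hn x
    have hn' : (0 : ℝ) < n := by exact_mod_cast hn
    rw [Measure.smul_apply, Measure.map_apply (hX.div_const _) (hopen x), smul_eq_mul,
      ENNReal.ofReal_mul (hγ.1 n hn).le, absTail, ofReal_measureReal]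
    congr 2
    ext ω
    simp [abs_div, lt_div_iff₀ hn']
  set m := μ {y | 1 < |y|} with hm
  have key : Tendsto (fun n : ℕ => ENNReal.ofReal (γ n * absTail P X (x * n))) atTop
      (𝓝 (ENNReal.ofReal (x ^ (-α)) * m)) := by
    refine tendsto_of_le_liminf_of_limsup_le ?_ ?_
    · rw [← hs x hx]
      refine (hμ.le_liminf _ (isOpen_lt continuous_const continuous_abs)
        (areSeparated_zero_lt_abs hx)).trans_eq ?_
      refine liminf_congr ?_
      filter_upwards [eventually_ge_atTop 1] with n hn using hmap n hn x
    · have hle : ∀ x' ∈ Set.Ioo 0 x,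
          limsup (fun n : ℕ => ENNReal.ofReal (γ n * absTail P X (x * n))) atTop ≤
            ENNReal.ofReal (x' ^ (-α)) * m := by
        intro x' hx'
        rw [← hs x' hx'.1]
        calc _ ≤ limsup (fun n => (ENNReal.ofReal (γ n) • P.map (fun ω => X ω / n)) {y | x ≤ |y|})
              atTop := by
              refine limsup_le_limsup ?_
              filter_upwards [eventually_ge_atTop 1] with n hn
              rw [← hmap n hn x]
              exact measure_mono fun y hy => (show x < |y| from hy).le
          _ ≤ μ {y | x ≤ |y|} := hμ.limsup_le _ (isClosed_le continuous_const continuous_abs)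
              (areSeparated_zero_le_abs hx)
          _ ≤ _ := measure_mono fun y hy => lt_of_lt_of_le hx'.2 hy
      have hlim : Tendsto (fun x' : ℝ => ENNReal.ofReal (x' ^ (-α)) * m) (𝓝[<] x)
          (𝓝 (ENNReal.ofReal (x ^ (-α)) * m)) := by
        refine ENNReal.Tendsto.mul_const ?_ (Or.inr hfin)
        refine ENNReal.tendsto_ofReal ?_
        exact ((Real.continuousAt_rpow_const x (-α) (Or.inl hx.ne')).tendsto).mono_left
          nhdsWithin_le_nhds
      refine ge_of_tendsto hlim ?_
      filter_upwards [Ioo_mem_nhdsLT hx] with x' hx' using hle x' hx'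
  have hreal := (ENNReal.tendsto_toReal (ENNReal.mul_ne_top ENNReal.ofReal_ne_top hfin)).comp key
  rw [ENNReal.toReal_mul, ENNReal.toReal_ofReal (by positivity), mul_comm] at hreal
  refine hreal.congr' ?_
  filter_upwards [eventually_ge_atTop 1] with n hn
  exact ENNReal.toReal_ofReal (mul_nonneg (hγ.1 n hn).le (absTail_nonneg _))

theorem RegVarRV.absTail_pos (hX : Measurable X) (h : RegVarRV P X α) (t : ℝ) :
    0 < absTail P X t := by
  obtain ⟨γ, m, hγ, hm, hlim⟩ := h.exists_tendsto_nat hX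
  have h1 := hlim 1 one_pos
  rw [Real.one_rpow, mul_one] at h1
  obtain ⟨n, hn, hn1, hnt⟩ := ((h1.eventually (eventually_gt_nhds hm)).and
    ((eventually_ge_atTop 1).and (eventually_ge_atTop ⌈t⌉₊))).exists
  have h2 : 0 < absTail P X (1 * n) := pos_of_mul_pos_right hn (hγ n hn1).le
  refine h2.trans_le (absTail_antitone ?_)
  rw [one_mul]
  exact Nat.ceil_le.mp hnt

theorem RegVarRV.tendsto_nat_div (hX : Measurable X) (h : RegVarRV P X α) {x : ℝ} (hx : 0 < x) :
    Tendsto (fun n : ℕ => absTail P X (x * n) / absTail P X n) atTop (𝓝 (x ^ (-α))) := by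
  have hpos := h.absTail_pos hX
  obtain ⟨γ, m, hγ, hm, hlim⟩ := h.exists_tendsto_nat hX
  have h1 := hlim 1 one_pos
  rw [Real.one_rpow, mul_one] at h1
  have := (hlim x hx).div h1 hm.ne'
  rw [mul_div_cancel_left₀ _ hm.ne'] at this
  refine this.congr' ?_
  filter_upwards [eventually_ge_atTop 1] with n hn
  have h3 := (hγ n hn).ne'
  simp only [Pi.div_apply, one_mul]
  rw [mul_div_mul_left _ _ h3]

/-- For every `x > 1`, eventually `n + 1 ≤ x n`, so the ratio is at least nearly `x ^ (-α)`, and `x`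
may tend to `1`. This lets limits along the integers pass to real arguments. -/
theorem RegVarRV.tendsto_succ_div (hX : Measurable X) (h : RegVarRV P X α) :
    Tendsto (fun n : ℕ => absTail P X (n + 1) / absTail P X n) atTop (𝓝 1) := by
  have hpos := h.absTail_pos hX
  refine tendsto_order.mpr ⟨fun a ha => ?_, fun a ha => ?_⟩
  · have hc : Tendsto (fun x : ℝ => x ^ (-α)) (𝓝[>] 1) (𝓝 1) := by
      have := (Real.continuousAt_rpow_const 1 (-α) (Or.inl one_ne_zero)).tendsto
      rw [Real.one_rpow] at this
      exact this.mono_left nhdsWithin_le_nhds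
    obtain ⟨x, hxa, hx1⟩ := ((hc.eventually (eventually_gt_nhds ha)).and self_mem_nhdsWithin).exists
    have hx1 : 1 < x := hx1
    have hx0 : 0 < x - 1 := by linarith
    have hlim := h.tendsto_nat_div hX (x := x) (by linarith)
    filter_upwards [hlim.eventually (eventually_gt_nhds hxa), eventually_ge_atTop ⌈1 / (x - 1)⌉₊]
      with n hn hn2
    refine hn.trans_le (div_le_div_of_nonneg_right (absTail_antitone ?_) (hpos _).le)
    have := Nat.ceil_le.mp hn2
    rw [div_le_iff₀ hx0] at this
    linarith
  · filter_upwards with n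
    refine lt_of_le_of_lt ?_ ha
    rw [div_le_one (hpos _)]
    exact absTail_antitone (by linarith)

theorem RegVarRV.tendsto_div (hX : Measurable X) (h : RegVarRV P X α) {x : ℝ} (hx : 0 < x) :
    Tendsto (fun t : ℝ => absTail P X (x * t) / absTail P X t) atTop (𝓝 (x ^ (-α))) :=
  tendsto_div_of_antitone_of_nat (F := fun t => absTail P X (x * t))
    (fun _ _ hab => absTail_antitone (mul_le_mul_of_nonneg_left hab hx.le)) absTail_antitone
    (fun _ => absTail_nonneg _) (h.absTail_pos hX) (h.tendsto_succ_div hX) (h.tendsto_nat_div hX hx)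

theorem TailBalance.tendsto_right (hX : Measurable X) (h : RegVarRV P X α)
    (hb : TailBalance P X p) :
    Tendsto (fun t : ℝ => P.real {ω | t < X ω} / absTail P X t) atTop (𝓝 p) :=
  tendsto_div_of_antitone_of_nat (F := fun t => P.real {ω | t < X ω})
    (fun _ _ hab => measureReal_mono fun _ hω => lt_of_le_of_lt hab hω) absTail_antitone
    (fun _ => measureReal_nonneg) (h.absTail_pos hX) (h.tendsto_succ_div hX) hb.2.2.1

theorem TailBalance.tendsto_left (hX : Measurable X) (h : RegVarRV P X α)
    (hb : TailBalance P X p) :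
    Tendsto (fun t : ℝ => P.real {ω | X ω ≤ -t} / absTail P X t) atTop (𝓝 (1 - p)) := by
  have hpos := h.absTail_pos hX
  refine tendsto_div_of_antitone_of_nat (F := fun t => P.real {ω | X ω ≤ -t})
    (fun _ _ hab => measureReal_mono fun _ hω => ?_) absTail_antitone
    (fun _ => measureReal_nonneg) hpos (h.tendsto_succ_div hX) ?_
  · exact le_trans hω (neg_le_neg hab)
  -- The closed left tail lies between two open ones: `X < -(n+1)` implies `X ≤ -(n+1)`, which
  -- implies `X < -n`. The shift by one costs nothing in the limit.
  · have h0 := hb.2.2.2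
    rw [← tendsto_add_atTop_iff_nat 1]
    refine tendsto_of_tendsto_of_tendsto_of_le_of_le
      (g := fun n : ℕ => P.real {ω | X ω < -((n + 1 : ℕ) : ℝ)} / absTail P X ((n + 1 : ℕ) : ℝ))
      (h := fun n : ℕ => P.real {ω | X ω < -(n : ℝ)} / absTail P X ((n + 1 : ℕ) : ℝ))
      (h0.comp (tendsto_add_atTop_nat 1)) ?_ (fun n => ?_) (fun n => ?_)
    · have := h0.div (h.tendsto_succ_div hX) one_ne_zero
      rw [div_one] at this
      refine this.congr fun n => ?_
      have h1 := (hpos n).ne'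
      change P.real _ / absTail P X n / (absTail P X (n + 1) / absTail P X n) = _
      rw [Nat.cast_succ, div_div_div_cancel_right₀ h1]
    · refine div_le_div_of_nonneg_right (measureReal_mono fun ω hω => ?_) (hpos _).le
      exact (show X ω < _ from hω).le
    · refine div_le_div_of_nonneg_right (measureReal_mono fun ω hω => ?_) (hpos _).le
      have hω : X ω ≤ -((n + 1 : ℕ) : ℝ) := hω
      push_cast at hω
      change X ω < -(n : ℝ)
      linarith

end Tail

/-! ### Power bounds -/

/-- A positive sequence that grows at least like a power along halving grows like a power. -/
theorem exists_rpow_le_of_halving {g : ℕ → ℝ} {s : ℝ} (hg : ∀ n, 1 ≤ n → 0 < g n)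
    (h : ∀ᶠ n : ℕ in atTop, 2 ^ s * g (n / 2) ≤ g n) :
    ∃ c : ℝ, 0 < c ∧ ∀ n : ℕ, 1 ≤ n → c * (n : ℝ) ^ s ≤ g n := by
  obtain ⟨N, hN⟩ := eventually_atTop.mp h
  set N' := max N 2
  -- The shift `e` absorbs the rounding in `n / 2`. For `s ≥ 0` take `e = 1`, as `n + 1 ≤ 2 (n / 2 +
  -- 1)`; for `s < 0` take `e = 0`, as `2 (n / 2) ≤ n` already has the right direction.
  obtain ⟨e, he0, he1, he⟩ : ∃ e : ℝ, 0 ≤ e ∧ e ≤ 1 ∧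
      ∀ n : ℕ, 1 ≤ n → ((n : ℝ) + e) ^ s ≤ 2 ^ s * (((n / 2 : ℕ) : ℝ) + e) ^ s ∧
        (n : ℝ) ^ s ≤ ((n : ℝ) + e) ^ s ∨ n < 2 := by
    rcases le_or_gt 0 s with hs | hs
    · refine ⟨1, zero_le_one, le_rfl, fun n hn => Or.inl ⟨?_, ?_⟩⟩
      · rw [← Real.mul_rpow (by positivity) (by positivity)]
        refine Real.rpow_le_rpow (by positivity) ?_ hs
        have : n ≤ 2 * (n / 2) + 1 := by omega
        have : (n : ℝ) ≤ 2 * ((n / 2 : ℕ) : ℝ) + 1 := by exact_mod_cast this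
        linarith
      · exact Real.rpow_le_rpow (by positivity) (by linarith) hs
    · refine ⟨0, le_rfl, zero_le_one, fun n hn => ?_⟩
      rcases lt_or_ge n 2 with h2 | h2
      · exact Or.inr h2
      · refine Or.inl ⟨?_, by simp⟩
        have h3 : 1 ≤ n / 2 := by omega
        have h3' : (0 : ℝ) < ((n / 2 : ℕ) : ℝ) := by exact_mod_cast h3
        rw [← Real.mul_rpow (by positivity) (by positivity)]
        refine Real.rpow_le_rpow_of_nonpos (by simpa using h3') ?_ hs.le
        have : 2 * (n / 2) ≤ n := by omega
        have : 2 * ((n / 2 : ℕ) : ℝ) ≤ n := by exact_mod_cast this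
        linarith
  have hne : ((Finset.Icc 1 N').image fun n : ℕ => g n / ((n : ℝ) + e) ^ s).Nonempty :=
    Finset.Nonempty.image ⟨1, by simp [N']⟩ _
  set c := ((Finset.Icc 1 N').image fun n : ℕ => g n / ((n : ℝ) + e) ^ s).min' hne
  have hpos : ∀ n : ℕ, 1 ≤ n → 0 < ((n : ℝ) + e) ^ s := fun n hn => by
    have : (0 : ℝ) < n := by exact_mod_cast hn
    positivity
  have hc : 0 < c := by
    obtain ⟨n, hn, hcn⟩ := Finset.mem_image.mp (Finset.min'_mem _ hne)
    have hn1 := (Finset.mem_Icc.mp hn).1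
    rw [show c = _ from hcn.symm]
    exact div_pos (hg n hn1) (hpos n hn1)
  have key : ∀ n : ℕ, 1 ≤ n → c * ((n : ℝ) + e) ^ s ≤ g n := by
    intro n
    induction n using Nat.strong_induction_on with
    | _ n ih =>
      intro hn
      rcases le_or_gt n N' with hnN | hnN
      · rw [← le_div_iff₀ (hpos n hn)]
        exact Finset.min'_le _ _ (Finset.mem_image.mpr ⟨n, Finset.mem_Icc.mpr ⟨hn, hnN⟩, rfl⟩)
      · have hn2 : 2 < n := lt_of_le_of_lt (le_max_right _ _) hnN
        have hnN2 : N ≤ n := (le_max_left _ _).trans hnN.le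
        rcases he n hn with h1 | h1
        · calc c * ((n : ℝ) + e) ^ s ≤ c * (2 ^ s * (((n / 2 : ℕ) : ℝ) + e) ^ s) :=
                mul_le_mul_of_nonneg_left h1.1 hc.le
            _ = 2 ^ s * (c * (((n / 2 : ℕ) : ℝ) + e) ^ s) := by ring
            _ ≤ 2 ^ s * g (n / 2) :=
                mul_le_mul_of_nonneg_left (ih _ (by omega) (by omega)) (by positivity)
            _ ≤ g n := hN n hnN2
        · omega
  -- At `n = 1` the comparison `he` may give nothing, so `g 1` enters the constant directly.
  refine ⟨min c (g 1), lt_min hc (hg 1 le_rfl), fun n hn => ?_⟩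
  rcases he n hn with h1 | h1
  · exact (mul_le_mul (min_le_left _ _) h1.2 (by positivity) hc.le).trans (key n hn)
  · obtain rfl : n = 1 := by omega
    simp

theorem RegVarSeq.tendsto_half {a : ℕ → ℝ} {ρ : ℝ} (h : RegVarSeq a ρ) :
    Tendsto (fun n : ℕ => a (n / 2) / a n) atTop (𝓝 ((2 : ℝ)⁻¹ ^ ρ)) := by
  refine (h.2 2⁻¹ (by norm_num)).congr fun n => ?_
  congr 2
  rw [inv_mul_eq_div]
  exact_mod_cast Nat.floor_div_eq_div (K := ℝ) n 2

theorem RegVarSeq.exists_rpow_le {a : ℕ → ℝ} {ρ s : ℝ} (h : RegVarSeq a ρ) (hs : s < ρ) :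
    ∃ c : ℝ, 0 < c ∧ ∀ n : ℕ, 1 ≤ n → c * (n : ℝ) ^ s ≤ a n := by
  refine exists_rpow_le_of_halving h.1 ?_
  have hlt : (2 : ℝ)⁻¹ ^ ρ < 2⁻¹ ^ s := Real.rpow_lt_rpow_of_exponent_gt (by norm_num) (by norm_num) hs
  filter_upwards [h.tendsto_half.eventually (eventually_lt_nhds hlt), eventually_ge_atTop 1]
    with n hn hn1
  rw [div_lt_iff₀ (h.1 n hn1)] at hn
  have h2 : (0 : ℝ) < 2 ^ s := by positivity
  rw [Real.inv_rpow zero_le_two] at hn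
  calc 2 ^ s * a (n / 2) ≤ 2 ^ s * ((2 ^ s)⁻¹ * a n) := mul_le_mul_of_nonneg_left hn.le h2.le
    _ = a n := by field_simp

section Tail

variable {Ω : Type*} [MeasurableSpace Ω] {P : Measure Ω} [IsProbabilityMeasure P] {X : Ω → ℝ}
  {α p : ℝ}

/-- The tail along a regularly varying sequence decays at most like a power. -/
theorem RegVarRV.exists_rpow_le_absTail (hX : Measurable X) (h : RegVarRV P X α)
    {a : ℕ → ℝ} {ρ : ℝ} (ha : RegVarSeq a ρ) (hatop : Tendsto a atTop atTop) :
    ∃ K c : ℝ, 0 < c ∧ ∀ n : ℕ, 1 ≤ n → c * (n : ℝ) ^ K ≤ absTail P X (a n) := by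
  have hpos := h.absTail_pos hX
  -- Since `x > 2 ^ ρ`, eventually `a n ≤ x * a (n / 2)`. Hence the tail at `a n` is at least the
  -- tail at `x * a (n / 2)`, which exceeds `y` times the tail at `a (n / 2)` because `y < x ^
  -- (-α)`.
  set x : ℝ := 2 ^ (ρ + 1) with hx
  have hx0 : 0 < x := by positivity
  set y : ℝ := x ^ (-α) / 2
  have hy0 : 0 < y := by positivity
  refine ⟨Real.logb 2 y, ?_⟩
  refine exists_rpow_le_of_halving (fun n _ => hpos _) ?_
  rw [Real.rpow_logb (by norm_num) (by norm_num) hy0]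
  have hhalf : Tendsto (fun n : ℕ => a (n / 2)) atTop atTop :=
    hatop.comp (Nat.tendsto_div_const_atTop two_ne_zero)
  have h1 := (h.tendsto_div hX hx0).comp hhalf
  have hyx : y < x ^ (-α) := half_lt_self (by positivity)
  have hlt : x⁻¹ < (2 : ℝ)⁻¹ ^ ρ := by
    rw [hx, ← Real.inv_rpow zero_le_two]
    exact Real.rpow_lt_rpow_of_exponent_gt (by norm_num) (by norm_num) (by linarith)
  filter_upwards [h1.eventually (eventually_gt_nhds hyx),
    ha.tendsto_half.eventually (eventually_gt_nhds hlt), eventually_ge_atTop 1] with n hn hn2 hn1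
  simp only [Function.comp_apply] at hn
  rw [lt_div_iff₀ (hpos _)] at hn
  rw [lt_div_iff₀ (ha.1 n hn1), inv_mul_lt_iff₀ hx0] at hn2
  exact hn.le.trans (absTail_antitone hn2.le)

/-- The tail of a regularly varying variable decays at least like any larger power. -/
theorem RegVarRV.exists_absTail_le_rpow (hX : Measurable X) (h : RegVarRV P X α)
    {s : ℝ} (hs : s < α) :
    ∃ C : ℝ, 0 < C ∧ ∀ n : ℕ, 1 ≤ n → absTail P X n ≤ C * (n : ℝ) ^ (-s) := by
  have hpos := h.absTail_pos hX
  -- The halving criterion is applied to the reciprocal of the tail.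
  obtain ⟨c, hc, hcn⟩ := exists_rpow_le_of_halving (g := fun n : ℕ => (absTail P X n)⁻¹) (s := s)
    (fun n _ => inv_pos.mpr (hpos _)) (by
      have h1 := (h.tendsto_div hX (x := 2⁻¹) (by norm_num)).comp tendsto_natCast_atTop_atTop
      have hlt : (2 : ℝ) ^ s < 2⁻¹ ^ (-α) := by
        rw [Real.inv_rpow zero_le_two, Real.rpow_neg zero_le_two, inv_inv]
        exact Real.rpow_lt_rpow_of_exponent_lt (by norm_num) hs
      filter_upwards [h1.eventually (eventually_gt_nhds hlt)] with n hn
      simp only [Function.comp_apply] at hn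
      rw [lt_div_iff₀ (hpos _)] at hn
      have h2 : absTail P X (2⁻¹ * n) ≤ absTail P X ((n / 2 : ℕ) : ℝ) := by
        refine absTail_antitone ?_
        have := Nat.cast_div_le (α := ℝ) (m := n) (n := 2)
        push_cast at this
        linarith
      rw [← div_eq_mul_inv, div_le_iff₀ (hpos _), inv_mul_eq_div, le_div_iff₀ (hpos _)]
      linarith)
  refine ⟨c⁻¹, inv_pos.mpr hc, fun n hn => ?_⟩
  have hn' : (0 : ℝ) < n := by exact_mod_cast hn
  have h1 := hcn n hn
  rw [Real.rpow_neg hn'.le, ← mul_inv]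
  exact (le_inv_comm₀ (by positivity) (hpos _)).mp h1

/-- Layer-cake formula: near zero the tail is at most `1` and `t ^ (β - 1)` is integrable; beyond
`1` the tail is bounded by a power `t ^ (-s)` with `β < s < α`. -/
theorem RegVarRV.lintegral_rpow_lt_top (hX : Measurable X) (h : RegVarRV P X α)
    {β : ℝ} (hβ0 : 0 < β) (hβ : β < α) :
    ∫⁻ ω, ENNReal.ofReal (|X ω| ^ β) ∂P < ∞ := by
  obtain ⟨s, hβs, hsα⟩ := exists_between hβ
  obtain ⟨C, hC, hCn⟩ := h.exists_absTail_le_rpow hX hsα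
  have hs0 : 0 < s := hβ0.trans hβs
  have hb : ∀ t : ℝ, 1 ≤ t → absTail P X t ≤ C * 2 ^ s * t ^ (-s) := by
    intro t ht
    have h1 : 1 ≤ ⌊t⌋₊ := (Nat.one_le_floor_iff t).mpr ht
    have h1' : (1 : ℝ) ≤ (⌊t⌋₊ : ℝ) := by exact_mod_cast h1
    have h2 := hCn _ h1
    have h3 : absTail P X t ≤ absTail P X ⌊t⌋₊ := absTail_antitone (Nat.floor_le (by linarith))
    have h4 : t / 2 ≤ ⌊t⌋₊ := by
      have := Nat.lt_floor_add_one t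
      linarith
    have h5 : ((⌊t⌋₊ : ℝ)) ^ (-s) ≤ (t / 2) ^ (-s) :=
      Real.rpow_le_rpow_of_nonpos (by linarith) h4 (by linarith)
    rw [Real.div_rpow (by linarith) zero_le_two, Real.rpow_neg zero_le_two, div_inv_eq_mul] at h5
    calc absTail P X t ≤ C * (⌊t⌋₊ : ℝ) ^ (-s) := h3.trans h2
      _ ≤ C * (t ^ (-s) * 2 ^ s) := mul_le_mul_of_nonneg_left h5 hC.le
      _ = _ := by ring
  rw [lintegral_rpow_eq_lintegral_meas_lt_mul P (ae_of_all _ fun _ => abs_nonneg _)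
    hX.norm.aemeasurable hβ0]
  refine ENNReal.mul_lt_top ENNReal.ofReal_lt_top ?_
  rw [← Set.Ioc_union_Ioi_eq_Ioi (zero_le_one' ℝ)]
  refine (lintegral_union_le _ _ _).trans_lt (ENNReal.add_lt_top.mpr ⟨?_, ?_⟩)
  · have hint : IntegrableOn (fun t : ℝ => t ^ (β - 1)) (Set.Ioc 0 1) := by
      have := (intervalIntegral.intervalIntegrable_rpow' (a := 0) (b := 1) (r := β - 1)
        (by linarith))
      rwa [intervalIntegrable_iff_integrableOn_Ioc_of_le zero_le_one] at this
    refine lt_of_le_of_lt (setLIntegral_mono' measurableSet_Ioc fun t ht => ?_)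
      hint.lintegral_lt_top
    exact mul_le_of_le_one_left bot_le prob_le_one
  · have hint : IntegrableOn (fun t : ℝ => C * 2 ^ s * t ^ (β - 1 - s)) (Set.Ioi 1) :=
      (integrableOn_Ioi_rpow_of_lt (by linarith) one_pos).const_mul _
    refine lt_of_le_of_lt (setLIntegral_mono' measurableSet_Ioi fun t ht => ?_)
      hint.lintegral_lt_top
    have ht1 : (1 : ℝ) < t := ht
    rw [← ofReal_measureReal, ← ENNReal.ofReal_mul measureReal_nonneg]
    refine ENNReal.ofReal_le_ofReal ?_
    rw [sub_eq_neg_add (β - 1) s, Real.rpow_add (by linarith), ← mul_assoc]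
    exact mul_le_mul_of_nonneg_right (hb t ht1.le) (Real.rpow_nonneg (by linarith) _)

end Tail

/-! ### Sums of truncated variables -/

theorem Real.exp_le_one_add_add_sq_mul_exp_abs (x : ℝ) :
    Real.exp x ≤ 1 + x + x ^ 2 * Real.exp |x| := by
  have h1 : 1 ≤ Real.exp |x| := Real.one_le_exp (abs_nonneg x)
  rcases le_or_gt |x| 1 with hx | hx
  · have := (abs_le.mp (Real.abs_exp_sub_one_sub_id_le hx)).2
    nlinarith [sq_nonneg x]
  · rcases lt_abs.mp hx with h | h
    · rw [abs_of_pos (by linarith)]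
      have h2 : 1 ≤ x ^ 2 := by nlinarith
      nlinarith [Real.exp_pos x]
    · have h2 : Real.exp x ≤ 1 := Real.exp_le_one_iff.mpr (by linarith)
      nlinarith [sq_nonneg x]

/-- `x` if `|x| ≤ b`, and `0` otherwise. -/
noncomputable def truncAt (b x : ℝ) : ℝ := if |x| ≤ b then x else 0

theorem measurable_truncAt (b : ℝ) : Measurable (truncAt b) :=
  Measurable.ite (measurableSet_le continuous_abs.measurable measurable_const)
    measurable_id measurable_const

theorem abs_truncAt_le {b : ℝ} (hb : 0 ≤ b) (x : ℝ) : |truncAt b x| ≤ b := by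
  unfold truncAt
  split_ifs with h
  · exact h
  · simpa using hb

theorem truncAt_neg (b x : ℝ) : truncAt b (-x) = -truncAt b x := by
  unfold truncAt
  rw [abs_neg]
  split_ifs <;> simp

theorem mul_truncAt {c : ℝ} (hc : 0 < c) (b x : ℝ) :
    c * truncAt b x = truncAt (c * b) (c * x) := by
  unfold truncAt
  simp only [abs_mul, abs_of_pos hc, mul_le_mul_iff_right₀ hc]
  split_ifs <;> simp

theorem truncAt_sq_le {b β : ℝ} (hβ0 : 0 < β) (hβ : β ≤ 2) (hb : 0 < b) (x : ℝ) :
    truncAt b x ^ 2 ≤ b ^ (2 - β) * |x| ^ β := by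
  unfold truncAt
  split_ifs with h
  · rcases eq_or_ne x 0 with rfl | hx
    · simp [Real.zero_rpow hβ0.ne']
    · have hx' : 0 < |x| := abs_pos.mpr hx
      calc x ^ 2 = |x| ^ ((2 - β) + β) := by
            rw [sub_add_cancel, ← sq_abs]; exact (Real.rpow_two _).symm
        _ = |x| ^ (2 - β) * |x| ^ β := Real.rpow_add hx' _ _
        _ ≤ _ := mul_le_mul_of_nonneg_right
          (Real.rpow_le_rpow hx'.le h (by linarith)) (by positivity)
  · rw [zero_pow two_ne_zero]
    positivity

theorem abs_truncAt_le_rpow {b β : ℝ} (hβ0 : 0 < β) (hβ : β ≤ 1) (hb : 0 < b) (x : ℝ) :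
    |truncAt b x| ≤ b ^ (1 - β) * |x| ^ β := by
  unfold truncAt
  split_ifs with h
  · rcases eq_or_ne x 0 with rfl | hx
    · simp [Real.zero_rpow hβ0.ne']
    · have hx' : 0 < |x| := abs_pos.mpr hx
      calc |x| = |x| ^ ((1 - β) + β) := by simp
        _ = |x| ^ (1 - β) * |x| ^ β := Real.rpow_add hx' _ _
        _ ≤ _ := mul_le_mul_of_nonneg_right
          (Real.rpow_le_rpow hx'.le h (by linarith)) (by positivity)
  · rw [abs_zero]; positivity

theorem abs_sub_truncAt_le_rpow {b β : ℝ} (hβ : 1 ≤ β) (hb : 0 < b) (x : ℝ) :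
    |x - truncAt b x| ≤ b ^ (1 - β) * |x| ^ β := by
  unfold truncAt
  split_ifs with h
  · rw [sub_self, abs_zero]; positivity
  · push Not at h
    have hx' : 0 < |x| := hb.trans h
    rw [sub_zero]
    calc |x| = |x| ^ ((1 - β) + β) := by simp
      _ = |x| ^ (1 - β) * |x| ^ β := Real.rpow_add hx' _ _
      _ ≤ _ := mul_le_mul_of_nonneg_right
        (Real.rpow_le_rpow_of_nonpos hb h.le (by linarith)) (by positivity)

theorem integral_truncAt_sq_le {Ω : Type*} [MeasurableSpace Ω] {P : Measure Ω} {X : Ω → ℝ}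
    {b β : ℝ} (hb : 0 < b) (hβ0 : 0 < β) (hβ : β ≤ 2)
    (hint : Integrable (fun ω => |X ω| ^ β) P) :
    ∫ ω, truncAt b (X ω) ^ 2 ∂P ≤ b ^ (2 - β) * ∫ ω, |X ω| ^ β ∂P := by
  rw [← integral_const_mul]
  refine integral_mono_of_nonneg (ae_of_all _ fun ω => sq_nonneg _) (hint.const_mul _)
    (ae_of_all _ fun ω => truncAt_sq_le hβ0 hβ hb _)

section Truncation

variable {Ω : Type*} [MeasurableSpace Ω] {P : Measure Ω} [IsProbabilityMeasure P]
  {X : Ω → ℝ} {b β : ℝ}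

theorem integrable_truncAt (hX : Measurable X) (hb : 0 ≤ b) :
    Integrable (fun ω => truncAt b (X ω)) P :=
  Integrable.of_bound ((measurable_truncAt b).comp hX).aestronglyMeasurable b
    (ae_of_all _ fun _ => abs_truncAt_le hb _)

theorem integrable_of_integrable_rpow (hX : Measurable X)
    (hint : Integrable (fun ω => |X ω| ^ β) P) (hβ : 1 ≤ β) : Integrable X P := by
  refine ((integrable_const (1 : ℝ)).add hint).mono' hX.aestronglyMeasurable (ae_of_all _ fun ω => ?_)
  rw [Real.norm_eq_abs, Pi.add_apply]
  rcases le_total |X ω| 1 with h | h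
  · have : 0 ≤ |X ω| ^ β := by positivity
    linarith
  · have := Real.self_le_rpow_of_one_le h hβ
    linarith

/-- For `β ≤ 1` the truncated variable itself satisfies the bound. For `β > 1` the variable is
integrable and centred, so the truncated mean is minus the mean of the discarded part, which
satisfies the same bound. -/
theorem abs_integral_truncAt_le (hX : Measurable X) (hb : 0 < b) (hβ0 : 0 < β)
    (hint : Integrable (fun ω => |X ω| ^ β) P) (hmean : Integrable X P → ∫ ω, X ω ∂P = 0) :
    |∫ ω, truncAt b (X ω) ∂P| ≤ b ^ (1 - β) * ∫ ω, |X ω| ^ β ∂P := by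
  rw [← integral_const_mul]
  rcases le_or_gt β 1 with hβ | hβ
  · refine (abs_integral_le_integral_abs).trans (integral_mono (integrable_truncAt hX hb.le).abs
      (hint.const_mul _) fun ω => abs_truncAt_le_rpow hβ0 hβ hb _)
  · have hXi := integrable_of_integrable_rpow hX hint hβ.le
    have h1 : ∫ ω, truncAt b (X ω) ∂P = -∫ ω, (X ω - truncAt b (X ω)) ∂P := by
      rw [integral_sub hXi (integrable_truncAt hX hb.le), hmean hXi]
      ring
    rw [h1, abs_neg]
    exact (abs_integral_le_integral_abs).trans (integral_mono
      (hXi.sub (integrable_truncAt hX hb.le)).abs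
      (hint.const_mul _) fun ω => abs_sub_truncAt_le_rpow hβ.le hb _)

/-- Integrating `exp x ≤ 1 + x + x² exp |x|` leaves the first two truncated moments, both controlled
by the moment of order `β`; finite variance is not needed. -/
theorem mgf_truncAt_le (hX : Measurable X) (hb : 0 < b) (hβ0 : 0 < β) (hβ : β ≤ 2)
    (hint : Integrable (fun ω => |X ω| ^ β) P) (hmean : Integrable X P → ∫ ω, X ω ∂P = 0)
    {θ : ℝ} (hθ : 0 ≤ θ) :
    mgf (fun ω => truncAt b (X ω)) P θ ≤
      Real.exp ((θ * b ^ (1 - β) + θ ^ 2 * Real.exp (θ * b) * b ^ (2 - β)) *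
        ∫ ω, |X ω| ^ β ∂P) := by
  set A := ∫ ω, |X ω| ^ β ∂P
  have hi := integrable_truncAt (P := P) hX hb.le
  have hi2 : Integrable (fun ω => truncAt b (X ω) ^ 2) P :=
    Integrable.of_bound (((measurable_truncAt b).comp hX).pow_const 2).aestronglyMeasurable (b ^ 2)
      (ae_of_all _ fun ω => by
        rw [norm_pow]
        exact pow_le_pow_left₀ (norm_nonneg _) (abs_truncAt_le hb.le _) 2)
  have hexp : Integrable (fun ω => 1 + θ * truncAt b (X ω) +
      θ ^ 2 * Real.exp (θ * b) * truncAt b (X ω) ^ 2) P :=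
    ((integrable_const 1).add (hi.const_mul _)).add (hi2.const_mul _)
  calc mgf (fun ω => truncAt b (X ω)) P θ
      ≤ ∫ ω, (1 + θ * truncAt b (X ω) + θ ^ 2 * Real.exp (θ * b) * truncAt b (X ω) ^ 2) ∂P := by
        refine integral_mono_of_nonneg (ae_of_all _ fun ω => (Real.exp_pos _).le) hexp
          (ae_of_all _ fun ω => ?_)
        refine (Real.exp_le_one_add_add_sq_mul_exp_abs _).trans ?_
        have h1 : Real.exp |θ * truncAt b (X ω)| ≤ Real.exp (θ * b) := by
          rw [Real.exp_le_exp, abs_mul, abs_of_nonneg hθ]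
          exact mul_le_mul_of_nonneg_left (abs_truncAt_le hb.le _) hθ
        have h2 := mul_le_mul_of_nonneg_left h1 (sq_nonneg (θ * truncAt b (X ω)))
        dsimp only
        linarith
    _ = 1 + θ * ∫ ω, truncAt b (X ω) ∂P +
          θ ^ 2 * Real.exp (θ * b) * ∫ ω, truncAt b (X ω) ^ 2 ∂P := by
        have h1 : Integrable (fun ω => 1 + θ * truncAt b (X ω)) P :=
          (integrable_const 1).add (hi.const_mul _)
        rw [integral_add h1 (hi2.const_mul _), integral_add (integrable_const 1) (hi.const_mul _), integral_const_mul,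
          integral_const_mul]
        simp
    _ ≤ (θ * b ^ (1 - β) + θ ^ 2 * Real.exp (θ * b) * b ^ (2 - β)) * A + 1 := by
        have h1 := mul_le_mul_of_nonneg_left
          ((le_abs_self _).trans (abs_integral_truncAt_le hX hb hβ0 hint hmean)) hθ
        have h2 := mul_le_mul_of_nonneg_left (integral_truncAt_sq_le hb hβ0 hβ hint)
          (show 0 ≤ θ ^ 2 * Real.exp (θ * b) by positivity)
        linarith
    _ ≤ _ := Real.add_one_le_exp _

end Truncation

/-! ### Exponential bounds for truncated sums -/

section Sums

variable {Ω : Type*} [MeasurableSpace Ω] {P : Measure Ω} [IsProbabilityMeasure P]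
  {Z : ℕ → Ω → ℝ} {β : ℝ}

/-- Chernoff's inequality; by independence the moment generating function of the sum is the `k`-th
power of that of one term. -/
theorem measureReal_sum_truncAt_ge_le (hmeas : ∀ i, Measurable (Z i)) (hindep : iIndepFun Z P)
    (hident : ∀ i, IdentDistrib (Z i) (Z 0) P P) (hβ0 : 0 < β) (hβ : β ≤ 2)
    (hint : Integrable (fun ω => |Z 0 ω| ^ β) P)
    (hmean : Integrable (Z 0) P → ∫ ω, Z 0 ω ∂P = 0) {b θ : ℝ} (hb : 0 < b) (hθ : 0 ≤ θ)
    (x : ℝ) (k : ℕ) :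
    P.real {ω | x ≤ ∑ i ∈ Finset.range k, truncAt b (Z i ω)} ≤
      Real.exp (-(θ * x) + k * ((θ * b ^ (1 - β) + θ ^ 2 * Real.exp (θ * b) * b ^ (2 - β)) *
        ∫ ω, |Z 0 ω| ^ β ∂P)) := by
  have hYm : ∀ i, Measurable (fun ω => truncAt b (Z i ω)) := fun i =>
    (measurable_truncAt b).comp (hmeas i)
  have hYi : iIndepFun (fun i ω => truncAt b (Z i ω)) P :=
    hindep.comp (fun _ => truncAt b) fun _ => measurable_truncAt b
  have hexp : Integrable (fun ω => Real.exp (θ * ∑ i ∈ Finset.range k, truncAt b (Z i ω))) P := by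
    refine Integrable.of_bound (C := Real.exp (θ * (k * b))) ?_ (ae_of_all _ fun ω => ?_)
    · exact ((Finset.measurable_sum _ fun i _ => hYm i).const_mul θ).exp.aestronglyMeasurable
    · rw [Real.norm_eq_abs, Real.abs_exp, Real.exp_le_exp]
      refine mul_le_mul_of_nonneg_left ?_ hθ
      refine (Finset.sum_le_card_nsmul _ _ b fun i _ =>
        (le_abs_self _).trans (abs_truncAt_le hb.le _)).trans_eq ?_
      simp
  have h1 := measure_ge_le_exp_mul_mgf (μ := P) x hθ hexp
  refine h1.trans ?_
  have h2 : mgf (fun ω => ∑ i ∈ Finset.range k, truncAt b (Z i ω)) P θ =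
      mgf (fun ω => truncAt b (Z 0 ω)) P θ ^ k := by
    have h3 := hYi.mgf_sum (t := θ) hYm (Finset.range k)
    have h4 : (∑ i ∈ Finset.range k, fun ω => truncAt b (Z i ω)) =
        fun ω => ∑ i ∈ Finset.range k, truncAt b (Z i ω) := by
      ext ω; simp
    rw [h4] at h3
    rw [h3, Finset.prod_eq_pow_card (b := mgf (fun ω => truncAt b (Z 0 ω)) P θ), Finset.card_range]
    intro i _
    exact mgf_congr_of_identDistrib _ _ ((hident i).comp (measurable_truncAt b)) θ
  rw [h2, Real.exp_add, Real.exp_nat_mul, neg_mul]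
  refine mul_le_mul_of_nonneg_left ?_ (Real.exp_pos _).le
  exact pow_le_pow_left₀ mgf_nonneg (mgf_truncAt_le (hmeas 0) hb hβ0 hβ hint hmean hθ) k

/-- Sums of variables truncated at a small multiple of `lam n` rarely exceed a multiple of `lam n`. -/
theorem eventually_measureReal_sum_truncAt_ge_le (hmeas : ∀ i, Measurable (Z i))
    (hindep : iIndepFun Z P) (hident : ∀ i, IdentDistrib (Z i) (Z 0) P P) (hβ0 : 0 < β)
    (hβ : β ≤ 2) (hint : Integrable (fun ω => |Z 0 ω| ^ β) P)
    (hmean : Integrable (Z 0) P → ∫ ω, Z 0 ω ∂P = 0) {lam : ℕ → ℝ}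
    (hlam : ∀ n, 1 ≤ n → 0 < lam n) {C η : ℝ} (hη : 0 < η)
    (hCη : ∀ n : ℕ, 1 ≤ n → n * lam n ^ (-β) ≤ C * (n : ℝ) ^ (-η))
    {ε M δ : ℝ} (hε : 0 < ε) (hM : 0 < M) (hδ : 0 < δ) (hδM : δ ≤ ε * η / (2 * M)) :
    ∀ᶠ n : ℕ in atTop, ∀ k ≤ n,
      P.real {ω | ε * lam n ≤ ∑ i ∈ Finset.range k, truncAt (δ * lam n) (Z i ω)} ≤
        Real.exp 1 * (n : ℝ) ^ (-M) := by
  set A := ∫ ω, |Z 0 ω| ^ β ∂P with hA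
  have hA0 : 0 ≤ A := integral_nonneg fun ω => by positivity
  -- `R n` bounds the part of the Chernoff exponent coming from the moment generating function.
  -- Powers of `log n` lose against negative powers of `n`, so eventually `R n ≤ 1`, whence the
  -- factor `exp 1`.
  set R : ℕ → ℝ := fun n => A * C * (δ ^ (1 - β) * (M / ε) * (Real.log n * (n : ℝ) ^ (-η)) +
    δ ^ (2 - β) * (M / ε) ^ 2 * (Real.log n ^ 2 * (n : ℝ) ^ (-(η / 2)))) with hR
  have hlog : ∀ (q : ℕ) (s : ℝ), 0 < s →
      Tendsto (fun n : ℕ => Real.log n ^ q * (n : ℝ) ^ (-s)) atTop (𝓝 0) := by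
    intro q s hs
    have h1 := (isLittleO_log_rpow_rpow_atTop (q : ℝ) hs).tendsto_div_nhds_zero.comp
      tendsto_natCast_atTop_atTop
    refine h1.congr fun n => ?_
    simp only [Function.comp_apply, Real.rpow_natCast]
    rw [Real.rpow_neg (by positivity), div_eq_mul_inv]
  have hRlim : Tendsto R atTop (𝓝 0) := by
    have h1 := hlog 1 η hη
    have h2 := hlog 2 (η / 2) (by positivity)
    simp only [pow_one] at h1
    have := ((h1.const_mul (δ ^ (1 - β) * (M / ε))).add
      (h2.const_mul (δ ^ (2 - β) * (M / ε) ^ 2))).const_mul (A * C)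
    simpa only [mul_zero, add_zero] using this
  filter_upwards [hRlim.eventually (eventually_le_nhds one_pos), eventually_ge_atTop 1]
    with n hn hn1 k hk
  have hl := hlam n hn1
  have hn0 : (0 : ℝ) < n := by exact_mod_cast hn1
  have hlog0 : 0 ≤ Real.log n := Real.log_nonneg (by exact_mod_cast hn1)
  -- With the Chernoff parameter `θ = L / λ_n`, the main term `exp (-θ ε λ_n)` is exactly `n ^
  -- (-M)`.
  set L := M / ε * Real.log n with hL
  have hL0 : 0 ≤ L := by positivity
  have hθ : 0 ≤ L / lam n := by positivity
  refine (measureReal_sum_truncAt_ge_le hmeas hindep hident hβ0 hβ hint hmean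
    (b := δ * lam n) (by positivity) hθ (ε * lam n) k).trans ?_
  rw [Real.exp_add, mul_comm (Real.exp 1)]
  refine mul_le_mul (le_of_eq ?_) ?_ (Real.exp_pos _).le (by positivity)
  · rw [Real.rpow_def_of_pos hn0]
    congr 1
    rw [hL]; field_simp
  · rw [Real.exp_le_exp]
    refine le_trans ?_ hn
    -- The upper bound on `δ` is made for this: the factor `exp (θ δ λ_n)` uses up only half of the
    -- gain `n ^ (-η)`.
    have e1 : Real.exp (L / lam n * (δ * lam n)) ≤ (n : ℝ) ^ (η / 2) := by
      rw [Real.rpow_def_of_pos hn0, Real.exp_le_exp]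
      have : L / lam n * (δ * lam n) = L * δ := by field_simp
      rw [this, hL]
      calc M / ε * Real.log n * δ ≤ M / ε * Real.log n * (ε * η / (2 * M)) := by gcongr
        _ = _ := by field_simp
    have e2 : L / lam n * (δ * lam n) ^ (1 - β) = δ ^ (1 - β) * L * lam n ^ (-β) := by
      rw [Real.mul_rpow hδ.le hl.le, sub_eq_add_neg 1 β, Real.rpow_add hl, Real.rpow_one]
      field_simp
    have e3 : (L / lam n) ^ 2 * (δ * lam n) ^ (2 - β) = δ ^ (2 - β) * L ^ 2 * lam n ^ (-β) := by
      rw [Real.mul_rpow hδ.le hl.le, sub_eq_add_neg 2 β, Real.rpow_add hl, Real.rpow_two]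
      field_simp
    have hk' : (k : ℝ) ≤ n := by exact_mod_cast hk
    have h4 : 0 ≤ lam n ^ (-β) := by positivity
    calc (k : ℝ) * ((L / lam n * (δ * lam n) ^ (1 - β) +
          (L / lam n) ^ 2 * Real.exp (L / lam n * (δ * lam n)) * (δ * lam n) ^ (2 - β)) * A)
        ≤ n * ((L / lam n * (δ * lam n) ^ (1 - β) +
          (L / lam n) ^ 2 * (n : ℝ) ^ (η / 2) * (δ * lam n) ^ (2 - β)) * A) := by gcongr
      _ = A * ((n * lam n ^ (-β)) * (δ ^ (1 - β) * L + δ ^ (2 - β) * L ^ 2 * (n : ℝ) ^ (η / 2))) := by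
          rw [e2, mul_right_comm _ _ ((δ * lam n) ^ (2 - β)), e3]; ring
      _ ≤ A * ((C * (n : ℝ) ^ (-η)) * (δ ^ (1 - β) * L + δ ^ (2 - β) * L ^ 2 * (n : ℝ) ^ (η / 2))) := by
          refine mul_le_mul_of_nonneg_left (mul_le_mul_of_nonneg_right (hCη n hn1) ?_) hA0
          positivity
      _ = R n := by
          have h5 : (n : ℝ) ^ (-(η / 2)) = (n : ℝ) ^ (-η) * (n : ℝ) ^ (η / 2) := by
            rw [← Real.rpow_add hn0]; congr 1; ring
          simp only [hR, hL, h5]; ring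

/-- A union bound over the `n + 1` partial sums and the two signs costs a factor of order `n`. No
maximal inequality is needed, since `M` is arbitrary. -/
theorem eventually_measureReal_exists_abs_sum_truncAt_le (hmeas : ∀ i, Measurable (Z i))
    (hindep : iIndepFun Z P) (hident : ∀ i, IdentDistrib (Z i) (Z 0) P P) (hβ0 : 0 < β)
    (hβ : β ≤ 2) (hint : Integrable (fun ω => |Z 0 ω| ^ β) P)
    (hmean : Integrable (Z 0) P → ∫ ω, Z 0 ω ∂P = 0) {lam : ℕ → ℝ}
    (hlam : ∀ n, 1 ≤ n → 0 < lam n) {C η : ℝ} (hη : 0 < η)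
    (hCη : ∀ n : ℕ, 1 ≤ n → n * lam n ^ (-β) ≤ C * (n : ℝ) ^ (-η))
    {ε M δ : ℝ} (hε : 0 < ε) (hM : 0 < M) (hδ : 0 < δ) (hδM : δ ≤ ε * η / (2 * M)) :
    ∀ᶠ n : ℕ in atTop,
      P.real {ω | ∃ k ≤ n, ε * lam n < |∑ i ∈ Finset.range k, truncAt (δ * lam n) (Z i ω)|} ≤
        4 * Real.exp 1 * (n : ℝ) ^ (1 - M) := by
  have hpos := eventually_measureReal_sum_truncAt_ge_le hmeas hindep hident hβ0 hβ hint hmean hlam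
    hη hCη hε hM hδ hδM
  have hneg := eventually_measureReal_sum_truncAt_ge_le (Z := fun i ω => -Z i ω) (P := P)
    (fun i => (hmeas i).neg) (hindep.comp (fun _ x => -x) fun _ => measurable_neg)
    (fun i => (hident i).comp measurable_neg) hβ0 hβ (by simpa only [abs_neg] using hint)
    (fun h => by rw [integral_neg, hmean (by simpa using h.neg), neg_zero]) hlam
    hη hCη hε hM hδ hδM
  filter_upwards [hpos, hneg, eventually_ge_atTop 1] with n hp hn hn1
  have hn0 : (0 : ℝ) < n := by exact_mod_cast hn1
  set A : ℕ → Set Ω := fun k =>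
    {ω | ε * lam n ≤ ∑ i ∈ Finset.range k, truncAt (δ * lam n) (Z i ω)}
  set B : ℕ → Set Ω := fun k =>
    {ω | ε * lam n ≤ ∑ i ∈ Finset.range k, truncAt (δ * lam n) (-Z i ω)}
  have hsub : {ω | ∃ k ≤ n, ε * lam n < |∑ i ∈ Finset.range k, truncAt (δ * lam n) (Z i ω)|} ⊆
      ⋃ k ∈ Finset.range (n + 1), (A k ∪ B k) := by
    rintro ω ⟨k, hk, hlt⟩
    refine Set.mem_biUnion (Finset.mem_coe.mpr (Finset.mem_range.mpr (Nat.lt_succ_of_le hk))) ?_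
    rcases lt_abs.mp hlt with h | h
    · exact Or.inl h.le
    · refine Or.inr ?_
      change ε * lam n ≤ ∑ i ∈ Finset.range k, truncAt (δ * lam n) (-Z i ω)
      simp only [truncAt_neg, Finset.sum_neg_distrib]
      exact h.le
  calc _ ≤ P.real (⋃ k ∈ Finset.range (n + 1), (A k ∪ B k)) :=
      measureReal_mono hsub (measure_ne_top _ _)
    _ ≤ ∑ k ∈ Finset.range (n + 1), P.real (A k ∪ B k) := measureReal_biUnion_finset_le _ _
    _ ≤ ∑ k ∈ Finset.range (n + 1), 2 * (Real.exp 1 * (n : ℝ) ^ (-M)) := by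
        refine Finset.sum_le_sum fun k hk => (measureReal_union_le _ _).trans ?_
        have hk' : k ≤ n := Nat.le_of_lt_succ (Finset.mem_range.mp hk)
        linarith [hp k hk', hn k hk']
    _ = (n + 1) * (2 * (Real.exp 1 * (n : ℝ) ^ (-M))) := by simp
    _ ≤ (n + n) * (2 * (Real.exp 1 * (n : ℝ) ^ (-M))) := by
        refine mul_le_mul_of_nonneg_right ?_ (by positivity)
        have : (1 : ℝ) ≤ n := by exact_mod_cast hn1
        linarith
    _ = _ := by
        rw [sub_eq_add_neg 1 M, Real.rpow_add hn0, Real.rpow_one]; ring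

end Sums

/-! ### Moments against the normalization -/

section Moments

variable {Ω : Type*} [MeasurableSpace Ω] {P : Measure Ω} [IsProbabilityMeasure P]
  {X : Ω → ℝ} {α ρ : ℝ}

/-- A moment of `X` of order at most two that beats the normalization. -/
theorem RegVarRV.exists_moment (hX : Measurable X) (h : RegVarRV P X α) (hα : 0 < α)
    (hfin : evariance X P < ∞ → 1 / 2 < ρ) (hinf : evariance X P = ∞ → 1 < α * ρ) :
    ∃ β : ℝ, 0 < β ∧ β ≤ 2 ∧ 1 < β * ρ ∧ Integrable (fun ω => |X ω| ^ β) P := by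
  by_cases hL2 : MemLp X 2 P
  · refine ⟨2, two_pos, le_rfl, ?_, ?_⟩
    · have := hfin hL2.evariance_lt_top
      linarith
    · have := hL2.integrable_sq
      refine this.congr (ae_of_all _ fun ω => ?_)
      simp
  · have hv : evariance X P = ∞ := evariance_eq_top hX.aestronglyMeasurable hL2
    have h1 := hinf hv
    have hρ : 0 < ρ := by
      by_contra hρ
      nlinarith
    -- Any `β` strictly between `1 / ρ` and `α` has a finite moment and satisfies `β ρ > 1`.
    obtain ⟨β, hβ1, hβ2⟩ := exists_between (show ρ⁻¹ < α by
      rw [inv_lt_iff_one_lt_mul₀ hρ]; exact h1)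
    have hβ0 : 0 < β := (inv_pos.mpr hρ).trans hβ1
    have hm : AEStronglyMeasurable (fun ω => |X ω| ^ β) P :=
      (hX.norm.pow_const β).aestronglyMeasurable
    have hint : Integrable (fun ω => |X ω| ^ β) P := by
      refine ⟨hm, ?_⟩
      rw [hasFiniteIntegral_iff_ofReal (ae_of_all _ fun ω => by positivity)]
      exact h.lintegral_rpow_lt_top hX hβ0 hβ2
    refine ⟨β, hβ0, ?_, ?_, hint⟩
    -- A finite moment of order above `2` would put `X` in `L²`, which this case excludes.
    · by_contra hgt
      push Not at hgt
      refine hL2 ((memLp_two_iff_integrable_sq hX.aestronglyMeasurable).mpr ?_)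
      refine ((integrable_const (1 : ℝ)).add hint).mono' (hX.pow_const 2).aestronglyMeasurable
        (ae_of_all _ fun ω => ?_)
      rw [Real.norm_eq_abs, abs_pow, Pi.add_apply]
      rcases le_total |X ω| 1 with h | h
      · have h2 : 0 ≤ |X ω| ^ β := by positivity
        have := pow_le_one₀ (n := 2) (abs_nonneg _) h
        linarith
      · have := Real.rpow_le_rpow_of_exponent_le h hgt.le
        rw [Real.rpow_two] at this
        linarith
    · rwa [inv_lt_iff_one_lt_mul₀ hρ] at hβ1

/-- Choose `s` with `1 / β < s < ρ`. The sequence grows at least like `n ^ s`, which gives `η = s β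
- 1 > 0`. -/
theorem RegVarSeq.exists_mul_rpow_neg_le {a : ℕ → ℝ} (h : RegVarSeq a ρ) {β : ℝ} (hβ : 0 < β)
    (hβρ : 1 < β * ρ) :
    ∃ C η : ℝ, 0 < η ∧ ∀ n : ℕ, 1 ≤ n → n * a n ^ (-β) ≤ C * (n : ℝ) ^ (-η) := by
  obtain ⟨s, hs1, hs2⟩ := exists_between (show β⁻¹ < ρ by
    rw [inv_lt_iff_one_lt_mul₀ hβ, mul_comm]; exact hβρ)
  rw [inv_lt_iff_one_lt_mul₀ hβ] at hs1
  obtain ⟨c, hc, hcn⟩ := h.exists_rpow_le hs2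
  refine ⟨c ^ (-β), s * β - 1, by linarith, fun n hn => ?_⟩
  have hn0 : (0 : ℝ) < n := by exact_mod_cast hn
  calc (n : ℝ) * a n ^ (-β) ≤ n * (c * (n : ℝ) ^ s) ^ (-β) := by
        refine mul_le_mul_of_nonneg_left ?_ hn0.le
        exact Real.rpow_le_rpow_of_nonpos (by positivity) (hcn n hn) (by linarith)
    _ = c ^ (-β) * ((n : ℝ) ^ (1 : ℝ) * (n : ℝ) ^ (s * -β)) := by
        rw [Real.mul_rpow hc.le (by positivity), ← Real.rpow_mul hn0.le, Real.rpow_one]; ring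
    _ = _ := by
        rw [← Real.rpow_add hn0]; congr 2; ring

theorem absTail_le_integral_mul_rpow {β t : ℝ} (hβ : 0 < β) (ht : 0 < t)
    (hint : Integrable (fun ω => |X ω| ^ β) P) :
    absTail P X t ≤ (∫ ω, |X ω| ^ β ∂P) * t ^ (-β) := by
  rw [Real.rpow_neg ht.le, ← div_eq_mul_inv, le_div_iff₀ (by positivity), mul_comm]
  refine le_trans ?_ (mul_meas_ge_le_integral_of_nonneg (ae_of_all _ fun ω => by positivity) hint
    (t ^ β))
  refine mul_le_mul_of_nonneg_left (measureReal_mono fun ω hω => ?_) (by positivity)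
  exact Real.rpow_le_rpow ht.le (show t < |X ω| from hω).le hβ.le

end Moments

/-! ### Negligibility of small jumps -/

section Walk

variable {Ω : Type*} [MeasurableSpace Ω] {P : Measure Ω} [IsProbabilityMeasure P]
  {Z : ℕ → Ω → ℝ} {α ρ : ℝ} {lam : ℕ → ℝ}

/-- A large jump becomes rare in the scaled walk. -/
theorem RegVarRV.tendsto_mul_absTail_zero {X : Ω → ℝ} (hX : Measurable X) (h : RegVarRV P X α)
    (hα : 0 < α) (hfin : evariance X P < ∞ → 1 / 2 < ρ) (hinf : evariance X P = ∞ → 1 < α * ρ)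
    (hlam : RegVarSeq lam ρ) :
    Tendsto (fun n : ℕ => n * absTail P X (lam n)) atTop (𝓝 0) := by
  obtain ⟨β, hβ0, hβ2, hβρ, hint⟩ := h.exists_moment hX hα hfin hinf
  obtain ⟨C, η, hη, hC⟩ := hlam.exists_mul_rpow_neg_le hβ0 hβρ
  have hlim : Tendsto (fun n : ℕ => (∫ ω, |X ω| ^ β ∂P) * (C * (n : ℝ) ^ (-η))) atTop (𝓝 0) := by
    have := ((tendsto_rpow_neg_atTop hη).comp tendsto_natCast_atTop_atTop).const_mul
      ((∫ ω, |X ω| ^ β ∂P) * C)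
    rw [mul_zero] at this
    exact this.congr fun n => by simp [mul_assoc]
  refine squeeze_zero' (Eventually.of_forall fun n => mul_nonneg n.cast_nonneg (absTail_nonneg _))
    ?_ hlim
  filter_upwards [eventually_ge_atTop 1] with n hn
  have h1 := absTail_le_integral_mul_rpow hβ0 (hlam.1 n hn) hint
  have h0 : 0 ≤ ∫ ω, |X ω| ^ β ∂P := integral_nonneg fun ω => by positivity
  calc (n : ℝ) * absTail P X (lam n) ≤ n * ((∫ ω, |X ω| ^ β ∂P) * lam n ^ (-β)) :=
        mul_le_mul_of_nonneg_left h1 n.cast_nonneg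
    _ = (∫ ω, |X ω| ^ β ∂P) * (n * lam n ^ (-β)) := by ring
    _ ≤ _ := mul_le_mul_of_nonneg_left (hC n hn) h0

/-- For a small truncation level, the small jumps are negligible at every polynomial order. -/
theorem exists_tendsto_small_jumps (hmeas : ∀ i, Measurable (Z i)) (hindep : iIndepFun Z P)
    (hident : ∀ i, IdentDistrib (Z i) (Z 0) P P) (hα : 0 < α) (hRV : RegVarRV P (Z 0) α)
    (hmean : Integrable (Z 0) P → ∫ ω, Z 0 ω ∂P = 0)
    (hlam : RegVarSeq lam ρ) (hlam_top : Tendsto lam atTop atTop)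
    (hfin : evariance (Z 0) P < ∞ → 1 / 2 < ρ) (hinf : evariance (Z 0) P = ∞ → 1 < α * ρ)
    (j : ℕ) {ε c : ℝ} (hε : 0 < ε) (hc : 0 < c) :
    ∃ δ : ℝ, 0 < δ ∧ δ ≤ c ∧ Tendsto (fun n : ℕ => ((n : ℝ) * absTail P (Z 0) (lam n))⁻¹ ^ j *
      P.real {ω | ∃ k ≤ n, ε * lam n < |∑ i ∈ Finset.range k, truncAt (δ * lam n) (Z i ω)|})
      atTop (𝓝 0) := by
  obtain ⟨β, hβ0, hβ2, hβρ, hint⟩ := hRV.exists_moment (hmeas 0) hα hfin hinf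
  obtain ⟨C, η, hη, hC⟩ := hlam.exists_mul_rpow_neg_le hβ0 hβρ
  obtain ⟨K, d, hd, hK⟩ := hRV.exists_rpow_le_absTail (hmeas 0) hlam hlam_top
  -- The normalization is `O(n ^ (-(K + 1) j))` and the bad event `O(n ^ (1 - M))`; this `M` makes
  -- the total exponent at most `-1`.
  set M : ℝ := max 1 (2 - (K + 1) * j) with hM
  have hM0 : 0 < M := lt_of_lt_of_le one_pos (le_max_left _ _)
  refine ⟨min c (ε * η / (2 * M)), lt_min hc (by positivity), min_le_left _ _, ?_⟩
  have hbound := eventually_measureReal_exists_abs_sum_truncAt_le hmeas hindep hident hβ0 hβ2 hint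
    hmean hlam.1 hη hC hε hM0 (lt_min hc (by positivity)) (min_le_right c (ε * η / (2 * M)))
  have hlim : Tendsto (fun n : ℕ => d⁻¹ ^ j * (4 * Real.exp 1) * (n : ℝ) ^ (-(1 : ℝ))) atTop
      (𝓝 0) := by
    have := ((tendsto_rpow_neg_atTop one_pos).comp tendsto_natCast_atTop_atTop).const_mul
      (d⁻¹ ^ j * (4 * Real.exp 1))
    rw [mul_zero] at this
    exact this
  refine squeeze_zero' (Eventually.of_forall fun n => ?_) ?_ hlim
  · have := absTail_nonneg (P := P) (X := Z 0) (lam n)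
    positivity
  · filter_upwards [hbound, eventually_ge_atTop 1] with n hn hn1
    have hn0 : (0 : ℝ) < n := by exact_mod_cast hn1
    have hn1' : (1 : ℝ) ≤ n := by exact_mod_cast hn1
    have h1 : d * (n : ℝ) ^ (K + 1) ≤ n * absTail P (Z 0) (lam n) := by
      rw [Real.rpow_add hn0, Real.rpow_one]
      have := mul_le_mul_of_nonneg_left (hK n hn1) hn0.le
      linarith
    calc _ ≤ (d * (n : ℝ) ^ (K + 1))⁻¹ ^ j * (4 * Real.exp 1 * (n : ℝ) ^ (1 - M)) := by
          have h2 : 0 < d * (n : ℝ) ^ (K + 1) := by positivity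
          have h3 := absTail_nonneg (P := P) (X := Z 0) (lam n)
          refine mul_le_mul ?_ hn measureReal_nonneg (by positivity)
          exact pow_le_pow_left₀ (by positivity) (inv_anti₀ h2 h1) j
      _ = d⁻¹ ^ j * (4 * Real.exp 1) * (n : ℝ) ^ (1 - M - (K + 1) * j) := by
          rw [mul_inv, mul_pow, Real.rpow_sub hn0 (1 - M), inv_pow ((n : ℝ) ^ (K + 1)),
            ← Real.rpow_mul_natCast hn0.le]
          ring
      _ ≤ _ := by
          refine mul_le_mul_of_nonneg_left ?_ (by positivity)
          refine Real.rpow_le_rpow_of_exponent_le hn1' ?_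
          have := le_max_right 1 (2 - (K + 1) * (j : ℝ))
          linarith

end Walk

/-! ### Step functions in the Skorohod topology -/

theorem stepFun_apply {j : ℕ} (z u : Fin j → ℝ) (t : unitInterval) :
    stepFun z u t = ∑ i, if u i ≤ (t : ℝ) then z i else 0 := rfl

theorem smul_stepFun {j : ℕ} (c : ℝ) (z u : Fin j → ℝ) :
    c • stepFun z u = stepFun (fun i => c * z i) u := by
  ext t
  change c * stepFun z u t = _
  simp only [stepFun_apply, Finset.mul_sum, mul_ite, mul_zero]

theorem SkorohodD.edist_le_of_timeChange {f g : SkorohodD} {a : ℝ}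
    (τ : unitInterval ≃o unitInterval) (h1 : ∀ t, |f t - g (τ t)| ≤ a)
    (h2 : ∀ t, |((τ t : unitInterval) : ℝ) - t| ≤ a) : edist f g ≤ ENNReal.ofReal a := by
  refine iInf_le_of_le τ (max_le (iSup_le fun t => ?_) (iSup_le fun t => ?_))
  · rw [edist_dist]
    exact ENNReal.ofReal_le_ofReal (h1 t)
  · rw [edist_dist]
    exact ENNReal.ofReal_le_ofReal (h2 t)

theorem SkorohodD.edist_le_of_forall_abs_le {f g : SkorohodD} {a : ℝ}
    (h : ∀ t, |f t - g t| ≤ a) : edist f g ≤ ENNReal.ofReal a :=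
  SkorohodD.edist_le_of_timeChange (OrderIso.refl _) h fun t => by
    simpa using (abs_nonneg _).trans (h t)

/-- If `τ` carries each jump time to its counterpart, then at every instant the same jumps have
occurred on both sides, and only the jump sizes differ. -/
theorem edist_stepFun_le {j : ℕ} {z u z' u' : Fin j → ℝ} {a : ℝ}
    (τ : unitInterval ≃o unitInterval)
    (hτ : ∀ i t, u' i ≤ ((τ t : unitInterval) : ℝ) ↔ u i ≤ (t : ℝ))
    (hz : ∑ i, |z i - z' i| ≤ a) (h2 : ∀ t, |((τ t : unitInterval) : ℝ) - t| ≤ a) :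
    edist (stepFun z u) (stepFun z' u') ≤ ENNReal.ofReal a := by
  refine SkorohodD.edist_le_of_timeChange τ (fun t => le_trans ?_ hz) h2
  rw [stepFun_apply, stepFun_apply, ← Finset.sum_sub_distrib]
  refine (Finset.abs_sum_le_sum_abs _ _).trans (Finset.sum_le_sum fun i _ => ?_)
  by_cases h : u i ≤ (t : ℝ)
  · rw [if_pos h, if_pos ((hτ i t).mpr h)]
  · rw [if_neg h, if_neg (mt (hτ i t).mp h)]
    simp

theorem edist_stepFun_left_le {j : ℕ} (z z' u : Fin j → ℝ) :
    edist (stepFun z u) (stepFun z' u) ≤ ENNReal.ofReal (∑ i, |z i - z' i|) :=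
  edist_stepFun_le (OrderIso.refl _) (fun _ _ => Iff.rfl) le_rfl fun t => by
    simpa using Finset.sum_nonneg fun i _ => abs_nonneg (z i - z' i)

theorem continuous_stepFun_left {j : ℕ} (u : Fin j → ℝ) :
    Continuous fun z : Fin j → ℝ => stepFun z u := by
  refine continuous_iff_continuousAt.mpr fun z => ?_
  rw [ContinuousAt, tendsto_iff_edist_tendsto_0]
  refine tendsto_of_tendsto_of_tendsto_of_le_of_le tendsto_const_nhds
    (h := fun z' => ENNReal.ofReal (∑ i, |z' i - z i|)) ?_ (fun _ => bot_le)
    (fun z' => edist_stepFun_left_le z' z u)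
  have : Continuous fun z' : Fin j → ℝ => ENNReal.ofReal (∑ i, |z' i - z i|) :=
    ENNReal.continuous_ofReal.comp (by fun_prop)
  simpa using this.tendsto z

/-- Small shifts of finitely many interior points of `[0,1]` are realized by a time change close to
the identity. -/
theorem exists_timeChange {j : ℕ} {u : Fin j → ℝ} (hu : ∀ i, u i ∈ Set.Ioo (0 : ℝ) 1)
    (hinj : Function.Injective u) :
    ∃ η : ℝ, 0 < η ∧ ∀ u' : Fin j → ℝ, ∑ i, |u' i - u i| < η →
      ∃ τ : unitInterval ≃o unitInterval,
        (∀ i t, u' i ≤ ((τ t : unitInterval) : ℝ) ↔ u i ≤ (t : ℝ)) ∧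
        ∀ t, |((τ t : unitInterval) : ℝ) - t| ≤ ∑ i, |u' i - u i| := by
  have hev : ∀ᶠ η : ℝ in 𝓝[>] 0, 0 < η ∧ ∀ i, η ≤ u i ∧ η ≤ 1 - u i ∧
      ∀ k, k ≠ i → η ≤ |u k - u i| := by
    have hle : ∀ x : ℝ, 0 < x → ∀ᶠ η : ℝ in 𝓝[>] 0, η ≤ x := fun x hx =>
      nhdsWithin_le_nhds (eventually_le_nhds hx)
    refine (eventually_mem_nhdsWithin).and (eventually_all.mpr fun i => ?_)
    refine (hle _ (hu i).1).and ((hle _ (by linarith [(hu i).2])).and (eventually_all.mpr fun k => ?_))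
    by_cases hk : k = i
    · simp [hk]
    · filter_upwards [hle _ (abs_pos.mpr (sub_ne_zero.mpr fun h => hk (hinj h)))] with η hη _
      exact hη
  obtain ⟨η, hη, hgap⟩ := hev.exists
  refine ⟨η, hη, fun u' hu' => ?_⟩
  set D := ∑ i, |u' i - u i| with hD
  -- Tent functions of height `1` and half-width `η`. As `η` is at most each gap between the points
  -- and to the endpoints, each tent vanishes at `0`, at `1` and at the other `u k`. So `f` fixes
  -- the endpoints and sends `u i` to `u' i`; it is strictly increasing because the perturbation has
  -- Lipschitz constant at most `D / η < 1`.
  let φ : Fin j → ℝ → ℝ := fun i t => max 0 (1 - |t - u i| / η)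
  let f : ℝ → ℝ := fun t => t + ∑ i, (u' i - u i) * φ i t
  have hφcont : ∀ i, Continuous (φ i) := fun i => by fun_prop
  have hfcont : Continuous f := by fun_prop
  have hφ0 : ∀ i t, η ≤ |t - u i| → φ i t = 0 := by
    intro i t h
    refine max_eq_left ?_
    rw [sub_nonpos, le_div_iff₀ hη, one_mul]
    exact h
  have hφabs : ∀ i t, |φ i t| ≤ 1 := by
    intro i t
    rw [abs_of_nonneg (le_max_left _ _)]
    refine max_le zero_le_one ?_
    have : 0 ≤ |t - u i| / η := by positivity
    linarith
  have hφlip : ∀ i s t, |φ i t - φ i s| ≤ |t - s| / η := by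
    intro i s t
    refine (abs_max_sub_max_le_max 0 _ 0 _).trans ?_
    rw [sub_self, abs_zero, max_eq_right (abs_nonneg _), sub_sub_sub_cancel_left, ← sub_div,
      abs_div, abs_of_pos hη, abs_sub_comm t s]
    refine div_le_div_of_nonneg_right ((abs_abs_sub_abs_le_abs_sub _ _).trans (le_of_eq ?_)) hη.le
    rw [sub_sub_sub_cancel_right]
  have hfsub : ∀ t, |f t - t| ≤ D := by
    intro t
    simp only [f, add_sub_cancel_left]
    refine (Finset.abs_sum_le_sum_abs _ _).trans (Finset.sum_le_sum fun i _ => ?_)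
    rw [abs_mul]
    exact mul_le_of_le_one_right (abs_nonneg _) (hφabs i t)
  have hfmono : StrictMono f := by
    intro s t hst
    have h1 : |∑ i, (u' i - u i) * φ i s - ∑ i, (u' i - u i) * φ i t| ≤ D * ((t - s) / η) := by
      rw [← Finset.sum_sub_distrib, hD, Finset.sum_mul]
      refine (Finset.abs_sum_le_sum_abs _ _).trans (Finset.sum_le_sum fun i _ => ?_)
      rw [← mul_sub, abs_mul, abs_sub_comm (φ i s)]
      refine mul_le_mul_of_nonneg_left ?_ (abs_nonneg _)
      have := hφlip i s t
      rwa [abs_of_pos (sub_pos.mpr hst)] at this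
    have h2 : D * ((t - s) / η) < t - s := by
      rw [← mul_div_assoc, div_lt_iff₀ hη, mul_comm]
      exact mul_lt_mul_of_pos_left hu' (sub_pos.mpr hst)
    have h3 := (abs_le.mp h1).2
    simp only [f]
    linarith
  have hf0 : f 0 = 0 := by
    simp only [f, zero_add]
    refine Finset.sum_eq_zero fun i _ => ?_
    rw [hφ0 i 0, mul_zero]
    rw [zero_sub, abs_neg, abs_of_pos (hu i).1]
    exact (hgap i).1
  have hf1 : f 1 = 1 := by
    simp only [f, add_eq_left]
    refine Finset.sum_eq_zero fun i _ => ?_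
    rw [hφ0 i 1, mul_zero]
    rw [abs_of_pos (by linarith [(hu i).2])]
    exact (hgap i).2.1
  have hfu : ∀ i, f (u i) = u' i := by
    intro i
    simp only [f]
    rw [Finset.sum_eq_single i]
    · simp [φ]
    · intro k _ hk
      rw [hφ0 k (u i), mul_zero]
      rw [abs_sub_comm]
      exact (hgap i).2.2 k hk
    · simp
  have hmem : ∀ t : unitInterval, f t ∈ unitInterval := fun t =>
    ⟨hf0.symm.le.trans (hfmono.monotone t.2.1), (hfmono.monotone t.2.2).trans hf1.le⟩
  let F : unitInterval → unitInterval := fun t => ⟨f t, hmem t⟩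
  have hFmono : StrictMono F := fun s t hst => hfmono hst
  have hFcont : Continuous F := (hfcont.comp continuous_subtype_val).subtype_mk _
  have hFsurj : Function.Surjective F := by
    intro y
    have h0 : F 0 = 0 := Subtype.ext hf0
    have h1 : F 1 = 1 := Subtype.ext hf1
    refine intermediate_value_univ 0 1 hFcont ?_
    rw [h0, h1]
    exact ⟨y.2.1, y.2.2⟩
  refine ⟨hFmono.orderIsoOfSurjective F hFsurj, fun i t => ?_, fun t => hfsub t⟩
  change u' i ≤ f t ↔ _
  rw [← hfu i]
  exact hfmono.le_iff_le

/-- Jump sizes and strictly increasing jump times in the open unit interval. -/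
def interiorDomain (j : ℕ) : Set ((Fin j → ℝ) × (Fin j → ℝ)) :=
  {zu | (∀ i, zu.2 i ∈ Set.Ioo (0 : ℝ) 1) ∧ StrictMono zu.2}

theorem isOpen_interiorDomain (j : ℕ) : IsOpen (interiorDomain j) := by
  have h : interiorDomain j = (⋂ i, {zu | zu.2 i ∈ Set.Ioo (0 : ℝ) 1}) ∩
      ⋂ (i) (k) (_ : i < k), {zu : (Fin j → ℝ) × (Fin j → ℝ) | zu.2 i < zu.2 k} := by
    ext zu
    simp only [interiorDomain, Set.mem_inter_iff, Set.mem_iInter, Set.mem_ofPred_eq]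
    exact Iff.rfl
  rw [h]
  refine (isOpen_iInter_of_finite fun i => ?_).inter (isOpen_iInter_of_finite fun i =>
    isOpen_iInter_of_finite fun k => isOpen_iInter_of_finite fun _ => ?_)
  · exact isOpen_Ioo.preimage (by fun_prop)
  · exact isOpen_lt (by fun_prop) (by fun_prop)

/-- Nearby jump times are matched by a small time change. Interior times are required because time
changes fix `0` and `1`, so a jump at an endpoint cannot be moved. -/
theorem continuousOn_stepFun (j : ℕ) :
    ContinuousOn (fun zu : (Fin j → ℝ) × (Fin j → ℝ) => stepFun zu.1 zu.2) (interiorDomain j) := by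
  rintro ⟨z, u⟩ ⟨hu, hmono⟩
  refine ContinuousAt.continuousWithinAt ?_
  obtain ⟨η, hη, hτ⟩ := exists_timeChange hu hmono.injective
  rw [ContinuousAt, tendsto_iff_edist_tendsto_0]
  have hcont : Continuous fun zu : (Fin j → ℝ) × (Fin j → ℝ) =>
      max (∑ i, |z i - zu.1 i|) (∑ i, |zu.2 i - u i|) := by fun_prop
  have hcont2 : Continuous fun zu : (Fin j → ℝ) × (Fin j → ℝ) => ∑ i, |zu.2 i - u i| := by fun_prop
  have hlim := (ENNReal.continuous_ofReal.comp hcont).tendsto (z, u)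
  simp only [Function.comp_apply, sub_self, abs_zero, Finset.sum_const_zero, max_self,
    ENNReal.ofReal_zero] at hlim
  refine tendsto_of_tendsto_of_tendsto_of_le_of_le' tendsto_const_nhds hlim
    (Eventually.of_forall fun _ => bot_le) ?_
  have hev := (hcont2.tendsto (z, u)).eventually (eventually_lt_nhds (b := η) (by simpa using hη))
  filter_upwards [hev] with zu hzu
  obtain ⟨τ, hτ1, hτ2⟩ := hτ zu.2 hzu
  rw [edist_comm]
  exact edist_stepFun_le τ hτ1 (le_max_left _ _) fun t => (hτ2 t).trans (le_max_right _ _)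

theorem stepFun_eq_comp {m n : ℕ} {k : Fin m → Fin n} (hk : Function.Injective k)
    {z : Fin n → ℝ} (u : Fin n → ℝ) (hz : ∀ i ∉ Set.range k, z i = 0) :
    stepFun z u = stepFun (z ∘ k) (u ∘ k) := by
  ext t
  rw [stepFun_apply, stepFun_apply]
  refine (Fintype.sum_of_injective k hk _ _ (fun i hi => ?_) fun i => rfl).symm
  rw [hz i hi, ite_self]

theorem stepFun_mem_stepAtMost {m n : ℕ} {z u : Fin n → ℝ} (hu : StrictMono u)
    (hu01 : ∀ i, u i ∈ Set.Icc (0 : ℝ) 1)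
    (hcard : (Finset.univ.filter fun i => z i ≠ 0).card ≤ m) : stepFun z u ∈ stepAtMost m := by
  set S := Finset.univ.filter fun i => z i ≠ 0
  -- Zero jumps are deleted by enumerating the others in increasing order.
  set k := S.orderEmbOfFin rfl with hk
  have hrange : Set.range k = S := Finset.range_orderEmbOfFin S rfl
  rw [stepFun_eq_comp k.injective u (fun i hi => by
    by_contra h
    exact hi (by rw [hrange]; simpa [S] using h))]
  refine Set.mem_biUnion (x := S.card) (by simpa using Nat.lt_succ_of_le hcard) ?_
  refine ⟨(z ∘ k, u ∘ k), ⟨fun i => ?_, fun i => hu01 _, hu.comp k.strictMono⟩, rfl⟩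
  have : k i ∈ (S : Set (Fin n)) := hrange ▸ Set.mem_range_self i
  simpa [S] using this

/-- A step function with `j` jumps at distance `r` from those with fewer jumps has no jump smaller
than `r`. -/
theorem le_abs_of_stepFun_mem {j : ℕ} {A : Set SkorohodD} {r : ℝ}
    (hA : ∀ x ∈ stepAtMost (j - 1), ∀ y ∈ A, ENNReal.ofReal r ≤ edist x y)
    {z u : Fin j → ℝ} (hu : StrictMono u) (hu01 : ∀ i, u i ∈ Set.Icc (0 : ℝ) 1)
    (h : stepFun z u ∈ A) (i : Fin j) : r ≤ |z i| := by
  -- Erasing the `i`-th jump leaves at most `j - 1` jumps and moves the path by at most `|z i|`.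
  have hmem : stepFun (Function.update z i 0) u ∈ stepAtMost (j - 1) := by
    refine stepFun_mem_stepAtMost hu hu01 ?_
    refine (Finset.card_le_card (t := Finset.univ.erase i) fun k hk => ?_).trans (by simp)
    simp only [Finset.mem_filter, Finset.mem_univ, true_and] at hk
    refine Finset.mem_erase.mpr ⟨fun hki => hk ?_, Finset.mem_univ _⟩
    rw [hki, Function.update_self]
  have h1 := (hA _ hmem _ h).trans (edist_stepFun_left_le _ _ u)
  rw [ENNReal.ofReal_le_ofReal_iff (Finset.sum_nonneg fun _ _ => abs_nonneg _),
    Finset.sum_eq_single i] at h1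
  · simpa using h1
  · intro k _ hk
    simp [Function.update_of_ne hk]
  · simp

/-! ### Weak convergence of jump sizes and jump times -/

/-- Intervals `(a, b]` form a π-system containing small neighbourhoods of every point, and their
masses are differences of tails. -/
theorem tendsto_probabilityMeasure_of_tendsto_Ioi {μ : ℕ → ProbabilityMeasure ℝ}
    {ν : ProbabilityMeasure ℝ}
    (h : ∀ x, Tendsto (fun n => (μ n : Measure ℝ).real (Set.Ioi x)) atTop
      (𝓝 ((ν : Measure ℝ).real (Set.Ioi x)))) :
    Tendsto μ atTop (𝓝 ν) := by
  refine (isPiSystem_Ioc (id : ℝ → ℝ) id).tendsto_probabilityMeasure_of_tendsto_of_mem ?_ ?_ ?_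
  · rintro _ ⟨a, b, -, rfl⟩
    exact measurableSet_Ioc
  · intro u hu x hx
    obtain ⟨ε, hε, hball⟩ := Metric.isOpen_iff.mp hu x hx
    refine ⟨Set.Ioc (x - ε / 2) (x + ε / 2), ⟨x - ε / 2, x + ε / 2, by simp; linarith, rfl⟩,
      Ioc_mem_nhds (by linarith) (by linarith), fun y hy => hball ?_⟩
    rw [Metric.mem_ball, Real.dist_eq, abs_lt]
    constructor <;> linarith [hy.1, hy.2]
  · rintro _ ⟨a, b, hab, rfl⟩
    have hab : a < b := hab
    have key : ∀ m : ProbabilityMeasure ℝ, (m : Measure ℝ).real (Set.Ioc a b) =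
        (m : Measure ℝ).real (Set.Ioi a) - (m : Measure ℝ).real (Set.Ioi b) := by
      intro m
      rw [← measureReal_sdiff (Set.Ioi_subset_Ioi hab.le) measurableSet_Ioi]
      congr 1
      ext y
      simp
    have h1 := (h a).sub (h b)
    simp only [← key] at h1
    exact NNReal.tendsto_coe.mp h1

/-- The uniform distribution on the grid `1/n, …, n/n`. -/
noncomputable def gridMeasure (n : ℕ) : Measure ℝ :=
  (n : ℝ≥0∞)⁻¹ • ∑ k : Fin n, Measure.dirac (((k : ℝ) + 1) / n)

theorem gridMeasure_apply (n : ℕ) {s : Set ℝ} (hs : MeasurableSet s) :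
    gridMeasure n s = (n : ℝ≥0∞)⁻¹ * ∑ k : Fin n, s.indicator 1 (((k : ℝ) + 1) / n) := by
  simp [gridMeasure, hs]

theorem isProbabilityMeasure_gridMeasure {n : ℕ} (hn : 1 ≤ n) :
    IsProbabilityMeasure (gridMeasure n) := by
  refine ⟨?_⟩
  rw [gridMeasure_apply n MeasurableSet.univ]
  simp only [Set.indicator_univ, Pi.one_apply, Finset.sum_const, Finset.card_univ,
    Fintype.card_fin, nsmul_eq_mul, mul_one]
  exact ENNReal.inv_mul_cancel (by simpa using (by omega : n ≠ 0)) (by simp)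

theorem gridMeasure_real_Ioi {n : ℕ} (hn : 1 ≤ n) {x : ℝ} (hx0 : 0 ≤ x) (hx1 : x ≤ 1) :
    (gridMeasure n).real (Set.Ioi x) = 1 - (⌊x * n⌋₊ : ℝ) / n := by
  have hn0 : (0 : ℝ) < n := by exact_mod_cast hn
  have hfl : ⌊x * n⌋₊ ≤ n := by
    have h1 : ⌊x * n⌋₊ ≤ ⌊(n : ℝ)⌋₊ := Nat.floor_le_floor (by nlinarith)
    simpa using h1
  -- With indices from zero, the grid point `(k + 1) / n` exceeds `x` exactly when `⌊x n⌋ ≤ k`.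
  have hcount : ∑ k : Fin n, (Set.Ioi x).indicator (1 : ℝ → ℝ≥0∞) (((k : ℝ) + 1) / n) =
      ((n - ⌊x * n⌋₊ : ℕ) : ℝ≥0∞) := by
    have h1 : ∀ k : ℕ, (Set.Ioi x).indicator (1 : ℝ → ℝ≥0∞) (((k : ℝ) + 1) / n) =
        if ⌊x * n⌋₊ ≤ k then 1 else 0 := by
      intro k
      rw [Set.indicator_apply]
      refine if_congr ?_ rfl rfl
      rw [Set.mem_Ioi, lt_div_iff₀ hn0, ← Nat.lt_add_one_iff, Nat.floor_lt (by positivity)]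
      push_cast
      exact Iff.rfl
    rw [Fin.sum_univ_eq_sum_range
      (fun k : ℕ => (Set.Ioi x).indicator (1 : ℝ → ℝ≥0∞) (((k : ℝ) + 1) / n))]
    simp only [h1]
    rw [Finset.sum_boole]
    congr 1
    have : (Finset.range n).filter (fun k => ⌊x * n⌋₊ ≤ k) = Finset.Ico ⌊x * n⌋₊ n := by
      ext k
      simp [and_comm]
    rw [this, Nat.card_Ico]
  rw [measureReal_def, gridMeasure_apply n measurableSet_Ioi, hcount, ENNReal.toReal_mul,
    ENNReal.toReal_inv, ENNReal.toReal_natCast, ENNReal.toReal_natCast, Nat.cast_sub hfl]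
  field_simp

theorem tendsto_gridMeasure_real_Ioi (x : ℝ) :
    Tendsto (fun n => (gridMeasure n).real (Set.Ioi x)) atTop
      (𝓝 ((volume.restrict (Set.Icc (0 : ℝ) 1)).real (Set.Ioi x))) := by
  have hvol : (volume.restrict (Set.Icc (0 : ℝ) 1)).real (Set.Ioi x) =
      volume.real (Set.Ioi x ∩ Set.Icc 0 1) := by
    rw [measureReal_restrict_apply measurableSet_Ioi]
  rw [hvol]
  rcases lt_or_ge x 0 with hx | hx
  · have h1 : Set.Ioi x ∩ Set.Icc 0 1 = Set.Icc (0 : ℝ) 1 :=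
      Set.inter_eq_right.mpr fun y hy => lt_of_lt_of_le hx hy.1
    rw [h1, Real.volume_real_Icc_of_le zero_le_one, sub_zero]
    refine tendsto_const_nhds.congr' ?_
    filter_upwards [eventually_ge_atTop 1] with n hn
    have := isProbabilityMeasure_gridMeasure hn
    have hn0 : (0 : ℝ) < n := by exact_mod_cast hn
    have h2 : (gridMeasure n).real (Set.Ioi 0) = 1 := by
      rw [gridMeasure_real_Ioi hn le_rfl zero_le_one]
      simp
    refine le_antisymm ?_ measureReal_le_one
    rw [← h2]
    exact measureReal_mono (Set.Ioi_subset_Ioi hx.le)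
  · rcases le_or_gt x 1 with hx1 | hx1
    · have h1 : Set.Ioi x ∩ Set.Icc 0 1 = Set.Ioc x 1 := by
        ext y
        simp only [Set.mem_inter_iff, Set.mem_Ioi, Set.mem_Icc, Set.mem_Ioc]
        exact ⟨fun h => ⟨h.1, h.2.2⟩, fun h => ⟨h.1, by linarith, h.2⟩⟩
      rw [h1, Real.volume_real_Ioc_of_le hx1]
      have h2 := ((tendsto_nat_floor_mul_div_atTop hx).comp
        (tendsto_natCast_atTop_atTop (R := ℝ))).const_sub 1
      refine h2.congr' ?_
      filter_upwards [eventually_ge_atTop 1] with n hn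
      rw [gridMeasure_real_Ioi hn hx hx1, Function.comp_apply]
    · have h1 : Set.Ioi x ∩ Set.Icc 0 1 = ∅ := by
        ext y
        simp only [Set.mem_inter_iff, Set.mem_Ioi, Set.mem_Icc, Set.mem_empty_iff_false, iff_false]
        rintro ⟨h1, h2⟩
        linarith
      rw [h1, measureReal_empty]
      refine tendsto_const_nhds.congr' ?_
      filter_upwards [eventually_ge_atTop 1] with n hn
      have := isProbabilityMeasure_gridMeasure hn
      have hn0 : (0 : ℝ) < n := by exact_mod_cast hn
      have h2 : (gridMeasure n).real (Set.Ioi 1) = 0 := by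
        rw [gridMeasure_real_Ioi hn zero_le_one le_rfl]
        simp [hn0.ne']
      refine le_antisymm measureReal_nonneg ?_
      rw [← h2]
      exact measureReal_mono (Set.Ioi_subset_Ioi hx1.le)

/-- The points of modulus greater than `c`. -/
def absGt (c : ℝ) : Set ℝ := {y | c < |y|}

theorem mem_absGt {c y : ℝ} : y ∈ absGt c ↔ c < |y| := Iff.rfl

theorem measurableSet_absGt (c : ℝ) : MeasurableSet (absGt c) :=
  (isOpen_lt continuous_const continuous_abs).measurableSet

theorem absGt_inter_Ioi {c x : ℝ} (hx : c ≤ x) : absGt c ∩ Set.Ioi x = Set.Ioi x :=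
  Set.inter_eq_right.mpr fun y hy => (hx.trans_lt hy).trans_le (le_abs_self y)

theorem absGt_inter_Iic {c x : ℝ} (hx : x < -c) : absGt c ∩ Set.Iic x = Set.Iic x :=
  Set.inter_eq_right.mpr fun y hy => mem_absGt.mpr (lt_abs.mpr (Or.inr (by
    have : y ≤ x := hy
    linarith)))

theorem absGt_inter_Ioi_of_mem_Icc {c x : ℝ} (h1 : -c ≤ x) (h2 : x ≤ c) :
    absGt c ∩ Set.Ioi x = absGt c ∩ Set.Ioi c := by
  ext y
  simp only [Set.mem_inter_iff, mem_absGt, Set.mem_Ioi, lt_abs]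
  constructor
  · rintro ⟨h | h, h'⟩
    · exact ⟨Or.inl h, h⟩
    · linarith
  · rintro ⟨h, h'⟩
    exact ⟨h, by linarith⟩

/-! ### Tails and conditioning of `nuAlpha` -/

section NuAlpha

variable {α p : ℝ}

instance : SigmaFinite (nuAlpha α p) := SigmaFinite.withDensity_ofReal _

theorem nuAlpha_Ioi {x : ℝ} (hα : 0 < α) (hp0 : 0 ≤ p) (hx : 0 < x) :
    nuAlpha α p (Set.Ioi x) = ENNReal.ofReal (p * x ^ (-α)) := by
  rw [nuAlpha, withDensity_apply _ measurableSet_Ioi, ← lintegral_pareto_tail hα hp0 hx]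
  refine setLIntegral_congr_fun measurableSet_Ioi fun t ht => ?_
  have ht0 : (0 : ℝ) < t := hx.trans ht
  simp [nuDensity, ht0]

theorem nuAlpha_absGt {c : ℝ} (hα : 0 < α) (hp0 : 0 ≤ p) (hp1 : p ≤ 1) (hc : 0 < c) :
    nuAlpha α p (absGt c) = ENNReal.ofReal (c ^ (-α)) := by
  have h1 : absGt c = Set.Iio (-c) ∪ Set.Ioi c := by
    ext y
    simp only [mem_absGt, lt_abs, Set.mem_union, Set.mem_Iio, Set.mem_Ioi]
    constructor
    · rintro (h | h)
      · exact Or.inr h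
      · exact Or.inl (by linarith)
    · rintro (h | h)
      · exact Or.inr (by linarith)
      · exact Or.inl h
  rw [h1, nuAlpha_tails hα hp0 hp1 hc hc]
  congr 1
  ring

theorem nuAlpha_Iic {x : ℝ} (hα : 0 < α) (hp0 : 0 ≤ p) (hp1 : p ≤ 1) (hx : x < 0) :
    nuAlpha α p (Set.Iic x) = ENNReal.ofReal ((1 - p) * (-x) ^ (-α)) := by
  have hx' : 0 < -x := by linarith
  have hx'' : 0 < (-x) ^ (-α) := by positivity
  have h1 : nuAlpha α p (Set.Iic x) = nuAlpha α p (Set.Iio x) :=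
    measure_congr ((withDensity_absolutelyContinuous volume _).ae_eq Iio_ae_eq_Iic).symm
  have h2 := nuAlpha_tails hα hp0 hp1 hx' hx'
  have hdisj : Disjoint (Set.Iio x) (Set.Ioi (-x)) :=
    Set.disjoint_left.mpr fun t (ha : t < x) (hb : -x < t) => by linarith
  rw [neg_neg, measure_union hdisj measurableSet_Ioi, nuAlpha_Ioi hα hp0 hx', ENNReal.ofReal_add
      (mul_nonneg (by linarith) hx''.le) (by positivity)] at h2
  rw [h1]
  exact (ENNReal.add_left_inj ENNReal.ofReal_ne_top).mp h2

/-- The limiting distribution of a jump of modulus greater than `c`. -/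
theorem isProbabilityMeasure_cond_nuAlpha {c : ℝ} (hα : 0 < α) (hp0 : 0 ≤ p) (hp1 : p ≤ 1)
    (hc : 0 < c) : IsProbabilityMeasure ((nuAlpha α p)[|absGt c]) := by
  refine cond_isProbabilityMeasure_of_finite ?_ ?_
  · rw [nuAlpha_absGt hα hp0 hp1 hc]
    have : 0 < c ^ (-α) := by positivity
    simpa using this
  · rw [nuAlpha_absGt hα hp0 hp1 hc]
    exact ENNReal.ofReal_ne_top

end NuAlpha

theorem cond_absGt_real_apply {μ : Measure ℝ} {c : ℝ} (s : Set ℝ) :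
    (μ[|absGt c]).real s = μ.real (absGt c ∩ s) / μ.real (absGt c) := by
  rw [measureReal_def, cond_apply (measurableSet_absGt c), ENNReal.toReal_mul, ENNReal.toReal_inv,
    div_eq_inv_mul, measureReal_def, measureReal_def]

/-! ### Convergence of the conditioned jump data -/

section JumpLaw

variable {Ω : Type*} [MeasurableSpace Ω] {P : Measure Ω} {X : Ω → ℝ} {α p : ℝ}

/-- The distribution of `X / l`. -/
noncomputable def scaledLaw (P : Measure Ω) (X : Ω → ℝ) (l : ℝ) : Measure ℝ :=
  P.map fun ω => l⁻¹ * X ω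

theorem scaledLaw_real_Ioi (hX : Measurable X) {l : ℝ} (hl : 0 < l) (x : ℝ) :
    (scaledLaw P X l).real (Set.Ioi x) = P.real {ω | x * l < X ω} := by
  rw [scaledLaw, map_measureReal_apply (hX.const_mul _) measurableSet_Ioi]
  congr 1
  ext ω
  simp [inv_mul_eq_div, lt_div_iff₀ hl]

theorem scaledLaw_real_Iic (hX : Measurable X) {l : ℝ} (hl : 0 < l) (x : ℝ) :
    (scaledLaw P X l).real (Set.Iic x) = P.real {ω | X ω ≤ x * l} := by
  rw [scaledLaw, map_measureReal_apply (hX.const_mul _) measurableSet_Iic]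
  congr 1
  ext ω
  simp [inv_mul_eq_div, div_le_iff₀ hl]

variable [IsProbabilityMeasure P]

theorem isProbabilityMeasure_scaledLaw (hX : Measurable X) (l : ℝ) :
    IsProbabilityMeasure (scaledLaw P X l) :=
  Measure.isProbabilityMeasure_map (hX.const_mul _).aemeasurable

theorem scaledLaw_absGt (hX : Measurable X) {l : ℝ} (hl : 0 < l) (c : ℝ) :
    scaledLaw P X l (absGt c) = ENNReal.ofReal (absTail P X (c * l)) := by
  rw [scaledLaw, Measure.map_apply (hX.const_mul _) (measurableSet_absGt c), absTail,
    ofReal_measureReal]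
  congr 1
  ext ω
  rw [Set.mem_preimage, mem_absGt, abs_mul, abs_inv, abs_of_pos hl, inv_mul_eq_div, lt_div_iff₀ hl]
  exact Iff.rfl

theorem scaledLaw_real_absGt (hX : Measurable X) {l : ℝ} (hl : 0 < l) (c : ℝ) :
    (scaledLaw P X l).real (absGt c) = absTail P X (c * l) := by
  rw [measureReal_def, scaledLaw_absGt hX hl, ENNReal.toReal_ofReal (absTail_nonneg _)]

theorem isProbabilityMeasure_cond_scaledLaw (hX : Measurable X) (h : RegVarRV P X α) {l : ℝ}
    (hl : 0 < l) (c : ℝ) : IsProbabilityMeasure ((scaledLaw P X l)[|absGt c]) := by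
  have := isProbabilityMeasure_scaledLaw (P := P) hX l
  refine cond_isProbabilityMeasure ?_
  rw [scaledLaw_absGt hX hl]
  simpa using h.absTail_pos hX _

/-- Conditioning on `|y| > c` turns convergence away from `0` into weak convergence of probability
measures. For `x ≥ c` the tail factors into a balance ratio tending to `p` and a ratio of tails of
`|X|`. Between `-c` and `c` there is no mass, and below `-c` the complement is treated in the same
way. -/
theorem tendsto_cond_scaledLaw_real_Ioi (hX : Measurable X) (h : RegVarRV P X α) (hα : 0 < α)
    (hb : TailBalance P X p) {c : ℝ} (hc : 0 < c) {l : ℕ → ℝ} (hl : ∀ n, 0 < l n)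
    (hltop : Tendsto l atTop atTop) (x : ℝ) :
    Tendsto (fun n => ((scaledLaw P X (l n))[|absGt c]).real (Set.Ioi x)) atTop
      (𝓝 (((nuAlpha α p)[|absGt c]).real (Set.Ioi x))) := by
  have hpos := h.absTail_pos hX
  obtain ⟨hp0, hp1, -, -⟩ := id hb
  have hcα : 0 < c ^ (-α) := by positivity
  have hν : (nuAlpha α p).real (absGt c) = c ^ (-α) := by
    rw [measureReal_def, nuAlpha_absGt hα hp0 hp1 hc, ENNReal.toReal_ofReal hcα.le]
  have hratio : ∀ y : ℝ, 0 < y →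
      Tendsto (fun n => absTail P X (y * l n) / absTail P X (c * l n)) atTop
        (𝓝 (y ^ (-α) / c ^ (-α))) := by
    intro y hy
    have := ((h.tendsto_div hX hy).comp hltop).div ((h.tendsto_div hX hc).comp hltop) hcα.ne'
    refine this.congr fun n => ?_
    have h1 := (hpos (l n)).ne'
    simp only [Pi.div_apply, Function.comp_apply]
    rw [div_div_div_cancel_right₀ h1]
  have hright : ∀ y : ℝ, c ≤ y →
      Tendsto (fun n => ((scaledLaw P X (l n))[|absGt c]).real (Set.Ioi y)) atTop
        (𝓝 (((nuAlpha α p)[|absGt c]).real (Set.Ioi y))) := by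
    intro y hy
    have hy0 : 0 < y := hc.trans_le hy
    have h1 := ((hb.tendsto_right hX h).comp (hltop.const_mul_atTop hy0)).mul (hratio y hy0)
    have h2 : ((nuAlpha α p)[|absGt c]).real (Set.Ioi y) = p * (y ^ (-α) / c ^ (-α)) := by
      rw [cond_absGt_real_apply, absGt_inter_Ioi hy, hν, measureReal_def, nuAlpha_Ioi hα hp0 hy0,
        ENNReal.toReal_ofReal (by positivity), mul_div_assoc]
    rw [h2]
    refine h1.congr fun n => ?_
    rw [cond_absGt_real_apply, absGt_inter_Ioi hy, scaledLaw_real_absGt hX (hl n),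
      scaledLaw_real_Ioi hX (hl n)]
    simp only [Function.comp_apply]
    rw [div_mul_div_cancel₀ (hpos _).ne']
  rcases le_or_gt c x with hx | hx
  · exact hright x hx
  · rcases le_or_gt (-c) x with hx' | hx'
    · simp only [cond_absGt_real_apply, absGt_inter_Ioi_of_mem_Icc hx' hx.le]
      simpa only [cond_absGt_real_apply] using hright c le_rfl
    · have hx0 : 0 < -x := by linarith
      have h1 := ((hb.tendsto_left hX h).comp (hltop.const_mul_atTop hx0)).mul (hratio (-x) hx0)
      have hprob := isProbabilityMeasure_cond_nuAlpha hα hp0 hp1 hc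
      have hcompl : ∀ (m : Measure ℝ) [IsProbabilityMeasure m],
          m.real (Set.Ioi x) = 1 - m.real (Set.Iic x) := by
        intro m _
        rw [← Set.compl_Iic, probReal_compl_eq_one_sub measurableSet_Iic]
      have h2 : ((nuAlpha α p)[|absGt c]).real (Set.Iic x) =
          (1 - p) * ((-x) ^ (-α) / c ^ (-α)) := by
        rw [cond_absGt_real_apply, absGt_inter_Iic hx', hν, measureReal_def,
          nuAlpha_Iic hα hp0 hp1 (by linarith), ENNReal.toReal_ofReal
          (mul_nonneg (by linarith) (by positivity)), mul_div_assoc]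
      rw [hcompl, h2]
      refine (h1.const_sub 1).congr fun n => ?_
      have := isProbabilityMeasure_cond_scaledLaw hX h (hl n) c
      rw [hcompl, cond_absGt_real_apply, absGt_inter_Iic hx', scaledLaw_real_absGt hX (hl n),
        scaledLaw_real_Iic hX (hl n)]
      simp only [Function.comp_apply]
      rw [div_mul_div_cancel₀ (hpos _).ne', neg_mul, neg_neg]

/-- The joint distribution of `j` independent large jumps and `j` independent grid times. -/
noncomputable def jumpMeasure (P : Measure Ω) (X : Ω → ℝ) (c l : ℝ) (j n : ℕ) :
    Measure ((Fin j → ℝ) × (Fin j → ℝ)) :=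
  (Measure.pi fun _ => (scaledLaw P X l)[|absGt c]).prod (Measure.pi fun _ => gridMeasure n)

/-- The limit of `jumpMeasure`. -/
noncomputable def jumpLimit (α p c : ℝ) (j : ℕ) : Measure ((Fin j → ℝ) × (Fin j → ℝ)) :=
  (Measure.pi fun _ => (nuAlpha α p)[|absGt c]).prod
    (Measure.pi fun _ => volume.restrict (Set.Icc (0 : ℝ) 1))

/-- Finite products preserve weak convergence, so one jump and one time suffice. The index is
shifted because `gridMeasure 0` is not a probability measure and `l 0` need not be positive. -/
theorem exists_tendsto_jumpMeasure (hX : Measurable X) (h : RegVarRV P X α) (hα : 0 < α)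
    (hb : TailBalance P X p) {c : ℝ} (hc : 0 < c) {l : ℕ → ℝ} (hl : ∀ n, 1 ≤ n → 0 < l n)
    (hltop : Tendsto l atTop atTop) (j : ℕ) :
    ∃ (μ : ℕ → ProbabilityMeasure ((Fin j → ℝ) × (Fin j → ℝ)))
      (ν : ProbabilityMeasure ((Fin j → ℝ) × (Fin j → ℝ))),
      (∀ n, (μ n : Measure _) = jumpMeasure P X c (l (n + 1)) j (n + 1)) ∧
      (ν : Measure _) = jumpLimit α p c j ∧ Tendsto μ atTop (𝓝 ν) := by
  obtain ⟨hp0, hp1, -, -⟩ := id hb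
  let Q : ℕ → ProbabilityMeasure ℝ := fun n => ⟨(scaledLaw P X (l (n + 1)))[|absGt c],
    isProbabilityMeasure_cond_scaledLaw hX h (hl _ (by omega)) c⟩
  let Q' : ProbabilityMeasure ℝ := ⟨(nuAlpha α p)[|absGt c],
    isProbabilityMeasure_cond_nuAlpha hα hp0 hp1 hc⟩
  let L : ℕ → ProbabilityMeasure ℝ := fun n => ⟨gridMeasure (n + 1),
    isProbabilityMeasure_gridMeasure (by omega)⟩
  let L' : ProbabilityMeasure ℝ := ⟨volume.restrict (Set.Icc (0 : ℝ) 1), ⟨by simp⟩⟩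
  have hQ : Tendsto Q atTop (𝓝 Q') := tendsto_probabilityMeasure_of_tendsto_Ioi fun x =>
    tendsto_cond_scaledLaw_real_Ioi hX h hα hb hc (fun n => hl _ (by omega))
      (hltop.comp (tendsto_add_atTop_nat 1)) x
  have hL : Tendsto L atTop (𝓝 L') := tendsto_probabilityMeasure_of_tendsto_Ioi fun x =>
    (tendsto_gridMeasure_real_Ioi x).comp (tendsto_add_atTop_nat 1)
  refine ⟨fun n => (ProbabilityMeasure.pi fun _ : Fin j => Q n).prod
    (ProbabilityMeasure.pi fun _ : Fin j => L n),
    (ProbabilityMeasure.pi fun _ : Fin j => Q').prod (ProbabilityMeasure.pi fun _ : Fin j => L'),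
    fun n => rfl, rfl, ?_⟩
  have h1 := (ProbabilityMeasure.continuous_pi (ι := Fin j) (α := fun _ => ℝ)).tendsto
    (fun _ => Q') |>.comp (tendsto_pi_nhds.mpr fun _ : Fin j => hQ)
  have h2 := (ProbabilityMeasure.continuous_pi (ι := Fin j) (α := fun _ => ℝ)).tendsto
    (fun _ => L') |>.comp (tendsto_pi_nhds.mpr fun _ : Fin j => hL)
  exact (ProbabilityMeasure.continuous_prod.tendsto _).comp (h1.prodMk_nhds h2)

theorem limsup_jumpMeasure_le (hX : Measurable X) (h : RegVarRV P X α) (hα : 0 < α)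
    (hb : TailBalance P X p) {c : ℝ} (hc : 0 < c) {l : ℕ → ℝ} (hl : ∀ n, 1 ≤ n → 0 < l n)
    (hltop : Tendsto l atTop atTop) {j : ℕ} {F : Set ((Fin j → ℝ) × (Fin j → ℝ))}
    (hF : IsClosed F) :
    limsup (fun n => jumpMeasure P X c (l n) j n F) atTop ≤ jumpLimit α p c j F := by
  obtain ⟨μ, ν, hμ, hν, hlim⟩ := exists_tendsto_jumpMeasure hX h hα hb hc hl hltop j
  rw [← limsup_nat_add _ 1, ← hν]
  simp only [← hμ]
  exact ProbabilityMeasure.limsup_measure_closed_le_of_tendsto hlim hF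

theorem le_liminf_jumpMeasure (hX : Measurable X) (h : RegVarRV P X α) (hα : 0 < α)
    (hb : TailBalance P X p) {c : ℝ} (hc : 0 < c) {l : ℕ → ℝ} (hl : ∀ n, 1 ≤ n → 0 < l n)
    (hltop : Tendsto l atTop atTop) {j : ℕ} {G : Set ((Fin j → ℝ) × (Fin j → ℝ))}
    (hG : IsOpen G) :
    jumpLimit α p c j G ≤ liminf (fun n => jumpMeasure P X c (l n) j n G) atTop := by
  obtain ⟨μ, ν, hμ, hν, hlim⟩ := exists_tendsto_jumpMeasure hX h hα hb hc hl hltop j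
  rw [← liminf_nat_add _ 1, ← hν]
  simp only [← hμ]
  exact ProbabilityMeasure.le_liminf_measure_open_of_tendsto hlim hG

end JumpLaw

/-! ### The measures of large jumps -/

/-- Passes between a restricted product and the product of conditioned laws. It serves both the law
of the increments and the infinite measure `nuAlpha`. -/
theorem restrict_pi_eq_smul_pi_cond {j : ℕ} (μ : Measure ℝ) [SigmaFinite μ] {s : Set ℝ}
    (h0 : μ s ≠ 0) (hs : μ s ≠ ∞) :
    (Measure.pi fun _ : Fin j => μ).restrict (Set.univ.pi fun _ => s) =
      (μ s) ^ j • Measure.pi fun _ : Fin j => μ[|s] := by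
  have := cond_isProbabilityMeasure_of_finite h0 hs
  rw [Measure.restrict_pi_pi]
  refine Measure.pi_eq fun t ht => ?_
  rw [Measure.smul_apply, Measure.pi_pi, smul_eq_mul]
  have h1 : ∀ i, μ[|s] (t i) = (μ s)⁻¹ * μ.restrict s (t i) := fun i => rfl
  simp only [h1, Finset.prod_mul_distrib, Finset.prod_const, Finset.card_univ, Fintype.card_fin]
  rw [← mul_assoc, ← mul_pow, ENNReal.mul_inv_cancel h0 hs, one_pow, one_mul]

/-- The jump times of the walk with `n` steps. -/
noncomputable def walkTime (n : ℕ) (k : Fin n) : ℝ := ((k : ℝ) + 1) / n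

theorem walkTime_strictMono (n : ℕ) : StrictMono (walkTime n) := by
  intro i k hik
  have hn : (0 : ℝ) < n := by exact_mod_cast i.pos
  refine div_lt_div_of_pos_right ?_ hn
  have : (i : ℕ) < k := hik
  have : (i : ℝ) < k := by exact_mod_cast this
  linarith

theorem walkTime_mem_Icc {n : ℕ} (k : Fin n) : walkTime n k ∈ Set.Icc (0 : ℝ) 1 := by
  have hn : (0 : ℝ) < n := by exact_mod_cast k.pos
  refine ⟨by unfold walkTime; positivity, ?_⟩
  rw [walkTime, div_le_one hn]
  exact_mod_cast k.2

/-- Expanding the product of sums shows that `j` independent grid times amount to a uniform tuple of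
walk indices, repetitions and all orders included. -/
theorem pi_gridMeasure {n : ℕ} (hn : 1 ≤ n) (j : ℕ) :
    (Measure.pi fun _ : Fin j => gridMeasure n) =
      ((n : ℝ≥0∞) ^ j)⁻¹ • ∑ k : Fin j → Fin n, Measure.dirac (walkTime n ∘ k) := by
  have := isProbabilityMeasure_gridMeasure hn
  refine Measure.pi_eq fun s hs => ?_
  simp only [gridMeasure_apply n (hs _), Finset.prod_mul_distrib, Finset.prod_const,
    Finset.card_univ, Fintype.card_fin]
  rw [Measure.smul_apply, Measure.finsetSum_apply, smul_eq_mul, ENNReal.inv_pow,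
    Finset.prod_univ_sum, Fintype.piFinset_univ]
  congr 1
  refine Finset.sum_congr rfl fun k _ => ?_
  rw [Measure.dirac_apply' _ (MeasurableSet.univ_pi hs)]
  by_cases h : walkTime n ∘ k ∈ Set.univ.pi s
  · rw [Set.indicator_of_mem h]
    refine (Finset.prod_eq_one fun i _ => ?_).symm
    exact Set.indicator_of_mem (h i (Set.mem_univ i)) _
  · rw [Set.indicator_of_notMem h]
    obtain ⟨i, hi⟩ : ∃ i, walkTime n (k i) ∉ s i := by
      by_contra hcon
      push Not at hcon
      exact h fun i _ => hcon i
    exact (Finset.prod_eq_zero (Finset.mem_univ i) (Set.indicator_of_notMem hi _)).symm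

section Law

variable {Ω : Type*} [MeasurableSpace Ω] {P : Measure Ω} [IsProbabilityMeasure P]
  {Z : ℕ → Ω → ℝ} {α p : ℝ}

theorem jumpMeasure_apply {X : Ω → ℝ} (hX : Measurable X) (h : RegVarRV P X α) {l : ℝ} (hl : 0 < l)
    (c : ℝ) (j : ℕ) {n : ℕ} (hn : 1 ≤ n) {B : Set ((Fin j → ℝ) × (Fin j → ℝ))}
    (hB : MeasurableSet B) :
    jumpMeasure P X c l j n B = ((n : ℝ≥0∞) ^ j)⁻¹ * ∑ k : Fin j → Fin n,
      Measure.pi (fun _ : Fin j => (scaledLaw P X l)[|absGt c]) {z | (z, walkTime n ∘ k) ∈ B} := by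
  have := isProbabilityMeasure_cond_scaledLaw hX h hl c
  rw [jumpMeasure, pi_gridMeasure hn, Measure.prod_smul_right, Measure.smul_apply, smul_eq_mul,
    ← Measure.sum_fintype, Measure.prod_sum_right, Measure.sum_fintype, Measure.finsetSum_apply]
  congr 1
  refine Finset.sum_congr rfl fun k _ => ?_
  rw [Measure.prod_dirac, Measure.map_apply measurable_prodMk_right hB]
  rfl

/-- The scaled increments of the walk with indices `k`. -/
noncomputable def jumpsAt (Z : ℕ → Ω → ℝ) (l : ℝ) {j n : ℕ} (k : Fin j → Fin n) (ω : Ω) :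
    Fin j → ℝ :=
  fun i => l⁻¹ * Z (k i) ω

theorem measurable_jumpsAt (hmeas : ∀ i, Measurable (Z i)) (l : ℝ) {j n : ℕ} (k : Fin j → Fin n) :
    Measurable (jumpsAt Z l k) :=
  measurable_pi_lambda _ fun _ => (hmeas _).const_mul _

theorem map_jumpsAt (hmeas : ∀ i, Measurable (Z i)) (hindep : iIndepFun Z P)
    (hident : ∀ i, IdentDistrib (Z i) (Z 0) P P) (l : ℝ) {j n : ℕ} {k : Fin j → Fin n}
    (hk : Function.Injective k) :
    P.map (jumpsAt Z l k) = Measure.pi fun _ : Fin j => scaledLaw P (Z 0) l := by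
  have hinj : Function.Injective fun i => ((k i : Fin n) : ℕ) := Fin.val_injective.comp hk
  have h1 : iIndepFun (fun (i : Fin j) ω => l⁻¹ * Z (k i) ω) P :=
    (hindep.precomp hinj).comp (fun _ x => l⁻¹ * x) fun _ => measurable_const_mul _
  have h2 := (iIndepFun_iff_map_fun_eq_pi_map
    fun i => ((hmeas (k i)).const_mul l⁻¹).aemeasurable).mp h1
  refine h2.trans ?_
  congr 1
  ext1 i
  exact ((hident (k i)).comp (measurable_const_mul l⁻¹)).map_eq

/-- Distinct increments are iid. Requiring all of them to be large contributes the `j`-th power of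
the tail and leaves independent conditioned jumps. -/
theorem measure_jumpsAt (hmeas : ∀ i, Measurable (Z i)) (hindep : iIndepFun Z P)
    (hident : ∀ i, IdentDistrib (Z i) (Z 0) P P) (hRV : RegVarRV P (Z 0) α) {l : ℝ} (hl : 0 < l)
    (c : ℝ) {j n : ℕ} {k : Fin j → Fin n} (hk : Function.Injective k) {S : Set (Fin j → ℝ)}
    (hS : MeasurableSet S) :
    P {ω | (∀ i, jumpsAt Z l k ω i ∈ absGt c) ∧ jumpsAt Z l k ω ∈ S} =
      ENNReal.ofReal (absTail P (Z 0) (c * l)) ^ j *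
        Measure.pi (fun _ : Fin j => (scaledLaw P (Z 0) l)[|absGt c]) S := by
  have := isProbabilityMeasure_scaledLaw (P := P) (hmeas 0) l
  have hsc := scaledLaw_absGt (P := P) (hmeas 0) hl c
  have h0 : scaledLaw P (Z 0) l (absGt c) ≠ 0 := by
    rw [hsc]
    simpa using hRV.absTail_pos (hmeas 0) _
  have hpi : MeasurableSet (Set.univ.pi fun _ : Fin j => absGt c) :=
    MeasurableSet.univ_pi fun _ => measurableSet_absGt c
  have h1 : {ω | (∀ i, jumpsAt Z l k ω i ∈ absGt c) ∧ jumpsAt Z l k ω ∈ S} =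
      jumpsAt Z l k ⁻¹' (S ∩ Set.univ.pi fun _ => absGt c) := by
    ext ω
    simp [and_comm]
  rw [h1, ← Measure.map_apply (measurable_jumpsAt hmeas l k) (hS.inter hpi),
    map_jumpsAt hmeas hindep hident l hk, ← Measure.restrict_apply hS,
    restrict_pi_eq_smul_pi_cond _ h0 (measure_ne_top _ _), Measure.smul_apply, smul_eq_mul, hsc]

/-- The right side is a sum over all tuples of indices; those that are not increasing are dropped.
-/
theorem sum_measure_jumpsAt_le (hmeas : ∀ i, Measurable (Z i)) (hindep : iIndepFun Z P)
    (hident : ∀ i, IdentDistrib (Z i) (Z 0) P P) (hRV : RegVarRV P (Z 0) α) {l : ℝ} (hl : 0 < l)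
    (c : ℝ) {j n : ℕ} (hn : 1 ≤ n) {B : Set ((Fin j → ℝ) × (Fin j → ℝ))} (hB : MeasurableSet B) :
    ∑ k : Fin j → Fin n with StrictMono k,
      P {ω | (∀ i, jumpsAt Z l k ω i ∈ absGt c) ∧ (jumpsAt Z l k ω, walkTime n ∘ k) ∈ B} ≤
      ENNReal.ofReal (n * absTail P (Z 0) (c * l)) ^ j * jumpMeasure P (Z 0) c l j n B := by
  have hn0 : ((n : ℝ≥0∞) ^ j) ≠ 0 := pow_ne_zero _ (by simpa using (by omega : n ≠ 0))
  have hnt : ((n : ℝ≥0∞) ^ j) ≠ ∞ := ENNReal.pow_ne_top (by simp)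
  rw [jumpMeasure_apply (hmeas 0) hRV hl c j hn hB, ENNReal.ofReal_mul n.cast_nonneg,
    ENNReal.ofReal_natCast, mul_pow, mul_right_comm, ← mul_assoc, ENNReal.mul_inv_cancel hn0 hnt,
    one_mul, mul_comm, Finset.mul_sum]
  refine le_trans (Finset.sum_le_sum fun k hk => le_of_eq ?_)
    (Finset.sum_le_sum_of_subset (Finset.filter_subset _ _))
  have hk' : StrictMono k := (Finset.mem_filter.mp hk).2
  exact measure_jumpsAt hmeas hindep hident hRV hl c hk'.injective (measurable_prodMk_right hB)

/-- When `B` only admits increasing times, the dropped tuples contribute nothing, since `walkTime n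
∘ k` increases strictly only if `k` does. -/
theorem le_sum_measure_jumpsAt (hmeas : ∀ i, Measurable (Z i)) (hindep : iIndepFun Z P)
    (hident : ∀ i, IdentDistrib (Z i) (Z 0) P P) (hRV : RegVarRV P (Z 0) α) {l : ℝ} (hl : 0 < l)
    (c : ℝ) {j n : ℕ} (hn : 1 ≤ n) {B : Set ((Fin j → ℝ) × (Fin j → ℝ))} (hB : MeasurableSet B)
    (hmono : ∀ zu ∈ B, StrictMono zu.2) :
    ENNReal.ofReal (n * absTail P (Z 0) (c * l)) ^ j * jumpMeasure P (Z 0) c l j n B ≤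
    ∑ k : Fin j → Fin n with StrictMono k,
      P {ω | (∀ i, jumpsAt Z l k ω i ∈ absGt c) ∧ (jumpsAt Z l k ω, walkTime n ∘ k) ∈ B} := by
  have hn0 : ((n : ℝ≥0∞) ^ j) ≠ 0 := pow_ne_zero _ (by simpa using (by omega : n ≠ 0))
  have hnt : ((n : ℝ≥0∞) ^ j) ≠ ∞ := ENNReal.pow_ne_top (by simp)
  rw [jumpMeasure_apply (hmeas 0) hRV hl c j hn hB, ENNReal.ofReal_mul n.cast_nonneg,
    ENNReal.ofReal_natCast, mul_pow, mul_right_comm, ← mul_assoc, ENNReal.mul_inv_cancel hn0 hnt,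
    one_mul, mul_comm, Finset.mul_sum]
  rw [← Finset.sum_filter_of_ne (p := fun k : Fin j → Fin n => StrictMono k)]
  · refine Finset.sum_le_sum fun k hk => le_of_eq ?_
    have hk' : StrictMono k := (Finset.mem_filter.mp hk).2
    exact (measure_jumpsAt hmeas hindep hident hRV hl c hk'.injective
      (measurable_prodMk_right hB)).symm
  · intro k _ hne
    by_contra hk
    refine hne ?_
    have : {z : Fin j → ℝ | (z, walkTime n ∘ k) ∈ B} = ∅ := by
      refine Set.eq_empty_of_forall_notMem fun z hz => hk ?_
      have h1 : StrictMono (walkTime n ∘ k) := hmono _ hz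
      exact fun a b hab => (walkTime_strictMono n).lt_iff_lt.mp (h1 hab)
    rw [this, measure_empty, mul_zero]

/-- The probability that all increments in `S` are large. -/
theorem measure_forall_mem_absGt (hmeas : ∀ i, Measurable (Z i)) (hindep : iIndepFun Z P)
    (hident : ∀ i, IdentDistrib (Z i) (Z 0) P P) {l : ℝ} (hl : 0 < l) (c : ℝ) (S : Finset ℕ) :
    P {ω | ∀ i ∈ S, l⁻¹ * Z i ω ∈ absGt c} =
      ENNReal.ofReal (absTail P (Z 0) (c * l)) ^ S.card := by
  have h1 : iIndepFun (fun i ω => l⁻¹ * Z i ω) P :=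
    hindep.comp (fun _ x => l⁻¹ * x) fun _ => measurable_const_mul _
  have h2 := h1.measure_inter_preimage_eq_mul S (sets := fun _ => absGt c)
    fun _ _ => measurableSet_absGt c
  have h3 : {ω | ∀ i ∈ S, l⁻¹ * Z i ω ∈ absGt c} =
      ⋂ i ∈ S, (fun ω => l⁻¹ * Z i ω) ⁻¹' absGt c := by
    ext ω
    simp
  rw [h3, h2]
  refine Finset.prod_eq_pow_card fun i _ => ?_
  rw [← scaledLaw_absGt (hmeas 0) hl, scaledLaw,
    Measure.map_apply ((hmeas 0).const_mul _) (measurableSet_absGt c)]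
  exact ((hident i).comp (measurable_const_mul l⁻¹)).measure_mem_eq (measurableSet_absGt c)

end Law

/-! ### The limit measure through conditioned jumps -/

section Limit

variable {α p : ℝ} {j : ℕ}

theorem smul_jumpLimit (hα : 0 < α) (hp0 : 0 ≤ p) (hp1 : p ≤ 1) {c : ℝ} (hc : 0 < c) :
    ENNReal.ofReal (c ^ (-α)) ^ j • jumpLimit α p c j =
      ((Measure.pi fun _ : Fin j => nuAlpha α p).prod volume).restrict
        ((Set.univ.pi fun _ => absGt c) ×ˢ (Set.univ.pi fun _ => Set.Icc (0 : ℝ) 1)) := by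
  have hν := nuAlpha_absGt hα hp0 hp1 hc
  have hc' : 0 < c ^ (-α) := by positivity
  have := isProbabilityMeasure_cond_nuAlpha hα hp0 hp1 hc
  rw [← Measure.prod_restrict, restrict_pi_eq_smul_pi_cond _ (by rw [hν]; simpa using hc')
    (by rw [hν]; exact ENNReal.ofReal_ne_top), hν, Measure.prod_smul_left, volume_pi,
    Measure.restrict_pi_pi]
  rfl

/-- The sets where a time is `0` or `1` or where two times agree are Lebesgue null. The hypothesis
is weak monotonicity because strict inequalities do not survive taking closures. -/
theorem ae_mem_interiorDomain (μ : Measure (Fin j → ℝ)) [SFinite μ] :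
    ∀ᵐ zu ∂(μ.prod (volume : Measure (Fin j → ℝ))),
      Monotone zu.2 → (∀ i, zu.2 i ∈ Set.Icc (0 : ℝ) 1) → zu ∈ interiorDomain j := by
  have h1 : ∀ᵐ u : Fin j → ℝ, (∀ i, u i ≠ 0 ∧ u i ≠ 1) ∧ ∀ i k, i ≠ k → u i ≠ u k := by
    refine (ae_all_iff.mpr fun i => ?_).and (ae_all_iff.mpr fun i => ae_all_iff.mpr fun k => ?_)
    · rw [volume_pi]
      exact (Measure.ae_eval_ne _ i 0).and (Measure.ae_eval_ne _ i 1)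
    · by_cases hik : i = k
      · exact ae_of_all _ fun u h => absurd hik h
      · have h2 : volume ((LinearMap.ker (LinearMap.proj (R := ℝ) (φ := fun _ : Fin j => ℝ) i -
            LinearMap.proj k) : Submodule ℝ (Fin j → ℝ)) : Set (Fin j → ℝ)) = 0 := by
          refine Measure.addHaar_submodule _ _ fun htop => ?_
          have h3 : (Pi.single i 1 : Fin j → ℝ) ∈ LinearMap.ker
              (LinearMap.proj (R := ℝ) (φ := fun _ : Fin j => ℝ) i - LinearMap.proj k) := by
            rw [htop]; trivial
          simp [Ne.symm hik] at h3
        filter_upwards [measure_eq_zero_iff_ae_notMem.mp h2] with u hu _ heq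
        refine hu ?_
        simp [heq]
  have h2 := Measure.quasiMeasurePreserving_snd (μ := μ) (ν := (volume : Measure (Fin j → ℝ)))
  filter_upwards [h2.ae h1] with zu hzu hmono hIcc
  refine ⟨fun i => ⟨lt_of_le_of_ne (hIcc i).1 (Ne.symm (hzu.1 i).1),
    lt_of_le_of_ne (hIcc i).2 (hzu.1 i).2⟩, hmono.strictMono_of_injective fun i k hik => ?_⟩
  by_contra hne
  exact hzu.2 i k hne hik

theorem measurableSet_nonzero_interiorDomain (j : ℕ) :
    MeasurableSet ({zu : (Fin j → ℝ) × (Fin j → ℝ) | ∀ i, zu.1 i ≠ 0} ∩ interiorDomain j) := by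
  refine MeasurableSet.inter ?_ (isOpen_interiorDomain j).measurableSet
  have : {zu : (Fin j → ℝ) × (Fin j → ℝ) | ∀ i, zu.1 i ≠ 0} = ⋂ i, {zu | zu.1 i = 0}ᶜ := by
    ext zu
    simp
  rw [this]
  refine MeasurableSet.iInter fun i => MeasurableSet.compl ?_
  exact measurableSet_eq_fun (by fun_prop) (by fun_prop)

/-- Up to a null set `jumpDomain` may be replaced by its interior times. There `h_j` is continuous,
which supplies the a.e. measurability without which `Measure.map` would be zero. -/
theorem limitMeasure_apply {A : Set SkorohodD} (hA : MeasurableSet A) :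
    limitMeasure α p j A = ((Measure.pi fun _ : Fin j => nuAlpha α p).prod volume)
      ({zu | (∀ i, zu.1 i ≠ 0) ∧ stepFun zu.1 zu.2 ∈ A} ∩ interiorDomain j) := by
  set μ := (Measure.pi fun _ : Fin j => nuAlpha α p).prod (volume : Measure (Fin j → ℝ))
  have hae : jumpDomain j =ᵐ[μ]
      ({zu | ∀ i, zu.1 i ≠ 0} ∩ interiorDomain j : Set ((Fin j → ℝ) × (Fin j → ℝ))) := by
    refine eventuallyEq_set.mpr ?_
    filter_upwards [ae_mem_interiorDomain (Measure.pi fun _ : Fin j => nuAlpha α p)] with zu hzu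
    constructor
    · rintro ⟨h1, h2, h3⟩
      exact ⟨h1, hzu h3.monotone h2⟩
    · rintro ⟨h1, h2, h3⟩
      exact ⟨h1, fun i => Set.Ioo_subset_Icc_self (h2 i), h3⟩
  have haem : AEMeasurable (fun zu : (Fin j → ℝ) × (Fin j → ℝ) => stepFun zu.1 zu.2)
      (μ.restrict ({zu | ∀ i, zu.1 i ≠ 0} ∩ interiorDomain j)) :=
    ((continuousOn_stepFun j).aemeasurable (isOpen_interiorDomain j).measurableSet).mono_measure
      (Measure.restrict_mono Set.inter_subset_right le_rfl)
  rw [limitMeasure, Measure.restrict_congr_set hae, Measure.map_apply_of_aemeasurable haem hA,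
    Measure.restrict_apply' (measurableSet_nonzero_interiorDomain j)]
  congr 1
  ext zu
  simp only [Set.mem_inter_iff, Set.mem_preimage, Set.mem_ofPred_eq]
  tauto

end Limit

/-! ### Comparison of the walk with its large jumps -/

theorem sub_truncAt_of_le {b x : ℝ} (h : |x| ≤ b) : x - truncAt b x = 0 := by
  rw [truncAt, if_pos h, sub_self]

theorem sub_truncAt_of_lt {b x : ℝ} (h : b < |x|) : x - truncAt b x = x := by
  rw [truncAt, if_neg (not_le.mpr h), sub_zero]

/-- No time change is needed: at time `t` the paths differ by the partial sum of the first `⌊t n⌋`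
truncated terms. -/
theorem edist_stepFun_sub_truncAt_le {n : ℕ} {w : ℕ → ℝ} {δ ε : ℝ}
    (hE : ∀ k ≤ n, |∑ i ∈ Finset.range k, truncAt δ (w i)| ≤ ε) :
    edist (stepFun (fun i : Fin n => w i) (walkTime n))
      (stepFun (fun i : Fin n => w i - truncAt δ (w i)) (walkTime n)) ≤ ENNReal.ofReal ε := by
  refine SkorohodD.edist_le_of_forall_abs_le fun t => ?_
  have hk : ⌊(t : ℝ) * n⌋₊ ≤ n := by
    have h1 : ⌊(t : ℝ) * n⌋₊ ≤ ⌊(n : ℝ)⌋₊ :=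
      Nat.floor_le_floor (mul_le_of_le_one_left n.cast_nonneg t.2.2)
    simpa using h1
  refine le_trans (le_of_eq ?_) (hE _ hk)
  congr 1
  rw [stepFun_apply, stepFun_apply, ← Finset.sum_sub_distrib]
  have h1 : ∀ i : Fin n, ((if walkTime n i ≤ (t : ℝ) then w i else 0) -
      if walkTime n i ≤ (t : ℝ) then w i - truncAt δ (w i) else 0) =
      (fun m : ℕ => if m < ⌊(t : ℝ) * n⌋₊ then truncAt δ (w m) else 0) i := by
    intro i
    have hn : (0 : ℝ) < n := by exact_mod_cast i.pos
    have h2 : walkTime n i ≤ (t : ℝ) ↔ (i : ℕ) < ⌊(t : ℝ) * n⌋₊ := by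
      rw [walkTime, div_le_iff₀ hn, ← Nat.succ_le_iff, Nat.le_floor_iff
        (mul_nonneg t.2.1 hn.le)]
      push_cast
      exact Iff.rfl
    by_cases h : walkTime n i ≤ (t : ℝ)
    · simp [h, h2.mp h]
    · simp [h, mt h2.mpr h]
  simp only [h1]
  rw [Fin.sum_univ_eq_sum_range
    (fun m : ℕ => if m < ⌊(t : ℝ) * n⌋₊ then truncAt δ (w m) else 0), ← Finset.sum_filter]
  congr 1
  ext m
  simp only [Finset.mem_filter, Finset.mem_range]
  omega

theorem edist_stepFun_comp_le {j n : ℕ} {w : ℕ → ℝ} {δ ε : ℝ}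
    (hE : ∀ k ≤ n, |∑ i ∈ Finset.range k, truncAt δ (w i)| ≤ ε) {k : Fin j → Fin n}
    (hk : Function.Injective k) (h1 : ∀ i, δ < |w (k i)|) (h2 : ∀ i ∉ Set.range k, |w i| ≤ δ) :
    edist (stepFun (fun i : Fin n => w i) (walkTime n))
      (stepFun (fun i => w (k i)) (walkTime n ∘ k)) ≤ ENNReal.ofReal ε := by
  have h3 := stepFun_eq_comp hk (z := fun i : Fin n => w i - truncAt δ (w i)) (walkTime n)
    fun i hi => sub_truncAt_of_le (h2 i hi)
  have h4 : (fun i : Fin n => w i - truncAt δ (w i)) ∘ k = fun i => w (k i) :=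
    funext fun i => sub_truncAt_of_lt (h1 i)
  rw [h4] at h3
  rw [← h3]
  exact edist_stepFun_sub_truncAt_le hE

theorem walkPath_eq {Ω : Type*} (Z : ℕ → Ω → ℝ) (n : ℕ) (l : ℝ) (ω : Ω) :
    l⁻¹ • walkPath Z n ω = stepFun (fun i : Fin n => l⁻¹ * Z i ω) (walkTime n) :=
  smul_stepFun _ _ _

/-- Jump data with all jumps larger than `c` that lead into `A`. -/
def jumpSet (j : ℕ) (c : ℝ) (A : Set SkorohodD) : Set ((Fin j → ℝ) × (Fin j → ℝ)) :=
  {zu | (∀ i, zu.1 i ∈ absGt c) ∧ StrictMono zu.2 ∧ (∀ i, zu.2 i ∈ Set.Icc (0 : ℝ) 1) ∧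
    stepFun zu.1 zu.2 ∈ A}

theorem le_edist_of_mem_cthickening {j : ℕ} {F : Set SkorohodD} {r ε : ℝ} (hε : 0 ≤ ε)
    (hF : ∀ x ∈ stepAtMost j, ∀ y ∈ F, ENNReal.ofReal r ≤ edist x y) :
    ∀ x ∈ stepAtMost j, ∀ y ∈ Metric.cthickening ε F, ENNReal.ofReal (r - ε) ≤ edist x y := by
  intro x hx y hy
  rw [Metric.mem_cthickening_iff] at hy
  have h1 : ENNReal.ofReal r ≤ edist x y + Metric.infEDist y F := by
    refine le_trans ?_ (Metric.infEDist_le_edist_add_infEDist (x := x) (y := y) (s := F))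
    exact Metric.le_infEDist.mpr fun w hw => hF x hx w hw
  rw [ENNReal.ofReal_sub _ hε, tsub_le_iff_right]
  exact h1.trans (add_le_add le_rfl hy)

section Sandwich

variable {Ω : Type*} {Z : ℕ → Ω → ℝ}

/-- The event that some partial sum of the small increments is large. -/
def smallJumpsBad (Z : ℕ → Ω → ℝ) (n : ℕ) (l δ ε : ℝ) : Set Ω :=
  {ω | ∃ k ≤ n, ε * l < |∑ i ∈ Finset.range k, truncAt (δ * l) (Z i ω)|}

theorem abs_sum_truncAt_le_of_notMem {n : ℕ} {l δ ε : ℝ} (hl : 0 < l) {ω : Ω}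
    (h : ω ∉ smallJumpsBad Z n l δ ε) :
    ∀ k ≤ n, |∑ i ∈ Finset.range k, truncAt δ (l⁻¹ * Z i ω)| ≤ ε := by
  intro k hk
  by_contra hcon
  push Not at hcon
  refine h ⟨k, hk, ?_⟩
  have h1 : ∀ i, truncAt δ (l⁻¹ * Z i ω) = l⁻¹ * truncAt (δ * l) (Z i ω) := by
    intro i
    rw [mul_truncAt (inv_pos.mpr hl)]
    congr 1
    field_simp
  simp only [h1, ← Finset.mul_sum, abs_mul, abs_inv, abs_of_pos hl] at hcon
  rwa [inv_mul_eq_div, lt_div_iff₀ hl] at hcon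

variable [MeasurableSpace Ω] {P : Measure Ω} [IsProbabilityMeasure P]

theorem measure_forall_fin_mem_absGt (hmeas : ∀ i, Measurable (Z i)) (hindep : iIndepFun Z P)
    (hident : ∀ i, IdentDistrib (Z i) (Z 0) P P) {l : ℝ} (hl : 0 < l) (c : ℝ) {n : ℕ}
    (S : Finset (Fin n)) :
    P {ω | ∀ i ∈ S, l⁻¹ * Z i ω ∈ absGt c} =
      ENNReal.ofReal (absTail P (Z 0) (c * l)) ^ S.card := by
  rw [← Finset.card_map Fin.valEmbedding, ← measure_forall_mem_absGt hmeas hindep hident hl]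
  congr 1
  ext ω
  simp

/-- Union bound over the index sets of size `m`, of which there are at most `n ^ m`. -/
theorem measure_card_large_le (hmeas : ∀ i, Measurable (Z i)) (hindep : iIndepFun Z P)
    (hident : ∀ i, IdentDistrib (Z i) (Z 0) P P) {l : ℝ} (hl : 0 < l) (δ : ℝ) (n m : ℕ) :
    P {ω | m ≤ (Finset.univ.filter fun i : Fin n => δ < |l⁻¹ * Z i ω|).card} ≤
      ENNReal.ofReal (n * absTail P (Z 0) (δ * l)) ^ m := by
  set q := ENNReal.ofReal (absTail P (Z 0) (δ * l))
  calc _ ≤ P (⋃ S ∈ Finset.powersetCard m (Finset.univ : Finset (Fin n)),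
        {ω | ∀ i ∈ S, l⁻¹ * Z i ω ∈ absGt δ}) := by
        refine measure_mono fun ω hω => ?_
        obtain ⟨S, hS, hcard⟩ := Finset.exists_subset_card_eq hω
        refine Set.mem_biUnion (x := S) (Finset.mem_coe.mpr
          (Finset.mem_powersetCard.mpr ⟨Finset.subset_univ _, hcard⟩)) fun i hi => ?_
        exact (Finset.mem_filter.mp (hS hi)).2
    _ ≤ ∑ S ∈ Finset.powersetCard m (Finset.univ : Finset (Fin n)),
        P {ω | ∀ i ∈ S, l⁻¹ * Z i ω ∈ absGt δ} := measure_biUnion_finset_le _ _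
    _ = ∑ S ∈ Finset.powersetCard m (Finset.univ : Finset (Fin n)), q ^ m := by
        refine Finset.sum_congr rfl fun S hS => ?_
        rw [measure_forall_fin_mem_absGt hmeas hindep hident hl, (Finset.mem_powersetCard.mp hS).2]
    _ = (n.choose m : ℝ≥0∞) * q ^ m := by simp
    _ ≤ (n : ℝ≥0∞) ^ m * q ^ m := by
        refine mul_le_mul_left ?_ _
        exact_mod_cast Nat.choose_le_pow n m
    _ = _ := by
        rw [ENNReal.ofReal_mul n.cast_nonneg, ENNReal.ofReal_natCast, mul_pow]

/-- Outside the bad event, count the increments larger than `δ`. Fewer than `j` would put the path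
within `ε < r` of `stepAtMost (j - 1)`. If there are exactly `j`, their step function lies within
`ε` of `F`, hence has all jumps at least `r - ε > c`. More than `j` go to the error term. The
closure prepares for the portmanteau theorem. -/
theorem measure_walk_le (hmeas : ∀ i, Measurable (Z i)) (hindep : iIndepFun Z P)
    (hident : ∀ i, IdentDistrib (Z i) (Z 0) P P) {l : ℝ} (hl : 0 < l) {j n : ℕ} (hj : 1 ≤ j)
    {F : Set SkorohodD} {r ε c δ : ℝ} (hε : 0 ≤ ε) (hr : c + ε < r) (hc : 0 < c)
    (hF : ∀ x ∈ stepAtMost (j - 1), ∀ y ∈ F, ENNReal.ofReal r ≤ edist x y) :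
    P {ω | l⁻¹ • walkPath Z n ω ∈ F} ≤
      (∑ k : Fin j → Fin n with StrictMono k,
        P {ω | (∀ i, jumpsAt Z l k ω i ∈ absGt c) ∧ (jumpsAt Z l k ω, walkTime n ∘ k) ∈
          closure (jumpSet j c (Metric.cthickening ε F))}) +
      (P (smallJumpsBad Z n l δ ε) + ENNReal.ofReal (n * absTail P (Z 0) (δ * l)) ^ (j + 1)) := by
  set D : (Fin j → Fin n) → Set Ω := fun k => {ω | (∀ i, jumpsAt Z l k ω i ∈ absGt c) ∧
    (jumpsAt Z l k ω, walkTime n ∘ k) ∈ closure (jumpSet j c (Metric.cthickening ε F))}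
  set I : Ω → Finset (Fin n) := fun ω => Finset.univ.filter fun i : Fin n => δ < |l⁻¹ * Z i ω|
  have hsub : {ω | l⁻¹ • walkPath Z n ω ∈ F} ⊆
      (⋃ k ∈ Finset.univ.filter fun k : Fin j → Fin n => StrictMono k, D k) ∪
        (smallJumpsBad Z n l δ ε ∪ {ω | j + 1 ≤ (I ω).card}) := by
    intro ω hω
    by_cases hbad : ω ∈ smallJumpsBad Z n l δ ε
    · exact Or.inr (Or.inl hbad)
    have hE := abs_sum_truncAt_le_of_notMem hl hbad
    have hω : stepFun (fun i : Fin n => l⁻¹ * Z i ω) (walkTime n) ∈ F := by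
      rw [← walkPath_eq]; exact hω
    rcases lt_trichotomy (I ω).card j with hlt | heq | hgt
    · exfalso
      have h1 := edist_stepFun_sub_truncAt_le (w := fun i => l⁻¹ * Z i ω) hE
      have h2 : stepFun (fun i : Fin n => l⁻¹ * Z i ω - truncAt δ (l⁻¹ * Z i ω)) (walkTime n) ∈
          stepAtMost (j - 1) := by
        refine stepFun_mem_stepAtMost (walkTime_strictMono n) walkTime_mem_Icc ?_
        refine (Finset.card_le_card fun i hi => ?_).trans (show (I ω).card ≤ j - 1 by omega)
        simp only [Finset.mem_filter, Finset.mem_univ, true_and, I] at hi ⊢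
        by_contra hcon
        exact hi (sub_truncAt_of_le (not_lt.mp hcon))
      rw [edist_comm] at h1
      have h3 := (hF _ h2 _ hω).trans h1
      rw [ENNReal.ofReal_le_ofReal_iff hε] at h3
      linarith
    · refine Or.inl ?_
      set k := (I ω).orderEmbOfFin heq
      have hrange : Set.range k = I ω := Finset.range_orderEmbOfFin _ heq
      have h1 : ∀ i, δ < |l⁻¹ * Z (k i) ω| := fun i => by
        have : k i ∈ (I ω : Set (Fin n)) := hrange ▸ Set.mem_range_self i
        simpa [I] using this
      have h2 : ∀ i ∉ Set.range k, |l⁻¹ * Z i ω| ≤ δ := fun i hi => by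
        rw [hrange] at hi
        simpa [I] using hi
      have h3 := edist_stepFun_comp_le (w := fun i => l⁻¹ * Z i ω) hE k.injective h1 h2
      rw [edist_comm] at h3
      have h4 : stepFun (jumpsAt Z l k ω) (walkTime n ∘ k) ∈ Metric.cthickening ε F :=
        Metric.mem_cthickening_of_edist_le _ _ _ _ hω h3
      have hmono : StrictMono (walkTime n ∘ k) := (walkTime_strictMono n).comp k.strictMono
      have hIcc : ∀ i, (walkTime n ∘ k) i ∈ Set.Icc (0 : ℝ) 1 := fun i => walkTime_mem_Icc _
      have h5 : ∀ i, jumpsAt Z l k ω i ∈ absGt c := fun i => by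
        have := le_abs_of_stepFun_mem (le_edist_of_mem_cthickening hε hF) hmono hIcc h4 i
        exact lt_of_lt_of_le (by linarith) this
      refine Set.mem_biUnion (x := (k : Fin j → Fin n)) (Finset.mem_coe.mpr
        (Finset.mem_filter.mpr ⟨Finset.mem_univ _, k.strictMono⟩)) ?_
      exact ⟨h5, subset_closure ⟨h5, hmono, hIcc, h4⟩⟩
    · exact Or.inr (Or.inr hgt)
  refine (measure_mono hsub).trans ((measure_union_le _ _).trans (add_le_add
    (measure_biUnion_finset_le _ _) ((measure_union_le _ _).trans (add_le_add le_rfl ?_))))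
  exact measure_card_large_le hmeas hindep hident hl δ n (j + 1)

/-- On `D k ∩ R k` the range of `k` is exactly the set of indices of increments above `δ`, so these
events are disjoint for distinct increasing `k`. On `D k` outside `R k` some further increment
exceeds `δ`, and summing over at most `n ^ j` tuples and `n` extra indices gives the power `j + 1`.
-/
theorem sum_measure_le_walk (hmeas : ∀ i, Measurable (Z i)) (hindep : iIndepFun Z P)
    (hident : ∀ i, IdentDistrib (Z i) (Z 0) P P) {l : ℝ} (hl : 0 < l) {j n : ℕ}
    {G A : Set SkorohodD} {ε c δ : ℝ} (hδc : δ ≤ c)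
    (hAG : ∀ x, ∀ y ∈ A, edist x y ≤ ENNReal.ofReal ε → x ∈ G)
    {B : Set ((Fin j → ℝ) × (Fin j → ℝ))} (hB : MeasurableSet B)
    (hBA : ∀ zu ∈ B, stepFun zu.1 zu.2 ∈ A) :
    ∑ k : Fin j → Fin n with StrictMono k,
        P {ω | (∀ i, jumpsAt Z l k ω i ∈ absGt c) ∧ (jumpsAt Z l k ω, walkTime n ∘ k) ∈ B} ≤
      P {ω | l⁻¹ • walkPath Z n ω ∈ G} +
      (P (smallJumpsBad Z n l δ ε) + ENNReal.ofReal (n * absTail P (Z 0) (δ * l)) ^ (j + 1)) := by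
  set q := ENNReal.ofReal (absTail P (Z 0) (δ * l))
  set K := Finset.univ.filter fun k : Fin j → Fin n => StrictMono k
  set D : (Fin j → Fin n) → Set Ω := fun k =>
    {ω | (∀ i, jumpsAt Z l k ω i ∈ absGt c) ∧ (jumpsAt Z l k ω, walkTime n ∘ k) ∈ B} with hD
  set R : (Fin j → Fin n) → Set Ω := fun k => {ω | ∀ i, i ∉ Set.range k → |l⁻¹ * Z i ω| ≤ δ}
    with hR
  have hDδ : ∀ k, ∀ ω ∈ D k, ∀ i, δ < |l⁻¹ * Z (k i) ω| := fun k ω hω i =>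
    lt_of_le_of_lt hδc (mem_absGt.mp (hω.1 i))
  have hDmeas : ∀ k, MeasurableSet (D k) := by
    intro k
    have hm := measurable_jumpsAt hmeas l k
    have : D k = (⋂ i, (fun ω => jumpsAt Z l k ω i) ⁻¹' absGt c) ∩
        (fun ω => (jumpsAt Z l k ω, walkTime n ∘ k)) ⁻¹' B := by
      ext ω; simp [hD]
    rw [this]
    exact (MeasurableSet.iInter fun i => ((measurable_pi_apply i).comp hm)
      (measurableSet_absGt c)).inter ((measurable_prodMk_right.comp hm) hB)
  have hRmeas : ∀ k, MeasurableSet (R k) := by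
    intro k
    have : R k = ⋂ (i : Fin n) (_ : i ∉ Set.range k), {ω | |l⁻¹ * Z i ω| ≤ δ} := by
      ext ω; simp [hR]
    rw [this]
    refine MeasurableSet.iInter fun i => MeasurableSet.iInter fun _ => ?_
    exact measurableSet_le ((hmeas i).const_mul _).norm measurable_const
  have hsplit : ∀ k ∈ K, P (D k) ≤ P (D k ∩ R k) + n * q ^ (j + 1) := by
    intro k hk
    have hk' : StrictMono k := (Finset.mem_filter.mp hk).2
    have hsub : D k ⊆ (D k ∩ R k) ∪ ⋃ m ∈ Finset.univ.filter fun m : Fin n => m ∉ Set.range k,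
        {ω | ∀ i ∈ insert m (Finset.univ.image k), l⁻¹ * Z i ω ∈ absGt δ} := by
      intro ω hω
      by_cases hRω : ω ∈ R k
      · exact Or.inl ⟨hω, hRω⟩
      · obtain ⟨m, hm, hmδ⟩ : ∃ m : Fin n, m ∉ Set.range k ∧ δ < |l⁻¹ * Z m ω| := by
          by_contra hcon
          push Not at hcon
          exact hRω hcon
        refine Or.inr (Set.mem_biUnion (x := m) (Finset.mem_coe.mpr
          (Finset.mem_filter.mpr ⟨Finset.mem_univ _, hm⟩)) fun i hi => ?_)
        rcases Finset.mem_insert.mp hi with rfl | hi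
        · exact hmδ
        · obtain ⟨a, -, rfl⟩ := Finset.mem_image.mp hi
          exact hDδ k ω hω a
    refine (measure_mono hsub).trans ((measure_union_le _ _).trans (add_le_add le_rfl ?_))
    refine (measure_biUnion_finset_le _ _).trans ?_
    calc _ = ∑ m ∈ Finset.univ.filter fun m : Fin n => m ∉ Set.range k, q ^ (j + 1) := by
          refine Finset.sum_congr rfl fun m hm => ?_
          rw [measure_forall_fin_mem_absGt hmeas hindep hident hl, Finset.card_insert_of_notMem,
            Finset.card_image_of_injective _ hk'.injective, Finset.card_univ, Fintype.card_fin]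
          simpa using (Finset.mem_filter.mp hm).2
      _ ≤ ∑ m : Fin n, q ^ (j + 1) := Finset.sum_le_sum_of_subset (Finset.filter_subset _ _)
      _ = _ := by simp
  have hdisj : Set.PairwiseDisjoint (K : Set (Fin j → Fin n)) fun k => D k ∩ R k := by
    intro k hk k' hk' hne
    refine Set.disjoint_left.mpr fun ω hω hω' => hne ?_
    have hks : StrictMono k := (Finset.mem_filter.mp hk).2
    have hks' : StrictMono k' := (Finset.mem_filter.mp hk').2
    have key : ∀ k₁ k₂ : Fin j → Fin n, ω ∈ D k₁ → ω ∈ R k₂ → Set.range k₁ ⊆ Set.range k₂ := by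
      rintro k₁ k₂ h1 h2 _ ⟨i, rfl⟩
      by_contra hcon
      exact absurd (hDδ k₁ ω h1 i) (not_lt.mpr (h2 _ hcon))
    exact (hks.range_inj hks').mp ((key k k' hω.1 hω'.2).antisymm (key k' k hω'.1 hω.2))
  have hunion : ∑ k ∈ K, P (D k ∩ R k) ≤
      P {ω | l⁻¹ • walkPath Z n ω ∈ G} + P (smallJumpsBad Z n l δ ε) := by
    rw [← measure_biUnion_finset hdisj fun k _ => (hDmeas k).inter (hRmeas k)]
    refine (measure_mono fun ω hω => ?_).trans (measure_union_le _ _)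
    obtain ⟨k, hk, hωk⟩ := Set.mem_iUnion₂.mp hω
    have hks : StrictMono k := (Finset.mem_filter.mp hk).2
    by_cases hbad : ω ∈ smallJumpsBad Z n l δ ε
    · exact Or.inr hbad
    · refine Or.inl ?_
      have hE := abs_sum_truncAt_le_of_notMem hl hbad
      have h3 := edist_stepFun_comp_le (w := fun i => l⁻¹ * Z i ω) hE hks.injective
        (hDδ k ω hωk.1) hωk.2
      change l⁻¹ • walkPath Z n ω ∈ G
      rw [walkPath_eq]
      exact hAG _ _ (hBA _ hωk.1.2) h3
  calc ∑ k ∈ K, P (D k) ≤ ∑ k ∈ K, (P (D k ∩ R k) + n * q ^ (j + 1)) := Finset.sum_le_sum hsplit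
    _ = ∑ k ∈ K, P (D k ∩ R k) + K.card * (n * q ^ (j + 1)) := by
        rw [Finset.sum_add_distrib, Finset.sum_const, nsmul_eq_mul]
    _ ≤ (P {ω | l⁻¹ • walkPath Z n ω ∈ G} + P (smallJumpsBad Z n l δ ε)) +
        (n : ℝ≥0∞) ^ j * (n * q ^ (j + 1)) := by
        refine add_le_add hunion (mul_le_mul_left ?_ _)
        have : K.card ≤ n ^ j := (Finset.card_filter_le _ _).trans (by simp)
        exact_mod_cast this
    _ = _ := by
        rw [ENNReal.ofReal_mul n.cast_nonneg, ENNReal.ofReal_natCast, mul_pow, add_assoc,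
          pow_succ (n : ℝ≥0∞), mul_assoc]

end Sandwich

/-! ### The limit theorem -/

section Limit

variable {α p : ℝ} {j : ℕ}

/-- Closed conditions pass to the closure, with strict inequalities becoming weak. Membership in `A`
passes wherever `stepFun` is continuous. -/
theorem mem_of_mem_closure_jumpSet {c : ℝ} (hc : 0 < c) {A : Set SkorohodD} (hA : IsClosed A)
    {zu : (Fin j → ℝ) × (Fin j → ℝ)} (h : zu ∈ closure (jumpSet j c A)) :
    (∀ i, zu.1 i ≠ 0) ∧ Monotone zu.2 ∧ (∀ i, zu.2 i ∈ Set.Icc (0 : ℝ) 1) ∧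
      (zu ∈ interiorDomain j → stepFun zu.1 zu.2 ∈ A) := by
  have h1 : ∀ i, c ≤ |zu.1 i| := fun i =>
    closure_minimal (s := jumpSet j c A) (t := {zu | c ≤ |zu.1 i|})
      (fun zu hzu => (mem_absGt.mp (hzu.1 i)).le)
      (isClosed_le continuous_const (by fun_prop)) h
  have h2 : ∀ i k, i ≤ k → zu.2 i ≤ zu.2 k := fun i k hik =>
    closure_minimal (s := jumpSet j c A) (t := {zu | zu.2 i ≤ zu.2 k})
      (fun zu hzu => hzu.2.1.monotone hik) (isClosed_le (by fun_prop) (by fun_prop)) h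
  have h3 : ∀ i, zu.2 i ∈ Set.Icc (0 : ℝ) 1 := fun i =>
    closure_minimal (s := jumpSet j c A) (t := {zu | zu.2 i ∈ Set.Icc (0 : ℝ) 1})
      (fun zu hzu => hzu.2.2.1 i) (isClosed_Icc.preimage (by fun_prop)) h
  refine ⟨fun i hi => ?_, fun i k hik => h2 i k hik, h3, fun hint => ?_⟩
  · have := h1 i
    rw [hi, abs_zero] at this
    linarith
  · have hcont := (continuousOn_stepFun j).continuousAt ((isOpen_interiorDomain j).mem_nhds hint)
    have h4 := mem_closure_image hcont h
    refine closure_minimal ?_ hA h4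
    rintro _ ⟨zu', hzu', rfl⟩
    exact hzu'.2.2.2

theorem smul_jumpLimit_closure_le (hα : 0 < α) (hp0 : 0 ≤ p) (hp1 : p ≤ 1) {c : ℝ} (hc : 0 < c)
    {A : Set SkorohodD} (hA : IsClosed A) :
    ENNReal.ofReal (c ^ (-α)) ^ j * jumpLimit α p c j (closure (jumpSet j c A)) ≤
      limitMeasure α p j A := by
  have h1 := congrArg (fun m => m (closure (jumpSet j c A))) (smul_jumpLimit (j := j) hα hp0 hp1 hc)
  simp only [Measure.smul_apply, smul_eq_mul] at h1
  rw [h1, limitMeasure_apply hA.measurableSet]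
  refine (Measure.restrict_apply_le _ _).trans (measure_mono_ae ?_)
  filter_upwards [ae_mem_interiorDomain (Measure.pi fun _ : Fin j => nuAlpha α p)] with zu hzu hmem
  obtain ⟨h2, h3, h4, h5⟩ := mem_of_mem_closure_jumpSet hc hA hmem
  exact ⟨⟨h2, h5 (hzu h3 h4)⟩, hzu h3 h4⟩

theorem jumpLimit_le_one (hα : 0 < α) (hp0 : 0 ≤ p) (hp1 : p ≤ 1) {c : ℝ} (hc : 0 < c)
    (B : Set ((Fin j → ℝ) × (Fin j → ℝ))) : jumpLimit α p c j B ≤ 1 := by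
  have := isProbabilityMeasure_cond_nuAlpha hα hp0 hp1 hc
  have : IsProbabilityMeasure (volume.restrict (Set.Icc (0 : ℝ) 1)) := ⟨by simp⟩
  have : IsProbabilityMeasure (jumpLimit α p c j) := by unfold jumpLimit; infer_instance
  exact prob_le_one

/-- Interior jump data with all jumps larger than `c` that lead into `A`. -/
def interiorJumpSet (j : ℕ) (c : ℝ) (A : Set SkorohodD) : Set ((Fin j → ℝ) × (Fin j → ℝ)) :=
  {zu | ∀ i, zu.1 i ∈ absGt c} ∩
    (interiorDomain j ∩ (fun zu => stepFun zu.1 zu.2) ⁻¹' A)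

theorem isOpen_interiorJumpSet (c : ℝ) {A : Set SkorohodD} (hA : IsOpen A) :
    IsOpen (interiorJumpSet j c A) := by
  refine IsOpen.inter ?_ ((continuousOn_stepFun j).isOpen_inter_preimage
    (isOpen_interiorDomain j) hA)
  have : {zu : (Fin j → ℝ) × (Fin j → ℝ) | ∀ i, zu.1 i ∈ absGt c} =
      ⋂ i, {zu | c < |zu.1 i|} := by
    ext zu
    simp [mem_absGt]
  rw [this]
  exact isOpen_iInter_of_finite fun i => isOpen_lt continuous_const (by fun_prop)

/-- All jumps of a path in `A` are at least `r > c`, so restricting to jumps above `c` loses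
nothing. -/
theorem limitMeasure_le_smul_jumpLimit (hα : 0 < α) (hp0 : 0 ≤ p) (hp1 : p ≤ 1) {c r : ℝ}
    (hc : 0 < c) (hcr : c < r) {A : Set SkorohodD} (hA : MeasurableSet A)
    (hAr : ∀ x ∈ stepAtMost (j - 1), ∀ y ∈ A, ENNReal.ofReal r ≤ edist x y) :
    limitMeasure α p j A ≤
      ENNReal.ofReal (c ^ (-α)) ^ j * jumpLimit α p c j (interiorJumpSet j c A) := by
  have h1 := congrArg (fun m => m (interiorJumpSet j c A)) (smul_jumpLimit (j := j) hα hp0 hp1 hc)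
  simp only [Measure.smul_apply, smul_eq_mul] at h1
  have hprod : MeasurableSet ((Set.univ.pi fun _ : Fin j => absGt c) ×ˢ
      (Set.univ.pi fun _ : Fin j => Set.Icc (0 : ℝ) 1)) :=
    (MeasurableSet.univ_pi fun _ => measurableSet_absGt c).prod
      (MeasurableSet.univ_pi fun _ => measurableSet_Icc)
  rw [h1, limitMeasure_apply hA, Measure.restrict_apply' hprod]
  refine measure_mono ?_
  rintro zu ⟨⟨-, hmem⟩, hint⟩
  have hIcc : ∀ i, zu.2 i ∈ Set.Icc (0 : ℝ) 1 := fun i => Set.Ioo_subset_Icc_self (hint.1 i)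
  have habs : ∀ i, zu.1 i ∈ absGt c := fun i =>
    hcr.trans_le (le_abs_of_stepFun_mem hAr hint.2 hIcc hmem i)
  exact ⟨⟨habs, hint, hmem⟩, fun i _ => habs i, fun i _ => hIcc i⟩

theorem finiteAwayFrom_limitMeasure (hα : 0 < α) (hp0 : 0 ≤ p) (hp1 : p ≤ 1) {r : ℝ} (hr : 0 < r)
    {A : Set SkorohodD} (hA : MeasurableSet A)
    (hAr : ∀ x ∈ stepAtMost (j - 1), ∀ y ∈ A, ENNReal.ofReal r ≤ edist x y) :
    limitMeasure α p j A < ∞ := by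
  refine (limitMeasure_le_smul_jumpLimit hα hp0 hp1 (half_pos hr) (half_lt_self hr) hA hAr).trans_lt
    (ENNReal.mul_lt_top (ENNReal.pow_lt_top ENNReal.ofReal_lt_top) ?_)
  exact (jumpLimit_le_one hα hp0 hp1 (half_pos hr) _).trans_lt ENNReal.one_lt_top

end Limit

theorem Metric.AreSeparated.exists_ofReal_le {S : Type*} [PseudoEMetricSpace S] {s t : Set S}
    (h : Metric.AreSeparated s t) :
    ∃ r : ℝ, 0 < r ∧ ∀ x ∈ s, ∀ y ∈ t, ENNReal.ofReal r ≤ edist x y := by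
  obtain ⟨r, hr0, hr⟩ := h
  -- The separation constant may be infinite, so it is capped at `1` to obtain a real radius.
  have h1 : min r 1 ≠ ∞ := ne_top_of_le_ne_top ENNReal.one_ne_top (min_le_right _ _)
  refine ⟨(min r 1).toReal, ENNReal.toReal_pos (by simp [hr0]) h1, fun x hx y hy => ?_⟩
  rw [ENNReal.ofReal_toReal h1]
  exact (min_le_left _ _).trans (hr x hx y hy)

section Convergence

variable {Ω : Type*} [MeasurableSpace Ω] {P : Measure Ω} [IsProbabilityMeasure P]
  {Z : ℕ → Ω → ℝ} {α p ρ : ℝ} {lam : ℕ → ℝ}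

/-- The normalization of the limit theorem. -/
noncomputable def normalization (P : Measure Ω) (X : Ω → ℝ) (lam : ℕ → ℝ) (j n : ℕ) : ℝ≥0∞ :=
  ENNReal.ofReal (((n : ℝ) * absTail P X (lam n))⁻¹ ^ j)

/-- The factors `n` cancel and leave the `j`-th power of a ratio of tails; its limit is the factor
in `smul_jumpLimit`. -/
theorem tendsto_normalization_mul {X : Ω → ℝ} (hX : Measurable X) (h : RegVarRV P X α)
    (hltop : Tendsto lam atTop atTop) (j : ℕ) {c : ℝ} (hc : 0 < c) :
    Tendsto (fun n : ℕ => normalization P X lam j n *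
      ENNReal.ofReal (n * absTail P X (c * lam n)) ^ j) atTop
      (𝓝 (ENNReal.ofReal (c ^ (-α)) ^ j)) := by
  have hpos := h.absTail_pos hX
  have h1 := ((h.tendsto_div hX hc).comp hltop).pow j
  have h2 := ENNReal.tendsto_ofReal h1
  rw [ENNReal.ofReal_pow (by positivity)] at h2
  refine h2.congr' ?_
  filter_upwards [eventually_ge_atTop 1] with n hn
  have hn0 : (0 : ℝ) < n := by exact_mod_cast hn
  have hT := hpos (lam n)
  have hTc := hpos (c * lam n)
  rw [normalization, ← ENNReal.ofReal_pow (by positivity), ← ENNReal.ofReal_mul (by positivity),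
    ← mul_pow]
  congr 2
  simp only [Function.comp_apply]
  field_simp

/-- `j` of the `j + 1` tail factors are balanced by the normalization; the remaining one, `n T(δ
λ_n)`, tends to zero. -/
theorem tendsto_normalization_error (hmeas : ∀ i, Measurable (Z i))
    (hα : 0 < α) (hRV : RegVarRV P (Z 0) α)
    (hlam : RegVarSeq lam ρ) (hltop : Tendsto lam atTop atTop)
    (hfin : evariance (Z 0) P < ∞ → 1 / 2 < ρ) (hinf : evariance (Z 0) P = ∞ → 1 < α * ρ)
    {j : ℕ} {δ ε : ℝ} (hδ : 0 < δ)
    (hsmall : Tendsto (fun n : ℕ => ((n : ℝ) * absTail P (Z 0) (lam n))⁻¹ ^ j *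
      P.real (smallJumpsBad Z n (lam n) δ ε)) atTop (𝓝 0)) :
    Tendsto (fun n : ℕ => normalization P (Z 0) lam j n *
      (P (smallJumpsBad Z n (lam n) δ ε) +
        ENNReal.ofReal (n * absTail P (Z 0) (δ * lam n)) ^ (j + 1))) atTop (𝓝 0) := by
  have hpos := hRV.absTail_pos (hmeas 0)
  have h1 := ENNReal.tendsto_ofReal hsmall
  have h2 : Tendsto (fun n : ℕ => (n : ℝ) * absTail P (Z 0) (δ * lam n)) atTop (𝓝 0) := by
    have := (hRV.tendsto_mul_absTail_zero (hmeas 0) hα hfin hinf hlam).mul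
      ((hRV.tendsto_div (hmeas 0) hδ).comp hltop)
    rw [zero_mul] at this
    refine this.congr fun n => ?_
    have := (hpos (lam n)).ne'
    simp only [Function.comp_apply]
    field_simp
  have h3 := ENNReal.Tendsto.mul (tendsto_normalization_mul (hmeas 0) hRV hltop j hδ)
    (Or.inr (by simp)) (ENNReal.tendsto_ofReal h2)
    (Or.inr (ENNReal.pow_ne_top ENNReal.ofReal_ne_top))
  rw [ENNReal.ofReal_zero] at h1 h3
  rw [mul_zero] at h3
  have h4 := h1.add h3
  rw [add_zero] at h4
  refine h4.congr fun n => ?_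
  have hT := hpos (lam n)
  rw [mul_add, pow_succ, ← mul_assoc, ENNReal.ofReal_mul (by positivity), ofReal_measureReal]
  rfl

/-- For fixed `n` the jump times are fixed, and the path depends continuously on the jump sizes. -/
theorem measurable_walk (hmeas : ∀ i, Measurable (Z i)) (l : ℝ) (n : ℕ) :
    Measurable fun ω => l⁻¹ • walkPath Z n ω := by
  simp only [walkPath_eq]
  exact (continuous_stepFun_left _).measurable.comp
    (measurable_pi_lambda _ fun i => (hmeas _).const_mul _)

theorem limsup_walk_le (hmeas : ∀ i, Measurable (Z i)) (hindep : iIndepFun Z P)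
    (hident : ∀ i, IdentDistrib (Z i) (Z 0) P P) (hα : 0 < α) (hRV : RegVarRV P (Z 0) α)
    (hbal : TailBalance P (Z 0) p) (hmean : Integrable (Z 0) P → ∫ ω, Z 0 ω ∂P = 0)
    (hlam : RegVarSeq lam ρ) (hltop : Tendsto lam atTop atTop)
    (hfin : evariance (Z 0) P < ∞ → 1 / 2 < ρ) (hinf : evariance (Z 0) P = ∞ → 1 < α * ρ)
    {j : ℕ} (hj : 1 ≤ j) {F : Set SkorohodD} {r ε : ℝ} (hε : 0 < ε) (hεr : ε < r / 2)
    (hF : ∀ x ∈ stepAtMost (j - 1), ∀ y ∈ F, ENNReal.ofReal r ≤ edist x y) :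
    limsup (fun n => normalization P (Z 0) lam j n *
      P {ω | (lam n)⁻¹ • walkPath Z n ω ∈ F}) atTop ≤
      limitMeasure α p j (Metric.cthickening ε F) := by
  obtain ⟨hp0, hp1, -, -⟩ := id hbal
  have hr : 0 < r := by linarith
  -- Since `ε < r / 2`, this choice ensures `c + ε < r`.
  set c := r / 4 with hc_def
  have hc : 0 < c := by positivity
  obtain ⟨δ, hδ, -, hsmall⟩ := exists_tendsto_small_jumps hmeas hindep hident hα hRV hmean hlam
    hltop hfin hinf j hε hc
  set B := closure (jumpSet j c (Metric.cthickening ε F))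
  set u : ℕ → ℝ≥0∞ := fun n => normalization P (Z 0) lam j n *
    ENNReal.ofReal (n * absTail P (Z 0) (c * lam n)) ^ j
  set v : ℕ → ℝ≥0∞ := fun n => jumpMeasure P (Z 0) c (lam n) j n B
  set e : ℕ → ℝ≥0∞ := fun n => normalization P (Z 0) lam j n *
    (P (smallJumpsBad Z n (lam n) δ ε) +
      ENNReal.ofReal (n * absTail P (Z 0) (δ * lam n)) ^ (j + 1))
  have hu : Tendsto u atTop (𝓝 (ENNReal.ofReal (c ^ (-α)) ^ j)) :=
    tendsto_normalization_mul (hmeas 0) hRV hltop j hc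
  have he : Tendsto e atTop (𝓝 0) :=
    tendsto_normalization_error hmeas hα hRV hlam hltop hfin hinf hδ hsmall
  have hv : limsup v atTop ≤ jumpLimit α p c j B :=
    limsup_jumpMeasure_le (hmeas 0) hRV hα hbal hc hlam.1 hltop isClosed_closure
  calc _ ≤ limsup (u * v + e) atTop := by
        refine limsup_le_limsup ?_
        filter_upwards [eventually_ge_atTop 1] with n hn
        simp only [Pi.add_apply, Pi.mul_apply, u, v, e]
        rw [mul_assoc, ← mul_add]
        refine mul_le_mul_right ?_ _
        refine (measure_walk_le hmeas hindep hident (hlam.1 n hn) hj hε.le (δ := δ) (c := c)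
          (by rw [hc_def]; linarith) hc hF).trans (add_le_add ?_ le_rfl)
        exact sum_measure_jumpsAt_le hmeas hindep hident hRV (hlam.1 n hn) c hn
          isClosed_closure.measurableSet
    _ = limsup (u * v) atTop := ENNReal.limsup_add_of_right_tendsto_zero he _
    -- The product rule for `limsup` needs a nonzero finite limit of `u`, which holds as `c ^ (-α)`
    -- is positive.
    _ ≤ limsup u atTop * limsup v atTop := by
        have hc' : 0 < c ^ (-α) := by positivity
        refine ENNReal.limsup_mul_le' (Or.inl ?_) (Or.inl ?_)
        · rw [hu.limsup_eq]
          exact pow_ne_zero _ (by simpa using hc')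
        · rw [hu.limsup_eq]
          exact ENNReal.pow_ne_top ENNReal.ofReal_ne_top
    _ ≤ ENNReal.ofReal (c ^ (-α)) ^ j * jumpLimit α p c j B := by
        rw [hu.limsup_eq]
        exact mul_le_mul_right hv _
    _ ≤ _ := smul_jumpLimit_closure_le hα hp0 hp1 hc Metric.isClosed_cthickening

theorem le_liminf_walk (hmeas : ∀ i, Measurable (Z i)) (hindep : iIndepFun Z P)
    (hident : ∀ i, IdentDistrib (Z i) (Z 0) P P) (hα : 0 < α) (hRV : RegVarRV P (Z 0) α)
    (hbal : TailBalance P (Z 0) p) (hmean : Integrable (Z 0) P → ∫ ω, Z 0 ω ∂P = 0)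
    (hlam : RegVarSeq lam ρ) (hltop : Tendsto lam atTop atTop)
    (hfin : evariance (Z 0) P < ∞ → 1 / 2 < ρ) (hinf : evariance (Z 0) P = ∞ → 1 < α * ρ)
    {j : ℕ} {A G : Set SkorohodD} {r ε : ℝ} (hε : 0 < ε) (hr : 0 < r) (hA : IsOpen A)
    (hAr : ∀ x ∈ stepAtMost (j - 1), ∀ y ∈ A, ENNReal.ofReal r ≤ edist x y)
    (hAG : ∀ x, ∀ y ∈ A, edist x y ≤ ENNReal.ofReal ε → x ∈ G) :
    limitMeasure α p j A ≤ liminf (fun n => normalization P (Z 0) lam j n *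
      P {ω | (lam n)⁻¹ • walkPath Z n ω ∈ G}) atTop := by
  obtain ⟨hp0, hp1, -, -⟩ := id hbal
  set c := r / 2
  have hc : 0 < c := half_pos hr
  obtain ⟨δ, hδ, hδc, hsmall⟩ := exists_tendsto_small_jumps hmeas hindep hident hα hRV hmean hlam
    hltop hfin hinf j hε hc
  set B := interiorJumpSet j c A
  have hB : IsOpen B := isOpen_interiorJumpSet c hA
  set u : ℕ → ℝ≥0∞ := fun n => normalization P (Z 0) lam j n *
    ENNReal.ofReal (n * absTail P (Z 0) (c * lam n)) ^ j
  set v : ℕ → ℝ≥0∞ := fun n => jumpMeasure P (Z 0) c (lam n) j n B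
  set e : ℕ → ℝ≥0∞ := fun n => normalization P (Z 0) lam j n *
    (P (smallJumpsBad Z n (lam n) δ ε) +
      ENNReal.ofReal (n * absTail P (Z 0) (δ * lam n)) ^ (j + 1))
  set f : ℕ → ℝ≥0∞ := fun n => normalization P (Z 0) lam j n *
      P {ω | (lam n)⁻¹ • walkPath Z n ω ∈ G}
  have hu : Tendsto u atTop (𝓝 (ENNReal.ofReal (c ^ (-α)) ^ j)) :=
    tendsto_normalization_mul (hmeas 0) hRV hltop j hc
  have he : Tendsto e atTop (𝓝 0) :=
    tendsto_normalization_error hmeas hα hRV hlam hltop hfin hinf hδ hsmall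
  have hv : jumpLimit α p c j B ≤ liminf v atTop :=
    le_liminf_jumpMeasure (hmeas 0) hRV hα hbal hc hlam.1 hltop hB
  calc limitMeasure α p j A ≤ ENNReal.ofReal (c ^ (-α)) ^ j * jumpLimit α p c j B :=
        limitMeasure_le_smul_jumpLimit hα hp0 hp1 hc (half_lt_self hr) hA.measurableSet hAr
    _ ≤ liminf u atTop * liminf v atTop := by
        rw [hu.liminf_eq]
        exact mul_le_mul_right hv _
    _ ≤ liminf (u * v) atTop := ENNReal.le_liminf_mul
    _ ≤ liminf (f + e) atTop := by
        refine liminf_le_liminf ?_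
        filter_upwards [eventually_ge_atTop 1] with n hn
        simp only [Pi.add_apply, Pi.mul_apply, u, v, e, f]
        rw [mul_assoc, ← mul_add]
        refine mul_le_mul_right ?_ _
        refine le_trans ?_ (sum_measure_le_walk hmeas hindep hident (hlam.1 n hn) hδc hAG
          hB.measurableSet fun zu hzu => hzu.2.2)
        exact le_sum_measure_jumpsAt hmeas hindep hident hRV (hlam.1 n hn) c hn
          hB.measurableSet fun zu hzu => hzu.2.1.2
    _ = liminf f atTop := ENNReal.liminf_add_of_right_tendsto_zero he _

end Convergence

theorem theorem3p5 {Ω : Type*} [MeasurableSpace Ω] (P : Measure Ω) [IsProbabilityMeasure P]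
    (Z : ℕ → Ω → ℝ) (hmeas : ∀ i, Measurable (Z i)) (hindep : iIndepFun Z P)
    (hident : ∀ i, IdentDistrib (Z i) (Z 0) P P)
    (α p ρ : ℝ) (hα : 0 < α)
    (hRV : RegVarRV P (Z 0) α) (hbal : TailBalance P (Z 0) p)
    (hmean : Integrable (Z 0) P → ∫ ω, Z 0 ω ∂P = 0)
    (lam : ℕ → ℝ) (hlam : RegVarSeq lam ρ) (hlam_top : Tendsto lam atTop atTop)
    (hfin : evariance (Z 0) P < ∞ → 1 / 2 < ρ)
    (hinf : evariance (Z 0) P = ∞ → 1 < α * ρ)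
    (j : ℕ) (hj : 1 ≤ j) :
    TendstoMO (stepAtMost (j - 1))
      (fun n => ENNReal.ofReal (((n : ℝ) * P.real {ω | lam n < |Z 0 ω|})⁻¹ ^ j) •
        P.map (fun ω => (lam n)⁻¹ • walkPath Z n ω))
      (limitMeasure α p j) := by
  have hmap : ∀ (n : ℕ) (A : Set SkorohodD), MeasurableSet A →
      (ENNReal.ofReal (((n : ℝ) * P.real {ω | lam n < |Z 0 ω|})⁻¹ ^ j) •
        P.map (fun ω => (lam n)⁻¹ • walkPath Z n ω)) A =
      normalization P (Z 0) lam j n * P {ω | (lam n)⁻¹ • walkPath Z n ω ∈ A} := by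
    intro n A hA
    rw [Measure.smul_apply, Measure.map_apply (measurable_walk hmeas _ _) hA]
    rfl
  obtain ⟨hp0, hp1, -, -⟩ := id hbal
  refine ⟨fun n A hA _ => ?_, fun A hA hsep => ?_, fun F hF hsep => ?_, fun G hG hsep => ?_⟩
  · rw [hmap n A hA]
    exact ENNReal.mul_lt_top ENNReal.ofReal_lt_top (measure_lt_top _ _)
  · obtain ⟨r, hr, hrA⟩ := hsep.exists_ofReal_le
    exact finiteAwayFrom_limitMeasure hα hp0 hp1 hr hA hrA
  · obtain ⟨r, hr, hrF⟩ := hsep.exists_ofReal_le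
    simp only [hmap _ F hF.measurableSet]
    have hfinite : limitMeasure α p j (Metric.cthickening (r / 2) F) ≠ ∞ :=
      (finiteAwayFrom_limitMeasure hα hp0 hp1 (r := r - r / 2) (by linarith)
        Metric.isClosed_cthickening.measurableSet
        (le_edist_of_mem_cthickening (by positivity) hrF)).ne
    -- Continuity from above: the thickenings of the closed set `F` decrease to `F`, and the one of
    -- radius `r / 2`, still away from `stepAtMost (j - 1)`, has finite mass.
    have hlim := tendsto_measure_cthickening_of_isClosed ⟨r / 2, by positivity, hfinite⟩ hF
    refine ge_of_tendsto (hlim.mono_left (nhdsWithin_le_nhds (s := Set.Ioi 0))) ?_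
    filter_upwards [Ioo_mem_nhdsGT (half_pos hr)] with ε hε
    exact limsup_walk_le hmeas hindep hident hα hRV hbal hmean hlam hlam_top hfin hinf hj hε.1 hε.2
      hrF
  · obtain ⟨r, hr, hrG⟩ := hsep.exists_ofReal_le
    simp only [hmap _ G hG.measurableSet]
    -- Points farther than `1 / (m + 1)` from the complement of `G`: open sets increasing to `G`,
    -- each with a margin that absorbs the path error `ε = 1 / (m + 1)`.
    set A : ℕ → Set SkorohodD := fun m =>
      {x | ENNReal.ofReal (1 / ((m : ℝ) + 1)) < Metric.infEDist x Gᶜ} with hA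
    have hAG : ∀ m x, ∀ y ∈ A m, edist x y ≤ ENNReal.ofReal (1 / ((m : ℝ) + 1)) → x ∈ G := by
      intro m x y hy hxy
      by_contra hx
      have hy : ENNReal.ofReal (1 / ((m : ℝ) + 1)) < Metric.infEDist y Gᶜ := hy
      have h1 : Metric.infEDist y Gᶜ ≤ edist y x := Metric.infEDist_le_edist_of_mem hx
      rw [edist_comm] at h1
      exact absurd (hy.trans_le (h1.trans hxy)) (lt_irrefl _)
    have hAsub : ∀ m, A m ⊆ G := fun m y hy => hAG m y y hy (by simp)
    have hunion : G = ⋃ m, A m := by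
      refine Set.Subset.antisymm (fun x hx => ?_) (Set.iUnion_subset hAsub)
      have h1 : 0 < Metric.infEDist x Gᶜ := by
        rw [pos_iff_ne_zero]
        intro h0
        exact (Metric.mem_iff_infEDist_zero_of_closed hG.isClosed_compl).mpr h0 hx
      obtain ⟨m, hm⟩ : ∃ m : ℕ, ENNReal.ofReal (1 / ((m : ℝ) + 1)) < Metric.infEDist x Gᶜ := by
        have h2 := ENNReal.tendsto_ofReal (tendsto_one_div_add_atTop_nhds_zero_nat (𝕜 := ℝ))
        rw [ENNReal.ofReal_zero] at h2
        exact (h2.eventually (eventually_lt_nhds h1)).exists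
      exact Set.mem_iUnion.mpr ⟨m, hm⟩
    have hmono : Monotone A := by
      intro m m' hmm x hx
      refine lt_of_le_of_lt (ENNReal.ofReal_le_ofReal ?_) hx
      exact Nat.one_div_le_one_div hmm
    have hmeasure : limitMeasure α p j G = ⨆ m, limitMeasure α p j (A m) := by
      rw [← hmono.measure_iUnion, ← hunion]
    rw [hmeasure]
    refine iSup_le fun m => ?_
    exact le_liminf_walk hmeas hindep hident hα hRV hbal hmean hlam hlam_top hfin hinf
      (by positivity) hr (isOpen_lt continuous_const Metric.continuous_infEDist)
      (fun x hx y hy => hrG x hx y (hAsub m hy)) (hAG m)
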